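/- **Proposition.** Let $n\ge 1$ and $K=\mathbb Q(q,t)$. For $a,b\in K$ let $\langle\cdot,\cdot\rangle_{a,b}$ be the $K$-bilinear form on the ring of symmetric functions $\Lambda=K[p_1,p_2,\dots]$ with $\langle p_\lambda,p_\mu\rangle_{a,b}=\delta_{\lambda\mu}\,z_\lambda\prod_{i=1}^{\ell(\lambda)}\frac{1-a^{\lambda_i}}{1-b^{\lambda_i}}$, where $z_\lambda=\prod_{i\ge1} i^{m_i(\lambda)}m_i(\lambda)!$ and $m_i(\lambda)$ is the multiplicity of $i$ in $\lambda$. The Macdonald polynomials $\{P^{(a,b)}_\lambda\}_\lambda$ are the unique basis of $\Lambda$ such that (1) $P^{(a,b)}_\lambda-m_\lambda$ is a linear combination of monomial symmetric functions $m_\mu$ with $\mu<\lambda$ in dominance order ($\mu\le\lambda$ iff $\mu_1+\dots+\mu_j\le\lambda_1+\dots+\lambda_j$ for all $j$), and (2) $\langle P^{(a,b)}_\lambda,P^{(a,b)}_\mu\rangle_{a,b}=0$ if $\lambda\ne\mu$. Consider multi-symmetric functions over $K$ in infinite alphabets $x^{(1)},\dots,x^{(n)}$. For an $n$-tuple of partitions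 $\boldsymbol\lambda=(\lambda^{(1)},\dots,\lambda^{(n)})$ put $$m_{\boldsymbol\lambda}=\prod_{k=1}^n m_{\lambda^{(k)}}(x^{(k)}),\qquad p_{\boldsymbol\lambda}=\prod_{k=1}^n p_{\lambda^{(k)}}(x^{(1)},\dots,x^{(k)}),$$ and let $\boldsymbol\mu\le\boldsymbol\lambda$ mean that $\sum_{i<k}|\mu^{(i)}|+\mu^{(k)}_1+\dots+\mu^{(k)}_j\le\sum_{i<k}|\lambda^{(i)}|+\lambda^{(k)}_1+\dots+\lambda^{(k)}_j$ for all $j,k$. Let $\langle\!\langle\cdot,\cdot\rangle\!\rangle_{q,t,n}$ be the bilinear form with $$\langle\!\langle p_{\boldsymbol\lambda},p_{\boldsymbol\mu}\rangle\!\rangle_{q,t,n}=\delta_{\boldsymbol\lambda\boldsymbol\mu}\;q^{(n-1)\sum_k|\lambda^{(k)}|-\sum_k(k-1)|\lambda^{(k)}|}\;z_{\lambda^{(1)}}\cdots z_{\lambda^{(n)}}\prod_{i=1}^{\ell(\lambda^{(n)})}\frac{1-q^{\lambda^{(n)}_i}}{1-t^{\lambda^{(n)}_i}} .$$ Then there is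 a unique basis $\{P^{(q,t)}_{\boldsymbol\lambda}\}_{\boldsymbol\lambda}$ of the space of multi-symmetric functions (the multi-Macdonald polynomials) such that (1) $P^{(q,t)}_{\boldsymbol\lambda}-m_{\boldsymbol\lambda}$ is a linear combination of $m_{\boldsymbol\mu}$ with $\boldsymbol\mu<\boldsymbol\lambda$, and (2) $\langle\!\langle P^{(q,t)}_{\boldsymbol\lambda},P^{(q,t)}_{\boldsymbol\mu}\rangle\!\rangle_{q,t,n}=0$ if $\boldsymbol\lambda\neq\boldsymbol\mu$; the Macdonald polynomials for each of the pairs of parameters below exist and are unique; and for every $\boldsymbol\lambda$, in plethystic notation, $$P_{\boldsymbol\lambda}^{(q,t)}(x^{(1)},\dots,x^{(n)})=P_{\lambda^{(1)}}^{(q,\,q^{n-1}t)}[A_{n-1}]\;\prod_{k=2}^{n}P_{\lambda^{(k)}}^{(q^{n-k+1}t,\;q^{n-k}t)}[A_{n-k}],$$ where, with $X^{(i)}=x^{(i)}_1+x^{(i)}_2+\cdots$, $$A_0=X^{(n)},\qquad A_i=X^{(n-i)}+\frac{q(1-q^{i-1}t)}{1-q^it}\,A_{i-1}\quad(1\le i\le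 n-1).$$ Here $f\mapsto f[A]$ is the $K$-algebra homomorphism that sends $p_r$ to $p_r[A]$, and $p_r[A]$ is obtained from $A$ by replacing $q$, $t$ and every variable $x^{(i)}_j$ by its $r$-th power. -/

import Mathlib

namespace MultiMacdonald

open scoped Nat

/-! ### The field of coefficients -/

/-- The field `ℚ(q,t)` of rational functions in two indeterminates. -/
abbrev K : Type := FractionRing (MvPolynomial (Fin 2) ℚ)

/-- The indeterminate `q`. -/
noncomputable def q : K := algebraMap (MvPolynomial (Fin 2) ℚ) K (MvPolynomial.X 0)

/-- The indeterminate `t`. -/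
noncomputable def t : K := algebraMap (MvPolynomial (Fin 2) ℚ) K (MvPolynomial.X 1)

/-- For `r ≥ 1`, the endomorphism `c(q,t) ↦ c(q^r,t^r)` of `ℚ(q,t)`. -/
noncomputable def adamsK (r : ℕ+) : K →+* K :=
  IsFractionRing.map (A := MvPolynomial (Fin 2) ℚ) (B := MvPolynomial (Fin 2) ℚ)
    (j := (MvPolynomial.expand (r : ℕ) :
      MvPolynomial (Fin 2) ℚ →ₐ[ℚ] MvPolynomial (Fin 2) ℚ).toRingHom)
    (MvPolynomial.expand_injective r.pos)

theorem adamsK_q (r : ℕ+) : adamsK r q = q ^ (r : ℕ) := by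
  simp [adamsK, q, IsFractionRing.map, IsLocalization.map_eq]

theorem adamsK_t (r : ℕ+) : adamsK r t = t ^ (r : ℕ) := by
  simp [adamsK, t, IsFractionRing.map, IsLocalization.map_eq]

/-! ### Partitions and multi-partitions -/

/-- A partition, of any degree: a finite multiset of positive integers, its non-zero parts. -/
abbrev Par : Type := Multiset ℕ+

/-- The degree `|λ|`. -/
def Par.size (la : Par) : ℕ := (la.map (fun r : ℕ+ => (r : ℕ))).sum

/-- `λ_1 + ⋯ + λ_j`, where `λ_1 ≥ λ_2 ≥ ⋯` are the parts followed by zeros. -/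
def Par.partialSum (la : Par) (j : ℕ) : ℕ :=
  (((la.sort (· ≥ ·)).take j).map (fun r : ℕ+ => (r : ℕ))).sum

/-- Dominance: `μ ≤ λ`. -/
def Par.Dominated (mu la : Par) : Prop := ∀ j : ℕ, mu.partialSum j ≤ la.partialSum j

/-- `z_λ = ∏_i i^{m_i} m_i!`, where `m_i` is the multiplicity of `i` in `λ`. -/
def Par.z (la : Par) : ℕ :=
  ∏ i ∈ la.toFinset, (i : ℕ) ^ la.count i * (la.count i)!

/-- `∏_i (1 - a^{λ_i}) / (1 - b^{λ_i})`, the product being over the non-zero parts of `λ`. -/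
noncomputable def Par.ratio (a b : K) (la : Par) : K :=
  (la.map (fun r : ℕ+ => (1 - a ^ (r : ℕ)) / (1 - b ^ (r : ℕ)))).prod

/-- Multi-partitions `(λ^{(1)}, …, λ^{(n)})`; the component `λ^{(k)}` has index `k - 1`. -/
abbrev MultiPar (n : ℕ) : Type := Fin n → Par

/-- Dominance on multi-partitions: `μ ≤ λ`. -/
def MultiPar.Dominated {n : ℕ} (mu la : MultiPar n) : Prop :=
  ∀ (k : Fin n) (j : ℕ),
    (∑ i ∈ Finset.Iio k, (mu i).size) + (mu k).partialSum j ≤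
      (∑ i ∈ Finset.Iio k, (la i).size) + (la k).partialSum j

/-- The exponent `(n-1)|α| - n(α)` for `α = (|λ^{(1)}|, …, |λ^{(n)}|)`, with
`n(α) = ∑_k (k-1) α_k`. -/
def MultiPar.qExponent {n : ℕ} (la : MultiPar n) : ℤ :=
  ((n : ℤ) - 1) * (∑ k, ((la k).size : ℤ)) - ∑ k : Fin n, ((k : ℕ) : ℤ) * ((la k).size : ℤ)

/-- `q^{(n-1)|α| - n(α)} z_{λ^{(1)}} ⋯ z_{λ^{(n)}} ∏_i (1 - q^{λ_i^{(n)}}) / (1 - t^{λ_i^{(n)}})`. -/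
noncomputable def MultiPar.zqt {n : ℕ} (la : MultiPar n) : K :=
  q ^ la.qExponent * (∏ k, ((la k).z : K)) *
    ∏ k : Fin n, if (k : ℕ) + 1 = n then (la k).ratio q t else 1

/-! ### Monomial and power-sum functions as power series -/

/-- The monomial symmetric function `m_λ` in the infinite set `S` of variables: the sum of all
monomials in these variables whose non-zero exponents are the parts of `λ`. -/
noncomputable def monomialSeries {σ : Type} (S : Set σ) (la : Par) : MvPowerSeries σ K :=
  open Classical in fun e : σ →₀ ℕ =>
    if (∀ v ∈ e.support, v ∈ S) ∧
      e.support.val.map (fun v => e v) = la.map (fun r : ℕ+ => (r : ℕ)) then 1 else 0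

/-- The power sum `p_r = ∑_{v ∈ S} v^r` in the set `S` of variables. -/
noncomputable def powerSumSeries {σ : Type} (S : Set σ) (r : ℕ+) : MvPowerSeries σ K :=
  open Classical in fun e : σ →₀ ℕ =>
    if ∃ v ∈ S, e = Finsupp.single v (r : ℕ) then 1 else 0

/-! ### Symmetric functions and the usual Macdonald polynomials -/

/-- The ring of symmetric functions `ℚ(q,t)[p_1, p_2, …]`; the variable `X r` is `p_r`. -/
abbrev Sym : Type := MvPolynomial ℕ+ K

/-- A symmetric function as a power series in `x_1, x_2, …`. -/
noncomputable def Sym.toSeries : Sym →ₐ[K] MvPowerSeries ℕ K :=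
  MvPolynomial.aeval (fun r : ℕ+ => powerSumSeries Set.univ r)

/-- `p_λ = ∏_i p_{λ_i}`. -/
noncomputable def Sym.p (la : Par) : Sym := (la.map (fun r => (MvPolynomial.X r : Sym))).prod

theorem Sym.p_eq_monomial (la : Par) :
    Sym.p la = MvPolynomial.monomial (Multiset.toFinsupp la) 1 := by
  induction la using Multiset.induction_on with
  | empty => simp [Sym.p]
  | cons a s ih =>
    rw [← Multiset.singleton_add, Multiset.toFinsupp_add, Multiset.toFinsupp_singleton]
    simp only [Sym.p, Multiset.map_add, Multiset.map_singleton, Multiset.prod_add,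
      Multiset.prod_singleton] at ih ⊢
    rw [ih, MvPolynomial.X, MvPolynomial.monomial_mul, one_mul]

/-- The basis `(p_λ)_λ` of the ring of symmetric functions. -/
noncomputable def Sym.pBasis : Module.Basis Par K Sym :=
  (MvPolynomial.basisMonomials ℕ+ K).reindex Multiset.toFinsupp.symm.toEquiv

theorem Sym.pBasis_apply (la : Par) : Sym.pBasis la = Sym.p la := by
  rw [Sym.p_eq_monomial]
  simp [Sym.pBasis]

/-- The scalar product with parameters `a, b`:
`⟨p_λ, p_μ⟩ = δ_{λ μ} z_λ ∏_i (1 - a^{λ_i}) / (1 - b^{λ_i})`. -/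
noncomputable def Sym.scalar (a b : K) : Sym →ₗ[K] Sym →ₗ[K] K :=
  Sym.pBasis.constr K fun la =>
    Sym.pBasis.constr K fun mu => if la = mu then (la.z : K) * la.ratio a b else 0

theorem Sym.scalar_p (a b : K) (la mu : Par) :
    Sym.scalar a b (Sym.p la) (Sym.p mu) = if la = mu then (la.z : K) * la.ratio a b else 0 := by
  rw [← Sym.pBasis_apply, ← Sym.pBasis_apply, Sym.scalar, Module.Basis.constr_basis,
    Module.Basis.constr_basis]

/-- `P` is a basis of the ring of symmetric functions that satisfies the two defining properties
of the Macdonald polynomials with parameters `a, b`. -/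
structure IsMacdonald (a b : K) (P : Par → Sym) : Prop where
  linearIndependent : LinearIndependent K P
  span_eq_top : Submodule.span K (Set.range P) = ⊤
  triangular : ∀ la : Par,
    Sym.toSeries (P la) - monomialSeries Set.univ la ∈
      Submodule.span K (monomialSeries Set.univ '' {mu : Par | mu.Dominated la ∧ mu ≠ la})
  orthogonal : ∀ la mu : Par, la ≠ mu → Sym.scalar a b (P la) (P mu) = 0

open Classical in
/-- The Macdonald polynomials `P_λ^{(a,b)}`: the unique basis with these properties
(and zero for parameters for which there is none). -/
noncomputable def macdonald (a b : K) : Par → Sym :=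
  if h : ∃ P, IsMacdonald a b P then h.choose else 0

/-! ### Multi-symmetric functions and the multi-Macdonald polynomials -/

/-- The ring of multi-symmetric functions in the alphabets `x^{(1)}, …, x^{(n)}`; the variable
`X (k, r)` is `p_r(x^{(k+1)})`. -/
abbrev MultiSym (n : ℕ) : Type := MvPolynomial (Fin n × ℕ+) K

/-- The alphabet `x^{(k+1)}` in the variables `(i, j)`, which stand for `x^{(i+1)}_{j+1}`. -/
def alphabet {n : ℕ} (k : Fin n) : Set (Fin n × ℕ) := {v | v.1 = k}

/-- A multi-symmetric function as a power series in the variables `x^{(k)}_j`. -/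
noncomputable def MultiSym.toSeries (n : ℕ) : MultiSym n →ₐ[K] MvPowerSeries (Fin n × ℕ) K :=
  MvPolynomial.aeval (fun v : Fin n × ℕ+ => powerSumSeries (alphabet v.1) v.2)

/-- `m_λ(x^{(1)}, …, x^{(n)}) = m_{λ^{(1)}}(x^{(1)}) ⋯ m_{λ^{(n)}}(x^{(n)})`. -/
noncomputable def multiMonomialSeries {n : ℕ} (la : MultiPar n) : MvPowerSeries (Fin n × ℕ) K :=
  ∏ k : Fin n, monomialSeries (alphabet k) (la k)

/-- `p_r(x^{(1)}, …, x^{(k+1)})`, the power sum in the union of the first alphabets. -/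
noncomputable def MultiSym.pUnion {n : ℕ} (k : Fin n) (r : ℕ+) : MultiSym n :=
  ∑ i ∈ Finset.Iic k, MvPolynomial.X (i, r)

/-- `p_λ = p_{λ^{(1)}}(x^{(1)}) p_{λ^{(2)}}(x^{(1)}, x^{(2)}) ⋯ p_{λ^{(n)}}(x^{(1)}, …, x^{(n)})`. -/
noncomputable def MultiSym.p {n : ℕ} (la : MultiPar n) : MultiSym n :=
  ∏ k : Fin n, ((la k).map (fun r => MultiSym.pUnion k r)).prod

/-- The difference `p_r(x^{(1)}, …, x^{(k+1)}) - p_r(x^{(1)}, …, x^{(k)})` with each power sum of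
a union of alphabets replaced by a variable. -/
noncomputable def MultiSym.pDiff {n : ℕ} (k : Fin n) (r : ℕ+) : MultiSym n :=
  MvPolynomial.X (k, r) -
    if h : 0 < (k : ℕ) then MvPolynomial.X (⟨(k : ℕ) - 1, by omega⟩, r) else 0

theorem MultiSym.sum_Iic_diff {M : Type*} [AddCommGroup M] {n : ℕ} (f : Fin n → M) (k : Fin n) :
    ∑ i ∈ Finset.Iic k, (f i - if h : 0 < (i : ℕ) then f ⟨(i : ℕ) - 1, by omega⟩ else 0) = f k := by
  obtain ⟨k, hk⟩ := k
  induction k with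
  | zero =>
    have : Finset.Iic (⟨0, hk⟩ : Fin n) = {⟨0, hk⟩} := by
      ext i; simp [Fin.le_def, Fin.ext_iff]
    rw [this]; simp
  | succ k ih =>
    have : Finset.Iic (⟨k + 1, hk⟩ : Fin n) =
        insert ⟨k + 1, hk⟩ (Finset.Iic (⟨k, by omega⟩ : Fin n)) := by
      ext i; simp only [Finset.mem_Iic, Finset.mem_insert, Fin.le_def, Fin.ext_iff]; omega
    rw [this, Finset.sum_insert (by simp [Fin.le_def]), ih (by omega)]
    simp

theorem MultiSym.sum_Iic_sub {M : Type*} [AddCommGroup M] {n : ℕ} (f : Fin n → M) (k : Fin n) :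
    ∑ i ∈ Finset.Iic k, f i -
      (if h : 0 < (k : ℕ) then ∑ i ∈ Finset.Iic (⟨(k : ℕ) - 1, by omega⟩ : Fin n), f i else 0) =
        f k := by
  obtain ⟨k, hk⟩ := k
  cases k with
  | zero =>
    have : Finset.Iic (⟨0, hk⟩ : Fin n) = {⟨0, hk⟩} := by
      ext i; simp [Fin.le_def, Fin.ext_iff]
    rw [this]; simp
  | succ k =>
    have : Finset.Iic (⟨k + 1, hk⟩ : Fin n) =
        insert ⟨k + 1, hk⟩ (Finset.Iic (⟨k, by omega⟩ : Fin n)) := by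
      ext i; simp only [Finset.mem_Iic, Finset.mem_insert, Fin.le_def, Fin.ext_iff]; omega
    rw [this, Finset.sum_insert (by simp [Fin.le_def])]
    simp

/-- The change of generators `p_r(x^{(k)}) ↦ p_r(x^{(1)}, …, x^{(k)})`, an automorphism. -/
noncomputable def MultiSym.unionEquiv (n : ℕ) : MultiSym n ≃ₐ[K] MultiSym n :=
  AlgEquiv.ofAlgHom
    (MvPolynomial.aeval (fun v : Fin n × ℕ+ => MultiSym.pUnion v.1 v.2))
    (MvPolynomial.aeval (fun v : Fin n × ℕ+ => MultiSym.pDiff v.1 v.2))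
    (by
      ext1 v
      obtain ⟨k, r⟩ := v
      have h := MultiSym.sum_Iic_sub
        (fun i : Fin n => (MvPolynomial.X (i, r) : MultiSym n)) k
      simp only [AlgHom.comp_apply, MvPolynomial.aeval_X, AlgHom.id_apply, MultiSym.pDiff, map_sub]
      split_ifs at h ⊢ <;> simpa [MultiSym.pUnion] using h)
    (by
      ext1 v
      obtain ⟨k, r⟩ := v
      have h := MultiSym.sum_Iic_diff
        (fun i : Fin n => (MvPolynomial.X (i, r) : MultiSym n)) k
      simpa [MultiSym.pUnion, MultiSym.pDiff] using h)

/-- Multi-partitions as exponents of monomials in the variables `X (k, r)`. -/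
noncomputable def MultiPar.exponentEquiv (n : ℕ) : ((Fin n × ℕ+) →₀ ℕ) ≃ MultiPar n :=
  (Finsupp.curryEquiv.trans Finsupp.equivFunOnFinite).trans
    (Equiv.piCongrRight fun _ => Multiset.toFinsupp.symm.toEquiv)

theorem MultiPar.monomial_exponentEquiv_symm {n : ℕ} (la : MultiPar n) :
    (MvPolynomial.monomial ((MultiPar.exponentEquiv n).symm la) 1 : MultiSym n) =
      ∏ k : Fin n, ((la k).map (fun r => (MvPolynomial.X (k, r) : MultiSym n))).prod := by
  classical
  have h : (MultiPar.exponentEquiv n).symm la =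
      ∑ k : Fin n, (Multiset.toFinsupp (la k)).mapDomain (fun r => (k, r)) := by
    rw [Equiv.symm_apply_eq]
    funext j
    apply Multiset.toFinsupp.injective
    ext r
    simp only [MultiPar.exponentEquiv, Equiv.trans_apply, Equiv.piCongrRight_apply, Pi.map_apply]
    have h2 : ∀ k : Fin n, ((Multiset.toFinsupp (la k)).mapDomain (fun r => (k, r))) (j, r) =
        if k = j then (la k).count r else 0 := by
      intro k
      split_ifs with hk
      · subst hk
        rw [Finsupp.mapDomain_apply (fun a b hab => by simpa using hab)]
        simp
      · rw [Finsupp.mapDomain_of_notMem_range]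
        rintro ⟨x, hx⟩
        exact hk (by simpa using congrArg Prod.fst hx)
    simp [Finsupp.curryEquiv, Finsupp.finsetSum_apply, h2]
  rw [h, MvPolynomial.monomial_sum_one]
  refine Finset.prod_congr rfl fun k _ => ?_
  rw [← MvPolynomial.rename_monomial, ← Sym.p_eq_monomial, Sym.p, map_multiset_prod,
    Multiset.map_map]
  simp

/-- The basis `(p_λ)_λ` of the ring of multi-symmetric functions. -/
noncomputable def MultiSym.pBasis (n : ℕ) : Module.Basis (MultiPar n) K (MultiSym n) :=
  ((MvPolynomial.basisMonomials (Fin n × ℕ+) K).reindex (MultiPar.exponentEquiv n)).map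
    (MultiSym.unionEquiv n).toLinearEquiv

theorem MultiSym.pBasis_apply {n : ℕ} (la : MultiPar n) :
    MultiSym.pBasis n la = MultiSym.p la := by
  have h : MultiSym.pBasis n la = MultiSym.unionEquiv n
      (MvPolynomial.monomial ((MultiPar.exponentEquiv n).symm la) 1) := by
    simp [MultiSym.pBasis]
  rw [h, MultiPar.monomial_exponentEquiv_symm, map_prod, MultiSym.p]
  refine Finset.prod_congr rfl fun k _ => ?_
  rw [map_multiset_prod, Multiset.map_map]
  simp [MultiSym.unionEquiv]

/-- The scalar product `⟨p_λ, p_μ⟩ = δ_{λ μ} z_λ(q,t)` on multi-symmetric functions. -/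
noncomputable def MultiSym.scalar (n : ℕ) : MultiSym n →ₗ[K] MultiSym n →ₗ[K] K :=
  (MultiSym.pBasis n).constr K fun la =>
    open Classical in (MultiSym.pBasis n).constr K fun mu => if la = mu then la.zqt else 0

open Classical in
theorem MultiSym.scalar_p {n : ℕ} (la mu : MultiPar n) :
    MultiSym.scalar n (MultiSym.p la) (MultiSym.p mu) = if la = mu then la.zqt else 0 := by
  rw [← MultiSym.pBasis_apply, ← MultiSym.pBasis_apply, MultiSym.scalar,
    Module.Basis.constr_basis, Module.Basis.constr_basis]

/-- `P` is a basis of the ring of multi-symmetric functions that satisfies the two defining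
properties of the multi-Macdonald polynomials. -/
structure IsMultiMacdonald (n : ℕ) (P : MultiPar n → MultiSym n) : Prop where
  linearIndependent : LinearIndependent K P
  span_eq_top : Submodule.span K (Set.range P) = ⊤
  triangular : ∀ la : MultiPar n,
    MultiSym.toSeries n (P la) - multiMonomialSeries la ∈
      Submodule.span K (multiMonomialSeries '' {mu : MultiPar n | mu.Dominated la ∧ mu ≠ la})
  orthogonal : ∀ la mu : MultiPar n, la ≠ mu → MultiSym.scalar n (P la) (P mu) = 0

open Classical in
/-- The multi-Macdonald polynomials `P_λ^{(q,t)}(x^{(1)}, …, x^{(n)})`: the unique basis with these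
properties (and zero if there were none). -/
noncomputable def multiMacdonald (n : ℕ) : MultiPar n → MultiSym n :=
  if h : ∃ P, IsMultiMacdonald n P then h.choose else 0

/-! ### Plethysm and the alphabets `A_i` -/

/-- `p_r[A]` for `r ≥ 1`: the ring endomorphism in `A` that raises `q`, `t` and every variable
`x^{(k)}_j` to the power `r`, so that `p_s(x^{(k)})` becomes `p_{rs}(x^{(k)})`. -/
noncomputable def adams {n : ℕ} (r : ℕ+) : MultiSym n →+* MultiSym n :=
  MvPolynomial.eval₂Hom (MvPolynomial.C.comp (adamsK r))
    (fun v : Fin n × ℕ+ => MvPolynomial.X (v.1, r * v.2))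

/-- The plethysm `f ↦ f[A]`: the homomorphism of algebras over `ℚ(q,t)` that sends `p_r` to
`p_r[A]`. -/
noncomputable def plethysm {n : ℕ} (A : MultiSym n) : Sym →ₐ[K] MultiSym n :=
  MvPolynomial.aeval (fun r : ℕ+ => adams r A)

/-- `X^{(k+1)} = x^{(k+1)}_1 + x^{(k+1)}_2 + ⋯`. -/
noncomputable def alphabetSum {n : ℕ} (k : Fin n) : MultiSym n := MvPolynomial.X (k, 1)

/-- `A_0 = X^{(n)}` and `A_i = X^{(n-i)} + q (1 - q^{i-1} t) / (1 - q^i t) A_{i-1}` for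
`1 ≤ i ≤ n - 1`; the alphabet `X^{(n-i)}` has index `n - 1 - i`. -/
noncomputable def alphabetA (n : ℕ) : (i : ℕ) → i < n → MultiSym n
  | 0, h => alphabetSum ⟨n - 1, by omega⟩
  | i + 1, h => alphabetSum ⟨n - 1 - (i + 1), by omega⟩ +
      MvPolynomial.C (q * (1 - q ^ i * t) / (1 - q ^ (i + 1) * t)) * alphabetA n i (by omega)

/-- First parameter of the factor indexed by `λ^{(k+1)}`: `q` for `λ^{(1)}`, and `q^{n-j+1} t` for
`λ^{(j)}` with `j = k + 1 ≥ 2`. -/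
noncomputable def firstParam (n k : ℕ) : K := if k = 0 then q else q ^ (n - k) * t

/-- Second parameter of the factor indexed by `λ^{(k+1)}`: `q^{n-j} t` for `j = k + 1`. -/
noncomputable def secondParam (n k : ℕ) : K := q ^ (n - 1 - k) * t

end MultiMacdonald

/-!
The proof exhibits the product of plethysms and checks that it has the two defining properties;
uniqueness is then linear algebra.

*Uniqueness.* Two families that are orthogonal for a non-degenerate form and unitriangular with
respect to the same vectors agree: the difference of two members lies in the span of the strictly
smaller members and is orthogonal to everything (`eq_of_orthogonal_of_unitriangular`). Dominance has
finite lower sets, on partitions as well as on multi-partitions, and both scalar products are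
diagonal in power sums with non-zero norms.

*Macdonald polynomials.* The operator `f ↦ [z^0] ∏_i (1 - βzx_i) / (1 - zx_i) · f[X + (a - 1)/z]`,
with `β = b⁻¹`, is self-adjoint for every form in which multiplication by `p_r` is adjoint on both
sides to `N_r ∂/∂p_r`, if `N_r` is proportional to `r (1 - a^r) / (1 - b^r)` up to a factor `c^r`
(`Sym.operator_selfAdjoint`). In finitely many variables, partial fractions turn it into a sum of
dilations `x_i ↦ a x_i` with rational coefficients, and clearing denominators shows that it is
triangular on monomial functions (`operator_triangular`). Its diagonal entries are
`1 + (1 - b⁻¹) ∑_i b^{-i} (a^{λ_{i+1}} - 1)`, and for the parameters in question, monomials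
`q^x t^y` with exponent vectors that are linearly independent, they are pairwise distinct
(`genericParameters_qt`). Hence the Macdonald polynomials exist and are the eigenvectors of the
operator (`macdonald_spec`).

*Orthogonality of the products.* The power sums `p_r[A_0], …, p_r[A_{n-1}]` are what Gram–Schmidt
orthogonalization makes of the power sums of the alphabets `x^{(n)}, …, x^{(1)}`
(`gram_of_recursion`), and the norm of `p_r[A_i]` is `q^{ri}` times that of `p_r` for the pair of
parameters attached to `A_i` (`gramForm_alphabetVector`). So, with all other factors of a product
fixed, the form in one factor is again one in which `p_r` is adjoint to such a multiple of `∂/∂p_r`,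
and eigenvectors of the operator with different eigenvalues give orthogonal products
(`colorScalar_eq_zero`).

*Triangularity of the products.* `A_{n-k}` is `X^{(k)}` plus a combination of later alphabets. In the
expansion of `m_ν` of a union of two alphabets only terms `m_α m_β` with `α ∪ β = ν` occur, so
replacing `X^{(k)}` by `A_{n-k}` only moves exponents to later alphabets, and the leading exponent
keeps its coefficient (`exponentsLe_toSeries_aeval`). Leading terms are multiplicative
(`exponentsLe_prod_and_coeff`).
-/

namespace MultiMacdonald

/-! ### Unitriangular families -/

section Unitriangular

variable {F V W I : Type*} [Field F] [AddCommGroup V] [Module F V] [AddCommGroup W] [Module F W]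
  {lt : I → I → Prop} {Φ : I → ℕ}

theorem span_image_eq_of_unitriangular (hΦ : ∀ i j, lt j i → Φ j < Φ i) {P M : I → V}
    (h : ∀ i, P i - M i ∈ Submodule.span F (M '' {j | lt j i})) {S : Set I}
    (hS : ∀ i ∈ S, ∀ j, lt j i → j ∈ S) :
    Submodule.span F (P '' S) = Submodule.span F (M '' S) := by
  apply le_antisymm
  · rw [Submodule.span_le]
    rintro _ ⟨i, hi, rfl⟩
    have h1 : M i ∈ Submodule.span F (M '' S) := Submodule.subset_span ⟨i, hi, rfl⟩
    have h2 := Submodule.span_mono (Set.image_mono (f := M) (hS i hi)) (h i)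
    simpa using add_mem h1 h2
  · rw [Submodule.span_le]
    rintro _ ⟨i, hi, rfl⟩
    induction hn : Φ i using Nat.strong_induction_on generalizing i with
    | _ n ih =>
      have h1 : P i ∈ Submodule.span F (P '' S) := Submodule.subset_span ⟨i, hi, rfl⟩
      have h2 : Submodule.span F (M '' {j | lt j i}) ≤ Submodule.span F (P '' S) := by
        rw [Submodule.span_le]
        rintro _ ⟨j, hj, rfl⟩
        exact ih (Φ j) (hn ▸ hΦ i j hj) j (hS i hi j hj) rfl
      simpa using sub_mem h1 (h2 (h i))

theorem linearIndependent_of_unitriangular (hΦ : ∀ i j, lt j i → Φ j < Φ i) {P M : I → V}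
    (h : ∀ i, P i - M i ∈ Submodule.span F (M '' {j | lt j i})) (hM : LinearIndependent F M) :
    LinearIndependent F P := by
  classical
  rw [linearIndependent_iff']
  intro s g hg
  by_contra! hne
  obtain ⟨i₀, hi₀, hgi₀⟩ := hne
  -- A term of maximal measure cannot be cancelled by the others.
  obtain ⟨i, hi, hmax⟩ := (s.filter fun i => g i ≠ 0).exists_max_image Φ
    ⟨i₀, Finset.mem_filter.2 ⟨hi₀, hgi₀⟩⟩
  rw [Finset.mem_filter] at hi
  have hmem : ∀ j ∈ s, g j • (P j - M j) ∈ Submodule.span F (M '' {j | j ≠ i}) := by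
    intro j hj
    by_cases hgj : g j = 0
    · simp [hgj]
    · refine Submodule.smul_mem _ _ (Submodule.span_mono (Set.image_mono ?_) (h j))
      rintro k hk rfl
      exact absurd (hΦ _ _ hk) (not_lt.2 (hmax j (Finset.mem_filter.2 ⟨hj, hgj⟩)))
  have hmem2 : ∑ j ∈ s.erase i, g j • M j ∈ Submodule.span F (M '' {j | j ≠ i}) :=
    Submodule.sum_mem _ fun j hj => Submodule.smul_mem _ _
      (Submodule.subset_span ⟨j, Finset.ne_of_mem_erase hj, rfl⟩)
  have hsum : g i • M i = -(∑ j ∈ s.erase i, g j • M j + ∑ j ∈ s, g j • (P j - M j)) := by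
    rw [eq_neg_iff_add_eq_zero, ← add_assoc,
      Finset.add_sum_erase s (fun j => g j • M j) hi.1, ← Finset.sum_add_distrib, ← hg]
    exact Finset.sum_congr rfl fun j _ => by rw [smul_sub]; abel
  have hMi : M i ∈ Submodule.span F (M '' {j | j ≠ i}) := by
    have : g i • M i ∈ Submodule.span F (M '' {j | j ≠ i}) := by
      rw [hsum]
      exact neg_mem (add_mem hmem2 (Submodule.sum_mem _ hmem))
    exact (Submodule.smul_mem_iff _ hi.2).1 this
  exact hM.notMem_span_image (s := {j | j ≠ i}) (by simp) hMi

/-- An orthogonal basis that is unitriangular with respect to a given family is determined by that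
family: the difference of two candidates lies in the span of the strictly smaller members and is
orthogonal to all of it. -/
theorem eq_of_orthogonal_of_unitriangular (hΦ : ∀ i j, lt j i → Φ j < Φ i)
    (htrans : ∀ i j k, lt i j → lt j k → lt i k) {τ : V →ₗ[F] W} (hτ : Function.Injective τ)
    {m : I → W} {B : V →ₗ[F] V →ₗ[F] F} (hB : ∀ x, (∀ y, B x y = 0) → x = 0) {P P' : I → V}
    (hspan : Submodule.span F (Set.range P) = ⊤)
    (htri : ∀ i, τ (P i) - m i ∈ Submodule.span F (m '' {j | lt j i}))
    (htri' : ∀ i, τ (P' i) - m i ∈ Submodule.span F (m '' {j | lt j i}))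
    (horth : ∀ i j, i ≠ j → B (P i) (P j) = 0) (horth' : ∀ i j, i ≠ j → B (P' i) (P' j) = 0) :
    P = P' := by
  have hlower : ∀ i : I, ∀ j ∈ {j | lt j i}, ∀ k, lt k j → k ∈ {j | lt j i} :=
    fun i j hj k hk => htrans k j i hk hj
  have key : ∀ i, Submodule.map τ (Submodule.span F (P '' {j | lt j i})) =
      Submodule.span F (m '' {j | lt j i}) := fun i => by
    rw [Submodule.map_span, ← Set.image_comp]
    exact span_image_eq_of_unitriangular (P := τ ∘ P) hΦ htri (hlower i)
  have key' : ∀ i, Submodule.map τ (Submodule.span F (P' '' {j | lt j i})) =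
      Submodule.span F (m '' {j | lt j i}) := fun i => by
    rw [Submodule.map_span, ← Set.image_comp]
    exact span_image_eq_of_unitriangular (P := τ ∘ P') hΦ htri' (hlower i)
  have hPP' : ∀ i, Submodule.span F (P '' {j | lt j i}) = Submodule.span F (P' '' {j | lt j i}) :=
    fun i => Submodule.map_injective_of_injective hτ ((key i).trans (key' i).symm)
  funext i
  have hd : P i - P' i ∈ Submodule.span F (P '' {j | lt j i}) := by
    have h1 : τ (P i - P' i) ∈ Submodule.map τ (Submodule.span F (P '' {j | lt j i})) := by
      rw [key, map_sub]
      simpa using sub_mem (htri i) (htri' i)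
    obtain ⟨x, hx, hxe⟩ := h1
    rwa [← hτ hxe]
  have hPj : ∀ j, B (P i - P' i) (P j) = 0 := by
    intro j
    by_cases hj : lt j i
    · have hne : i ≠ j := by rintro rfl; exact lt_irrefl _ (hΦ _ _ hj)
      have hle : Submodule.span F (P' '' {j | lt j i}) ≤ LinearMap.ker (B (P' i)) := by
        rw [Submodule.span_le]
        rintro _ ⟨k, hk, rfl⟩
        have hne : i ≠ k := by rintro rfl; exact lt_irrefl _ (hΦ _ _ hk)
        exact horth' i k hne
      have hmem : P j ∈ Submodule.span F (P' '' {j | lt j i}) := by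
        rw [← hPP']
        exact Submodule.subset_span ⟨j, hj, rfl⟩
      have h0 : B (P' i) (P j) = 0 := hle hmem
      rw [map_sub, LinearMap.sub_apply, h0, horth i j hne, sub_zero]
    · have hle : Submodule.span F (P '' {j | lt j i}) ≤ LinearMap.ker (B.flip (P j)) := by
        rw [Submodule.span_le]
        rintro _ ⟨k, hk, rfl⟩
        have hne : k ≠ j := by rintro rfl; exact hj hk
        exact horth k j hne
      exact hle hd
  refine sub_eq_zero.1 (hB _ fun y => ?_)
  have hle : Submodule.span F (Set.range P) ≤ LinearMap.ker (B (P i - P' i)) := by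
    rw [Submodule.span_le]
    rintro _ ⟨j, rfl⟩
    exact hPj j
  exact hle (hspan ▸ Submodule.mem_top)

/-- A triangular operator whose diagonal entry at `i` differs from those at all smaller indices has
an eigenvector with leading term `M i`: the operator minus that diagonal entry is onto the span of
the smaller members. -/
theorem exists_eigenvector_of_triangular (hΦ : ∀ i j, lt j i → Φ j < Φ i)
    (htrans : ∀ i j k, lt i j → lt j k → lt i k) {M : I → V} {E : V →ₗ[F] V} {ε : I → F}
    (hε : ∀ i j, lt j i → ε j ≠ ε i)
    (hE : ∀ i, E (M i) - ε i • M i ∈ Submodule.span F (M '' {j | lt j i})) (i : I) :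
    ∃ p, p - M i ∈ Submodule.span F (M '' {j | lt j i}) ∧ E p = ε i • p := by
  set U := Submodule.span F (M '' {j | lt j i})
  let T : V →ₗ[F] V := E - ε i • LinearMap.id
  have honto : U ≤ Submodule.map T U := by
    rw [Submodule.span_le]
    rintro _ ⟨j, hj, rfl⟩
    induction hn : Φ j using Nat.strong_induction_on generalizing j with
    | _ n ih =>
      have h1 : Submodule.span F (M '' {k | lt k j}) ≤
          Submodule.map T U := by
        rw [Submodule.span_le]
        rintro _ ⟨k, hk, rfl⟩
        exact ih (Φ k) (hn ▸ hΦ j k hk) k (htrans k j i hk hj) rfl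
      have h2 : T (M j) ∈ Submodule.map T U :=
        Submodule.mem_map_of_mem (Submodule.subset_span ⟨j, hj, rfl⟩)
      have h3 := sub_mem h2 (h1 (hE j))
      have h4 : T (M j) - (E (M j) - ε j • M j) = (ε j - ε i) • M j := by
        simp only [T, LinearMap.sub_apply, LinearMap.smul_apply, LinearMap.id_apply]
        module
      rw [h4] at h3
      exact (Submodule.smul_mem_iff _ (sub_ne_zero.2 (hε i j hj))).1 h3
  obtain ⟨y, hy, hye⟩ := honto (hE i)
  refine ⟨M i - y, by simpa using hy, ?_⟩
  simp only [T, LinearMap.sub_apply, LinearMap.smul_apply, LinearMap.id_apply] at hye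
  rw [map_sub, smul_sub, sub_eq_sub_iff_sub_eq_sub, ← hye]

end Unitriangular

/-! ### Exponents and their types -/

/-- The type of an exponent: the multiset of its non-zero values. -/
def exponentType {σ : Type} (e : σ →₀ ℕ) : Par := e.support.val.map fun v => (e v).toPNat'

theorem map_coe_exponentType {σ : Type} (e : σ →₀ ℕ) :
    (exponentType e).map (fun r : ℕ+ => (r : ℕ)) = e.support.val.map fun v => e v := by
  rw [exponentType, Multiset.map_map]
  refine Multiset.map_congr rfl fun v hv => ?_
  have : e v ≠ 0 := Finsupp.mem_support_iff.1 hv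
  simp [Nat.pos_of_ne_zero this]

theorem map_coe_injective : Function.Injective fun la : Par => la.map (fun r : ℕ+ => (r : ℕ)) :=
  Multiset.map_injective PNat.coe_injective

theorem exponentType_eq_iff {σ : Type} (e : σ →₀ ℕ) (la : Par) :
    exponentType e = la ↔
      (e.support.val.map fun v => e v) = la.map (fun r : ℕ+ => (r : ℕ)) := by
  rw [← map_coe_exponentType, map_coe_injective.eq_iff]

open Classical in
theorem coeff_monomialSeries {σ : Type} (S : Set σ) (la : Par) (e : σ →₀ ℕ) :
    MvPowerSeries.coeff e (monomialSeries S la) =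
      if (∀ v ∈ e.support, v ∈ S) ∧ exponentType e = la then 1 else 0 := by
  rw [MvPowerSeries.coeff_apply, monomialSeries]
  simp only [exponentType_eq_iff]

open Classical in
theorem coeff_powerSumSeries {σ : Type} (S : Set σ) (r : ℕ+) (e : σ →₀ ℕ) :
    MvPowerSeries.coeff e (powerSumSeries S r) =
      if ∃ v ∈ S, e = Finsupp.single v (r : ℕ) then 1 else 0 := rfl

theorem exponentType_embDomain {σ τ : Type} (φ : σ ↪ τ) (e : σ →₀ ℕ) :
    exponentType (e.embDomain φ) = exponentType e := by
  simp [exponentType, Finsupp.support_embDomain]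

theorem size_exponentType {σ : Type} (e : σ →₀ ℕ) :
    Par.size (exponentType e) = ∑ v ∈ e.support, e v := by
  rw [Par.size, map_coe_exponentType]; rfl

theorem exponentType_zero {σ : Type} : exponentType (0 : σ →₀ ℕ) = 0 := by
  simp [exponentType]

theorem card_exponentType {σ : Type} (e : σ →₀ ℕ) :
    Multiset.card (exponentType e) = e.support.card := by
  simp [exponentType]

theorem exponentType_eq_zero {σ : Type} {e : σ →₀ ℕ} : exponentType e = 0 ↔ e = 0 := by
  rw [← Multiset.card_eq_zero, card_exponentType, Finset.card_eq_zero, Finsupp.support_eq_empty]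

theorem exponentType_add_of_disjoint {σ : Type} {e f : σ →₀ ℕ}
    (h : Disjoint e.support f.support) :
    exponentType (e + f) = exponentType e + exponentType f := by
  classical
  rw [exponentType, Finsupp.support_add_eq h, ← Finset.disjUnion_eq_union _ _ h,
    Finset.disjUnion_val, Multiset.map_add]
  congr 1
  · refine Multiset.map_congr rfl fun v hv => ?_
    have : f v = 0 := Finsupp.notMem_support_iff.1 (Finset.disjoint_left.1 h hv)
    simp [this]
  · refine Multiset.map_congr rfl fun v hv => ?_
    have : e v = 0 := Finsupp.notMem_support_iff.1 (Finset.disjoint_right.1 h hv)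
    simp [this]

theorem exponentType_single {σ : Type} (v : σ) (r : ℕ+) :
    exponentType (Finsupp.single v (r : ℕ)) = {r} := by
  rw [exponentType, Finsupp.support_single _ (PNat.ne_zero r)]
  simp

/-- The exponent `(λ_1, λ_2, …)` of type `λ`, with `λ_1 ≥ λ_2 ≥ ⋯`. -/
def canonicalExponent (la : Par) : ℕ →₀ ℕ :=
  ((la.sort (· ≥ ·)).map fun r : ℕ+ => (r : ℕ)).toFinsupp

theorem exponentType_canonicalExponent (la : Par) : exponentType (canonicalExponent la) = la := by
  rw [exponentType_eq_iff, canonicalExponent]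
  set l := (la.sort (· ≥ ·)).map fun r : ℕ+ => (r : ℕ) with hl
  have h1 : l.toFinsupp.support = Finset.range l.length := by
    rw [List.toFinsupp_support, Finset.filter_eq_self]
    intro i hi
    rw [Finset.mem_range] at hi
    rw [List.getD_eq_getElem _ _ hi]
    simp [hl]
  have h2 : (Finset.range l.length).val.map (fun v => l.toFinsupp v) = (l : Multiset ℕ) := by
    rw [Finset.range_val, Multiset.range, Multiset.map_coe]
    congr 1
    refine List.ext_getElem (by simp) fun i h h' => ?_
    simp only [List.getElem_map, List.getElem_range]
    exact List.toFinsupp_apply_lt l i h'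
  rw [h1, h2, hl, ← Multiset.map_coe, Multiset.sort_eq]

theorem sum_range_canonicalExponent (la : Par) (j : ℕ) :
    ∑ i ∈ Finset.range j, canonicalExponent la i = la.partialSum j := by
  rw [Par.partialSum, canonicalExponent, List.map_take]
  generalize (la.sort (· ≥ ·)).map (fun r : ℕ+ => (r : ℕ)) = l
  simp only [List.toFinsupp_apply]
  induction j with
  | zero => simp
  | succ j ih =>
    rw [Finset.sum_range_succ, ih]
    by_cases hj : j < l.length
    · rw [List.sum_take_succ _ _ hj, List.getD_eq_getElem _ _ hj]
    · rw [not_lt] at hj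
      rw [List.getD_eq_default _ _ hj, List.take_of_length_le hj,
        List.take_of_length_le (by omega), add_zero]

/-! ### Partial sums -/

theorem sum_le_sum_take_of_le {l : List ℕ+} (hl : l.Pairwise (· ≥ ·)) {s : Multiset ℕ+}
    (hs : s ≤ (l : Multiset ℕ+)) {j : ℕ} (hj : Multiset.card s ≤ j) :
    Par.size s ≤ ((l.take j).map fun r : ℕ+ => (r : ℕ)).sum := by
  induction l generalizing s j with
  | nil =>
    have : s = 0 := by simpa using hs
    simp [this, Par.size]
  | cons a l ih =>
    rw [List.pairwise_cons] at hl
    rcases Multiset.empty_or_exists_mem s with rfl | ⟨x, hx⟩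
    · simp [Par.size]
    obtain ⟨j, rfl⟩ : ∃ i, j = i + 1 :=
      Nat.exists_eq_succ_of_ne_zero (by
        have := Multiset.card_pos_iff_exists_mem.2 ⟨x, hx⟩; omega)
    -- Replace the largest entry of `s`, or any entry if `a` is not one of them, by `a`.
    obtain ⟨y, hy, hya, hys⟩ : ∃ y ∈ s, y ≤ a ∧ s.erase y ≤ (l : Multiset ℕ+) := by
      by_cases ha : a ∈ s
      · exact ⟨a, ha, le_rfl, by rw [Multiset.erase_le_iff_le_cons]; simpa using hs⟩
      · have hsl : s ≤ (l : Multiset ℕ+) := by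
          rw [← Multiset.cons_coe] at hs
          exact (Multiset.le_cons_of_notMem ha).1 hs
        exact ⟨x, hx, hl.1 x (by simpa using Multiset.mem_of_le hsl hx),
          (Multiset.erase_le _ _).trans hsl⟩
    have h1 := ih hl.2 hys (j := j) (by rw [Multiset.card_erase_of_mem hy]; simp; omega)
    have h2 : Par.size s = (y : ℕ) + Par.size (s.erase y) := by
      conv_lhs => rw [← Multiset.cons_erase hy]
      simp [Par.size]
    have h3 : (y : ℕ) ≤ a := hya
    rw [h2, List.take_succ_cons, List.map_cons, List.sum_cons]
    omega

theorem Par.size_le_partialSum {s la : Par} (hs : s ≤ la) {j : ℕ} (hj : Multiset.card s ≤ j) :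
    s.size ≤ la.partialSum j :=
  sum_le_sum_take_of_le (Multiset.pairwise_sort _ _) (by rwa [Multiset.sort_eq]) hj

theorem Par.partialSum_le_size (la : Par) (j : ℕ) : la.partialSum j ≤ la.size := by
  have h : la.size = ((la.sort (· ≥ ·)).map fun r : ℕ+ => (r : ℕ)).sum := by
    conv_lhs => rw [← Multiset.sort_eq la (· ≥ ·)]
    simp only [Par.size, Multiset.map_coe, Multiset.sum_coe]
  rw [h, Par.partialSum, List.map_take]
  exact (List.take_sublist _ _).sum_le_sum (by simp)

theorem Par.partialSum_eq_size {la : Par} {j : ℕ} (hj : Multiset.card la ≤ j) :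
    la.partialSum j = la.size :=
  le_antisymm (la.partialSum_le_size j) (Par.size_le_partialSum le_rfl hj)

theorem Par.card_le_size (la : Par) : Multiset.card la ≤ la.size := by
  have h := Multiset.card_nsmul_le_sum (s := la.map fun r : ℕ+ => (r : ℕ)) (a := 1) (by
    intro x hx
    obtain ⟨r, -, rfl⟩ := Multiset.mem_map.1 hx
    exact r.pos)
  simpa [Par.size] using h

theorem Par.size_add (la mu : Par) : (la + mu).size = la.size + mu.size := by
  simp [Par.size]

theorem Par.partialSum_mono {al la : Par} (h : al ≤ la) (j : ℕ) :
    al.partialSum j ≤ la.partialSum j := by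
  have h1 : al.partialSum j = Par.size (((al.sort (· ≥ ·)).take j : List ℕ+) : Multiset ℕ+) := by
    simp [Par.size, Par.partialSum]
  rw [h1]
  refine Par.size_le_partialSum (le_trans ?_ h) (by simp)
  conv_rhs => rw [← Multiset.sort_eq al (· ≥ ·)]
  exact (List.take_sublist _ _).subperm

/-- The sum of the values of an exponent over `j` variables is at most the sum of the `j` largest
parts of its type. -/
theorem sum_le_partialSum_exponentType {σ : Type} (e : σ →₀ ℕ) (T : Finset σ) :
    ∑ v ∈ T, e v ≤ (exponentType e).partialSum T.card := by
  classical
  set s : Par := (e.support ∩ T).val.map fun v => (e v).toPNat'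
  have h1 : s ≤ exponentType e :=
    Multiset.map_le_map (Finset.val_le_iff.2 Finset.inter_subset_left)
  have h2 : Multiset.card s ≤ T.card := by
    rw [Multiset.card_map]
    exact Finset.card_le_card Finset.inter_subset_right
  refine le_trans (le_of_eq ?_) (Par.size_le_partialSum h1 h2)
  have h3 : s.size = ∑ v ∈ e.support ∩ T, e v := by
    simp only [s, Par.size, Multiset.map_map]
    refine Finset.sum_congr rfl fun v hv => ?_
    have : e v ≠ 0 := Finsupp.mem_support_iff.1 (Finset.mem_inter.1 hv).1
    simp [Nat.pos_of_ne_zero this]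
  rw [h3]
  refine (Finset.sum_subset Finset.inter_subset_right fun v hv hv' => ?_).symm
  by_contra hne
  exact hv' (Finset.mem_inter.2 ⟨Finsupp.mem_support_iff.2 hne, hv⟩)

theorem Par.eq_of_partialSum_eq {la mu : Par} (h : ∀ j, la.partialSum j = mu.partialSum j) :
    la = mu := by
  have : canonicalExponent la = canonicalExponent mu := by
    ext i
    have h1 := h (i + 1)
    rw [← sum_range_canonicalExponent, ← sum_range_canonicalExponent, Finset.sum_range_succ,
      Finset.sum_range_succ, sum_range_canonicalExponent, sum_range_canonicalExponent, h i] at h1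
    exact Nat.add_left_cancel h1
  rw [← exponentType_canonicalExponent la, this, exponentType_canonicalExponent]

theorem finite_setOf_size_le (d : ℕ) : {la : Par | la.size ≤ d}.Finite := by
  classical
  refine (Set.finite_Iic (d • ∑ r ∈ Finset.range (d + 1), ({r.toPNat'} : Multiset ℕ+))).subset ?_
  intro la hla
  rw [Set.mem_Iic, Multiset.le_iff_count]
  intro r
  by_cases hr : r ∈ la
  · have hrd : (r : ℕ) ≤ d := by
      refine le_trans ?_ hla
      exact Multiset.le_sum_of_mem (Multiset.mem_map_of_mem _ hr)
    have h1 : la.count r ≤ d := (Multiset.count_le_card _ _).trans ((Par.card_le_size la).trans hla)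
    rw [Multiset.count_nsmul]
    have h2 : 1 ≤ Multiset.count r (∑ r ∈ Finset.range (d + 1), ({r.toPNat'} : Multiset ℕ+)) := by
      rw [Multiset.one_le_count_iff_mem, Multiset.mem_sum]
      exact ⟨r, Finset.mem_range.2 (by omega), by simp⟩
    exact h1.trans (Nat.le_mul_of_pos_right d h2)
  · rw [Multiset.count_eq_zero_of_notMem hr]
    exact Nat.zero_le _

/-! ### Symmetric functions in an alphabet -/

/-- A symmetric function in the set `S` of variables. -/
noncomputable def Sym.inAlphabet {σ : Type} (S : Set σ) : Sym →ₐ[K] MvPowerSeries σ K :=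
  MvPolynomial.aeval fun r : ℕ+ => powerSumSeries S r

theorem Sym.toSeries_eq_inAlphabet : Sym.toSeries = Sym.inAlphabet (Set.univ : Set ℕ) := rfl

theorem rename_powerSumSeries {σ τ : Type} (φ : σ ↪ τ) (S : Set σ) (r : ℕ+) :
    MvPowerSeries.rename φ (powerSumSeries S r) = powerSumSeries (φ '' S) r := by
  classical
  ext x
  by_cases hx : x ∈ Set.range (Finsupp.mapDomain φ)
  · obtain ⟨y, rfl⟩ := hx
    rw [← Finsupp.embDomain_eq_mapDomain, MvPowerSeries.coeff_embDomain_rename,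
      coeff_powerSumSeries, coeff_powerSumSeries]
    congr 1
    simp only [Set.exists_mem_image, ← Finsupp.embDomain_single, Finsupp.embDomain_inj]
  · rw [MvPowerSeries.coeff_rename_eq_zero _ _ hx, coeff_powerSumSeries, if_neg]
    rintro ⟨_, ⟨v, -, rfl⟩, rfl⟩
    exact hx ⟨Finsupp.single v (r : ℕ), by simp⟩

theorem killCompl_powerSumSeries {σ τ : Type} (φ : σ ↪ τ) (S : Set τ) (r : ℕ+) :
    MvPowerSeries.killCompl φ (powerSumSeries S r) = powerSumSeries (φ ⁻¹' S) r := by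
  classical
  ext x
  rw [MvPowerSeries.coeff_killCompl, coeff_powerSumSeries, coeff_powerSumSeries]
  congr 1
  apply propext
  constructor
  · rintro ⟨v, hv, h⟩
    have hmem : v ∈ (x.embDomain φ).support := by rw [h]; simp
    rw [Finsupp.support_embDomain, Finset.mem_map] at hmem
    obtain ⟨u, -, rfl⟩ := hmem
    refine ⟨u, hv, ?_⟩
    rwa [← Finsupp.embDomain_single, Finsupp.embDomain_inj] at h
  · rintro ⟨u, hu, rfl⟩
    exact ⟨φ u, hu, by rw [Finsupp.embDomain_single]⟩

theorem rename_inAlphabet {σ τ : Type} (φ : σ ↪ τ) (S : Set σ) (f : Sym) :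
    MvPowerSeries.rename φ (Sym.inAlphabet S f) = Sym.inAlphabet (φ '' S) f := by
  rw [← AlgHom.comp_apply]
  congr 1
  ext1 r
  simp [Sym.inAlphabet, rename_powerSumSeries]

theorem killCompl_inAlphabet {σ τ : Type} (φ : σ ↪ τ) (S : Set τ) (f : Sym) :
    MvPowerSeries.killCompl φ (Sym.inAlphabet S f) = Sym.inAlphabet (φ ⁻¹' S) f := by
  rw [← AlgHom.comp_apply]
  congr 1
  ext1 r
  simp [Sym.inAlphabet, killCompl_powerSumSeries]

theorem exists_embDomain_subtype_eq {σ : Type} {S : Set σ} {e : σ →₀ ℕ}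
    (he : ∀ v ∈ e.support, v ∈ S) :
    ∃ y : S →₀ ℕ, y.embDomain (Function.Embedding.subtype (· ∈ S)) = e := by
  have : e ∈ Set.range (Finsupp.embDomain (M := ℕ) (Function.Embedding.subtype (· ∈ S))) := by
    rw [Finsupp.mem_range_embDomain_iff]
    intro v hv
    simpa using he v hv
  exact this

/-- Setting the variables outside `S` to zero. -/
theorem coeff_inAlphabet_of_support_subset {σ : Type} {S : Set σ} {e : σ →₀ ℕ}
    (he : ∀ v ∈ e.support, v ∈ S) (f : Sym) :
    MvPowerSeries.coeff e (Sym.inAlphabet S f) =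
      MvPowerSeries.coeff e (Sym.inAlphabet Set.univ f) := by
  obtain ⟨y, rfl⟩ := exists_embDomain_subtype_eq he
  rw [← MvPowerSeries.coeff_killCompl, ← MvPowerSeries.coeff_killCompl, killCompl_inAlphabet,
    killCompl_inAlphabet]
  congr 2
  ext v
  simp

theorem support_subset_of_coeff_inAlphabet_ne_zero {σ : Type} {S : Set σ} {e : σ →₀ ℕ} {f : Sym}
    (h : MvPowerSeries.coeff e (Sym.inAlphabet S f) ≠ 0) : ∀ v ∈ e.support, v ∈ S := by
  have h1 : Sym.inAlphabet S f = MvPowerSeries.rename (Function.Embedding.subtype (· ∈ S))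
      (Sym.inAlphabet (Set.univ : Set S) f) := by
    rw [rename_inAlphabet]; simp
  rw [h1] at h
  have h2 : e ∈ Set.range (Finsupp.mapDomain (Function.Embedding.subtype (· ∈ S))) := by
    by_contra hc
    exact h (MvPowerSeries.coeff_rename_eq_zero _ _ hc)
  obtain ⟨y, rfl⟩ := h2
  rw [← Finsupp.embDomain_eq_mapDomain]
  intro v hv
  rw [Finsupp.support_embDomain, Finset.mem_map] at hv
  obtain ⟨u, -, rfl⟩ := hv
  exact u.2

theorem rename_monomialSeries {σ τ : Type} (φ : σ ↪ τ) (S : Set σ) (la : Par) :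
    MvPowerSeries.rename φ (monomialSeries S la) = monomialSeries (φ '' S) la := by
  classical
  ext x
  by_cases hx : x ∈ Set.range (Finsupp.mapDomain φ)
  · obtain ⟨y, rfl⟩ := hx
    rw [← Finsupp.embDomain_eq_mapDomain, MvPowerSeries.coeff_embDomain_rename,
      coeff_monomialSeries, coeff_monomialSeries, exponentType_embDomain]
    simp [Finsupp.support_embDomain]
  · rw [MvPowerSeries.coeff_rename_eq_zero _ _ hx, coeff_monomialSeries, if_neg]
    rintro ⟨h, -⟩
    apply hx
    have : x ∈ Set.range (Finsupp.embDomain φ) := by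
      rw [Finsupp.mem_range_embDomain_iff]
      intro v hv
      obtain ⟨u, -, rfl⟩ := h v hv
      exact ⟨u, rfl⟩
    obtain ⟨y, rfl⟩ := this
    exact ⟨y, (Finsupp.embDomain_eq_mapDomain _ _).symm⟩

/-! ### Coefficients depend only on the type of the exponent -/

theorem card_fiber_eq_count_exponentType {σ : Type} (e : σ →₀ ℕ) (n : ℕ+) :
    Nat.card {v // e v = n} = (exponentType e).count n := by
  classical
  rw [exponentType, Multiset.count_map, ← Finset.filter_val, Finset.card_val]
  apply Nat.subtype_card
  intro v
  rw [Finset.mem_filter, Finsupp.mem_support_iff]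
  constructor
  · rintro ⟨h1, h2⟩
    rw [h2]
    simp [Nat.pos_of_ne_zero h1]
  · intro h
    simp [h]

theorem exists_perm_embDomain_eq {e f : ℕ →₀ ℕ} (h : exponentType e = exponentType f) :
    ∃ π : Equiv.Perm ℕ, e.embDomain π.toEmbedding = f := by
  have hfin : ∀ (g : ℕ →₀ ℕ) (n : ℕ), n ≠ 0 → Finite {v // g v = n} := fun g n hn =>
    (g.hasFiniteSupport.subset fun v (hv : g v = n) => by
      simpa [hv] using hn).to_subtype
  have hinf : ∀ g : ℕ →₀ ℕ, Infinite {v // g v = 0} := fun g => by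
    have : ({v | g v = 0} : Set ℕ) = (g.support : Set ℕ)ᶜ := by ext; simp
    rw [← Set.coe_ofPred, this]
    exact g.support.finite_toSet.infinite_compl.to_subtype
  have hfib : ∀ n : ℕ, Nonempty ({v // e v = n} ≃ {v // f v = n}) := by
    intro n
    rcases Nat.eq_zero_or_pos n with rfl | hn
    · have := hinf e
      have := hinf f
      exact nonempty_equiv_of_countable
    · have := hfin e n hn.ne'
      have := hfin f n hn.ne'
      refine Finite.card_eq.1 ?_
      have h1 := card_fiber_eq_count_exponentType e ⟨n, hn⟩
      have h2 := card_fiber_eq_count_exponentType f ⟨n, hn⟩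
      rw [h] at h1
      exact h1.trans h2.symm
  set π : Equiv.Perm ℕ := Equiv.ofFiberEquiv fun n => (hfib n).some
  refine ⟨π, ?_⟩
  ext v
  obtain ⟨u, rfl⟩ := π.surjective v
  exact (Finsupp.embDomain_apply_self π.toEmbedding e u).trans
    (Equiv.ofFiberEquiv_map (fun n => (hfib n).some) u).symm

theorem coeff_toSeries_eq_of_exponentType_eq {e f : ℕ →₀ ℕ} (h : exponentType e = exponentType f)
    (s : Sym) : MvPowerSeries.coeff e (Sym.toSeries s) = MvPowerSeries.coeff f (Sym.toSeries s) := by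
  obtain ⟨π, rfl⟩ := exists_perm_embDomain_eq h
  have h1 : Sym.toSeries s = MvPowerSeries.rename π.toEmbedding (Sym.toSeries s) := by
    rw [Sym.toSeries_eq_inAlphabet, rename_inAlphabet]
    simp
  conv_rhs => rw [h1]
  rw [MvPowerSeries.coeff_embDomain_rename]

theorem toSeries_eq_sum_monomialSeries {s : Sym} {T : Finset Par}
    (hT : ∀ e, MvPowerSeries.coeff e (Sym.toSeries s) ≠ 0 → exponentType e ∈ T) :
    Sym.toSeries s = ∑ mu ∈ T,
      MvPowerSeries.coeff (canonicalExponent mu) (Sym.toSeries s) • monomialSeries Set.univ mu := by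
  classical
  ext e
  rw [map_sum]
  simp only [MvPowerSeries.coeff_smul, coeff_monomialSeries, Set.mem_univ, implies_true, true_and,
    mul_ite, mul_one, mul_zero]
  rw [Finset.sum_ite_eq]
  split_ifs with h
  · exact coeff_toSeries_eq_of_exponentType_eq (exponentType_canonicalExponent _).symm s
  · by_contra hne
    exact h (hT e hne)

/-! ### Monomial symmetric functions as polynomials in the power sums -/

theorem size_exponentType_eq_degree {σ : Type} (e : σ →₀ ℕ) :
    (exponentType e).size = e.degree := by
  rw [size_exponentType, Finsupp.degree_apply]

/-- The expansion of `p_λ` in monomials: the coefficients are natural numbers, non-zero on the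
exponents of type `λ`, and all other exponents have fewer non-zero values. -/
theorem exists_natCast_coeff_toSeries_p (la : Par) : ∃ N : (ℕ →₀ ℕ) → ℕ,
    (∀ e, MvPowerSeries.coeff e (Sym.toSeries (Sym.p la)) = (N e : K)) ∧
    (∀ e, exponentType e = la → N e ≠ 0) ∧
    ∀ e, N e ≠ 0 → (exponentType e = la ∨
      Multiset.card (exponentType e) < Multiset.card la) ∧ (exponentType e).size = la.size := by
  classical
  induction la using Multiset.induction_on with
  | empty =>
    refine ⟨fun e => if e = 0 then 1 else 0, fun e => ?_, fun e he => ?_, fun e he => ?_⟩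
    · simp [Sym.p, MvPowerSeries.coeff_one]
    · simp [exponentType_eq_zero.1 he]
    · have : e = 0 := by by_contra h; simp [h] at he
      subst this
      simp [exponentType_zero]
  | cons a la ih =>
    obtain ⟨N, hN, hne, hsupp⟩ := ih
    refine ⟨fun e => ∑ x ∈ Finset.HasAntidiagonal.antidiagonal e,
      if ∃ v, x.1 = Finsupp.single v (a : ℕ) then N x.2 else 0, fun e => ?_, fun e he => ?_,
      fun e he => ?_⟩
    · have h1 : Sym.p (a ::ₘ la) = MvPolynomial.X a * Sym.p la := by simp [Sym.p]
      have h2 : Sym.toSeries (MvPolynomial.X a) = powerSumSeries Set.univ a := by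
        simp [Sym.toSeries]
      rw [h1, map_mul, h2, MvPowerSeries.coeff_mul, Nat.cast_sum]
      refine Finset.sum_congr rfl fun x _ => ?_
      rw [coeff_powerSumSeries, hN]
      simp
    · have ha : a ∈ exponentType e := by rw [he]; exact Multiset.mem_cons_self _ _
      rw [exponentType, Multiset.mem_map] at ha
      obtain ⟨v, hv, hva⟩ := ha
      have hv0 : e v ≠ 0 := Finsupp.mem_support_iff.1 hv
      have hea : e v = a := by rw [← hva]; simp [Nat.pos_of_ne_zero hv0]
      have hadd : Finsupp.single v (a : ℕ) + e.erase v = e := by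
        rw [← hea]; exact Finsupp.single_add_erase v e
      have htype : exponentType (e.erase v) = la := by
        have hdisj : Disjoint (Finsupp.single v (a : ℕ)).support (e.erase v).support := by
          rw [Finsupp.support_single _ (PNat.ne_zero a)]
          simp
        have := exponentType_add_of_disjoint hdisj
        rw [hadd, he, exponentType_single, Multiset.singleton_add] at this
        exact ((Multiset.cons_inj_right a).1 this).symm
      have hmem : (Finsupp.single v (a : ℕ), e.erase v) ∈ Finset.HasAntidiagonal.antidiagonal e :=
        Finset.HasAntidiagonal.mem_antidiagonal.2 hadd
      intro h0
      rw [Finset.sum_eq_zero_iff] at h0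
      have := h0 _ hmem
      rw [if_pos ⟨v, rfl⟩] at this
      exact hne _ htype this
    · obtain ⟨⟨x, y⟩, hxy, hx⟩ := Finset.exists_ne_zero_of_sum_ne_zero he
      rw [Finset.HasAntidiagonal.mem_antidiagonal] at hxy
      simp only [ne_eq, ite_eq_right_iff, not_forall] at hx
      obtain ⟨⟨v, rfl⟩, hy⟩ := hx
      obtain ⟨h1, h2⟩ := hsupp y hy
      simp only at hxy
      subst hxy
      constructor
      · by_cases hv : v ∈ y.support
        · right
          have h3 : Multiset.card (exponentType y) ≤ Multiset.card la := by
            rcases h1 with h1 | h1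
            · rw [h1]
            · exact h1.le
          have h4 : (Finsupp.single v (a : ℕ) + y).support ⊆ y.support := by
            refine Finsupp.support_add.trans ?_
            rw [Finsupp.support_single _ (PNat.ne_zero a)]
            exact Finset.union_subset (by simpa using hv) le_rfl
          have h5 := Finset.card_le_card h4
          rw [card_exponentType] at h3 ⊢
          rw [Multiset.card_cons]
          omega
        · have hdisj : Disjoint (Finsupp.single v (a : ℕ)).support y.support := by
            rw [Finsupp.support_single _ (PNat.ne_zero a)]
            simpa using hv
          rw [exponentType_add_of_disjoint hdisj, exponentType_single, Multiset.singleton_add]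
          rcases h1 with h1 | h1
          · left; rw [h1]
          · right; simpa using h1
      · rw [size_exponentType_eq_degree] at h2 ⊢
        rw [map_add, h2]
        simp [Par.size, Finsupp.degree_single]

/-- The span of the products of power sums of degree `d`. -/
noncomputable def Sym.ofDegree (d : ℕ) : Submodule K Sym :=
  Submodule.span K (Sym.p '' {mu : Par | mu.size = d})

/-- The products of power sums, divided by their leading coefficients, are unitriangular over the
monomial functions for the number of parts. -/
theorem exists_smul_p_sub_monomialSeries_mem (la : Par) : ∃ c : K, c ≠ 0 ∧
    Sym.toSeries (c • Sym.p la) - monomialSeries Set.univ la ∈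
      Submodule.span K (monomialSeries Set.univ ''
        {mu : Par | Multiset.card mu < Multiset.card la ∧ mu.size = la.size}) := by
  classical
  obtain ⟨N, hN, hne, hsupp⟩ := exists_natCast_coeff_toSeries_p la
  set T := (finite_setOf_size_le la.size).toFinset.filter fun mu =>
    (mu = la ∨ Multiset.card mu < Multiset.card la) ∧ mu.size = la.size with hTdef
  have hmemT : ∀ mu, mu ∈ T ↔
      (mu = la ∨ Multiset.card mu < Multiset.card la) ∧ mu.size = la.size := by
    intro mu
    rw [hTdef, Finset.mem_filter, Set.Finite.mem_toFinset]
    exact ⟨fun h => h.2, fun h => ⟨h.2.le, h⟩⟩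
  have hT : ∀ e, MvPowerSeries.coeff e (Sym.toSeries (Sym.p la)) ≠ 0 → exponentType e ∈ T := by
    intro e he
    rw [hN, Nat.cast_ne_zero] at he
    exact (hmemT _).2 (hsupp e he)
  have hla : la ∈ T := (hmemT la).2 ⟨Or.inl rfl, rfl⟩
  have hexp := toSeries_eq_sum_monomialSeries hT
  rw [← Finset.add_sum_erase _ _ hla, hN] at hexp
  have hNla : (N (canonicalExponent la) : K) ≠ 0 :=
    Nat.cast_ne_zero.2 (hne _ (exponentType_canonicalExponent la))
  refine ⟨(N (canonicalExponent la) : K)⁻¹, inv_ne_zero hNla, ?_⟩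
  rw [map_smul, hexp, smul_add, smul_smul, inv_mul_cancel₀ hNla, one_smul, add_sub_cancel_left]
  refine Submodule.smul_mem _ _ (Submodule.sum_mem _ fun mu hmu => Submodule.smul_mem _ _ ?_)
  rw [Finset.mem_erase, hmemT] at hmu
  exact Submodule.subset_span ⟨mu, ⟨hmu.2.1.resolve_left hmu.1, hmu.2.2⟩, rfl⟩

theorem coeff_canonicalExponent_monomialSeries (la mu : Par) [Decidable (la = mu)] :
    MvPowerSeries.coeff (canonicalExponent la) (monomialSeries Set.univ mu) =
      if la = mu then 1 else 0 := by
  rw [coeff_monomialSeries, exponentType_canonicalExponent]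
  simp

theorem linearIndependent_monomialSeries :
    LinearIndependent K (fun la : Par => monomialSeries (Set.univ : Set ℕ) la) := by
  classical
  rw [linearIndependent_iff']
  intro s g hg mu hmu
  have := congrArg (MvPowerSeries.coeff (canonicalExponent mu)) hg
  simpa [map_sum, MvPowerSeries.coeff_smul, coeff_canonicalExponent_monomialSeries, hmu] using this

theorem injective_of_linearIndependent_comp_basis {F V W I : Type*} [Field F] [AddCommGroup V]
    [Module F V] [AddCommGroup W] [Module F W] (b : Module.Basis I F V) (τ : V →ₗ[F] W)
    (h : LinearIndependent F (fun i => τ (b i))) : Function.Injective τ := by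
  rw [injective_iff_map_eq_zero]
  intro x hx
  rw [linearIndependent_iff] at h
  have h1 := h (b.repr x) (by
    rw [← hx]
    conv_rhs => rw [← b.linearCombination_repr x]
    rw [Finsupp.linearCombination_apply, Finsupp.linearCombination_apply, Finsupp.sum,
      Finsupp.sum, map_sum]
    simp)
  simpa using h1

theorem Sym.toSeries_injective : Function.Injective Sym.toSeries := by
  choose c hc hmem using exists_smul_p_sub_monomialSeries_mem
  have h1 : LinearIndependent K (fun la => Sym.toSeries (c la • Sym.p la)) :=
    linearIndependent_of_unitriangular (Φ := Multiset.card) (fun i j h => h.1) hmem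
      linearIndependent_monomialSeries
  refine injective_of_linearIndependent_comp_basis Sym.pBasis Sym.toSeries.toLinearMap ?_
  have h2 := h1.units_smul (w := fun la => (Units.mk0 (c la) (hc la))⁻¹)
  have h3 : (fun la => Sym.toSeries.toLinearMap (Sym.pBasis la)) =
      (fun la => (Units.mk0 (c la) (hc la))⁻¹) • fun la => Sym.toSeries (c la • Sym.p la) := by
    funext la
    rw [Sym.pBasis_apply]
    simp [Units.smul_def, smul_smul, hc la]
  rw [h3]
  exact h2

theorem monomialSeries_mem_map_toSeries (la : Par) :
    monomialSeries Set.univ la ∈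
      Submodule.map Sym.toSeries.toLinearMap (Sym.ofDegree la.size) := by
  choose c hc hmem using exists_smul_p_sub_monomialSeries_mem
  have h1 : monomialSeries (Set.univ : Set ℕ) la ∈ Submodule.span K
      (monomialSeries (Set.univ : Set ℕ) '' {mu : Par | mu.size = la.size}) :=
    Submodule.subset_span ⟨la, rfl, rfl⟩
  rw [← span_image_eq_of_unitriangular (P := fun la => Sym.toSeries (c la • Sym.p la))
    (Φ := Multiset.card) (fun i j h => h.1) hmem
    (S := {mu : Par | mu.size = la.size}) (fun i hi j hj => hj.2.trans hi)] at h1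
  refine Submodule.span_le.2 ?_ h1
  rintro _ ⟨mu, hmu, rfl⟩
  exact Submodule.mem_map_of_mem (f := Sym.toSeries.toLinearMap)
    (Submodule.smul_mem _ _ (Submodule.subset_span ⟨mu, hmu, rfl⟩))

/-- The monomial symmetric function `m_λ` as a polynomial in the power sums. -/
noncomputable def Sym.m (la : Par) : Sym := (monomialSeries_mem_map_toSeries la).choose

theorem Sym.m_mem_ofDegree (la : Par) : Sym.m la ∈ Sym.ofDegree la.size :=
  (monomialSeries_mem_map_toSeries la).choose_spec.1

theorem Sym.toSeries_m (la : Par) : Sym.toSeries (Sym.m la) = monomialSeries Set.univ la :=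
  (monomialSeries_mem_map_toSeries la).choose_spec.2

theorem Sym.linearIndependent_m : LinearIndependent K Sym.m := by
  refine LinearIndependent.of_comp Sym.toSeries.toLinearMap ?_
  have h : Sym.toSeries.toLinearMap ∘ Sym.m = fun la => monomialSeries (Set.univ : Set ℕ) la :=
    funext Sym.toSeries_m
  rw [h]
  exact linearIndependent_monomialSeries

theorem Sym.span_m : Submodule.span K (Set.range Sym.m) = ⊤ := by
  choose c hc hmem using exists_smul_p_sub_monomialSeries_mem
  have h1 : ∀ la : Par, c la • Sym.p la - Sym.m la ∈ Submodule.span K (Sym.m ''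
      {mu : Par | Multiset.card mu < Multiset.card la ∧ mu.size = la.size}) := by
    intro la
    have h2 := hmem la
    rw [← Sym.toSeries_m, ← map_sub] at h2
    have h3 : monomialSeries (Set.univ : Set ℕ) = Sym.toSeries.toLinearMap ∘ Sym.m := by
      funext mu; exact (Sym.toSeries_m mu).symm
    rw [h3, Set.image_comp, ← Submodule.map_span] at h2
    obtain ⟨x, hx, hxe⟩ := h2
    rwa [← Sym.toSeries_injective hxe]
  have h2 := span_image_eq_of_unitriangular (S := Set.univ) (Φ := Multiset.card)
    (fun i j h => h.1) h1 (fun _ _ _ _ => Set.mem_univ _)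
  rw [Set.image_univ, Set.image_univ] at h2
  rw [← h2, eq_top_iff, ← Sym.pBasis.span_eq, Submodule.span_le]
  rintro _ ⟨la, rfl⟩
  rw [Sym.pBasis_apply]
  exact (Submodule.smul_mem_iff _ (hc la)).1 (Submodule.subset_span ⟨la, rfl⟩)

/-- The basis `(m_λ)_λ` of the ring of symmetric functions. -/
noncomputable def Sym.mBasis : Module.Basis Par K Sym :=
  Module.Basis.mk Sym.linearIndependent_m Sym.span_m.ge

theorem Sym.mBasis_apply (la : Par) : Sym.mBasis la = Sym.m la := by
  rw [Sym.mBasis, Module.Basis.mk_apply]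

theorem Sym.mBasis_repr (f : Sym) (la : Par) :
    Sym.mBasis.repr f la = MvPowerSeries.coeff (canonicalExponent la) (Sym.toSeries f) := by
  classical
  have h : Sym.mBasis.coord la =
      (MvPowerSeries.coeff (canonicalExponent la)).comp Sym.toSeries.toLinearMap := by
    refine Sym.mBasis.ext fun mu => ?_
    rw [Module.Basis.coord_apply, Module.Basis.repr_self, LinearMap.comp_apply,
      AlgHom.toLinearMap_apply, Sym.mBasis_apply, Sym.toSeries_m,
      coeff_canonicalExponent_monomialSeries, Finsupp.single_apply]
    simp only [eq_comm]
  exact LinearMap.congr_fun h f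

/-! ### The Macdonald operator -/

/-- The homomorphism `f ↦ f[X + (a - 1)u]`, that is, `p_r ↦ p_r + (a^r - 1)u^r`. -/
noncomputable def Sym.shift (a : K) : Sym →ₐ[K] Polynomial Sym :=
  MvPolynomial.aeval fun r : ℕ+ => Polynomial.C (MvPolynomial.X r) +
    Polynomial.C (MvPolynomial.C (a ^ (r : ℕ) - 1)) * Polynomial.X ^ (r : ℕ)

/-- The coefficient `g_m` of `z^m` in `∏_i (1 - βzx_i) / (1 - zx_i)`, defined by the recursion
`m g_m = ∑_{r=1}^m (1 - β^r) p_r g_{m-r}` that logarithmic differentiation gives. -/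
noncomputable def Sym.g (b : K) : ℕ → Sym
  | 0 => 1
  | m + 1 => ((m : K) + 1)⁻¹ • ∑ i : Fin (m + 1),
      (1 - b ^ ((i : ℕ) + 1)) • (MvPolynomial.X (i : ℕ).succPNat * Sym.g b (m - i))

theorem Sym.g_zero (b : K) : Sym.g b 0 = 1 := by rw [Sym.g]

theorem Sym.g_succ (b : K) (m : ℕ) : ((m : K) + 1) • Sym.g b (m + 1) =
    ∑ i ∈ Finset.range (m + 1),
      (1 - b ^ (i + 1)) • (MvPolynomial.X i.succPNat * Sym.g b (m - i)) := by
  rw [Sym.g, smul_smul, mul_inv_cancel₀ (Nat.cast_add_one_ne_zero m), one_smul,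
    Finset.sum_range]

/-- The operator `f ↦ [z^0] ∏_i (1 - βzx_i) / (1 - zx_i) · f[X + (a - 1)/z]`. -/
noncomputable def Sym.operator (a b : K) : Sym →ₗ[K] Sym :=
  (Polynomial.lsum fun m => LinearMap.mulLeft K (Sym.g b m)) ∘ₗ (Sym.shift a).toLinearMap

theorem Sym.operator_apply {a : K} (b : K) {f : Sym} {N : ℕ} (hN : (Sym.shift a f).natDegree < N) :
    Sym.operator a b f = ∑ m ∈ Finset.range N, Sym.g b m * (Sym.shift a f).coeff m := by
  rw [Sym.operator, LinearMap.comp_apply, AlgHom.toLinearMap_apply, Polynomial.lsum_apply,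
    Polynomial.sum_over_range' _ _ N hN]
  · rfl
  · simp

theorem Sym.derivative_shift (a : K) (f : Sym) : ∃ N₀, ∀ N, N₀ ≤ N →
    Polynomial.derivative (Sym.shift a f) = ∑ i ∈ Finset.range N,
      Polynomial.C (MvPolynomial.C (((i : K) + 1) * (a ^ (i + 1) - 1))) * Polynomial.X ^ i *
        Sym.shift a (MvPolynomial.pderiv i.succPNat f) := by
  induction f using MvPolynomial.induction_on with
  | C c =>
    refine ⟨0, fun N _ => ?_⟩
    simp [Sym.shift, MvPolynomial.algebraMap_eq]
  | add f g hf hg =>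
    obtain ⟨N₁, h₁⟩ := hf
    obtain ⟨N₂, h₂⟩ := hg
    refine ⟨max N₁ N₂, fun N hN => ?_⟩
    rw [map_add, map_add, h₁ N (le_of_max_le_left hN), h₂ N (le_of_max_le_right hN),
      ← Finset.sum_add_distrib]
    exact Finset.sum_congr rfl fun i _ => by rw [map_add, map_add, mul_add]
  | mul_X f s hf =>
    obtain ⟨N₁, h₁⟩ := hf
    refine ⟨max N₁ s, fun N hN => ?_⟩
    have hX : Sym.shift a (MvPolynomial.X s) = Polynomial.C (MvPolynomial.X s) +
        Polynomial.C (MvPolynomial.C (a ^ (s : ℕ) - 1)) * Polynomial.X ^ (s : ℕ) := by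
      simp [Sym.shift]
    obtain ⟨i₀, rfl⟩ : ∃ i : ℕ, s = i.succPNat := ⟨s.natPred, by simp⟩
    have hi₀ : i₀ ∈ Finset.range N := Finset.mem_range.2 (by
      have := le_of_max_le_right hN
      rw [Nat.succPNat_coe] at this
      omega)
    have hd : Polynomial.derivative (Sym.shift a (MvPolynomial.X i₀.succPNat)) =
        Polynomial.C (MvPolynomial.C (((i₀ : K) + 1) * (a ^ (i₀ + 1) - 1))) *
          Polynomial.X ^ i₀ := by
      rw [hX, Nat.succPNat_coe]
      simp only [Polynomial.derivative_C, zero_add,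
        Polynomial.derivative_C_mul, Nat.succ_eq_add_one, Polynomial.derivative_X_pow, map_mul,
        add_tsub_cancel_right, Nat.cast_add, Nat.cast_one, map_add, map_one, map_natCast]
      ring
    rw [map_mul, Polynomial.derivative_mul, h₁ N (le_of_max_le_left hN), hd, Finset.sum_mul]
    have hsum : Sym.shift a f * (Polynomial.C (MvPolynomial.C (((i₀ : K) + 1) *
        (a ^ (i₀ + 1) - 1))) * Polynomial.X ^ i₀) = ∑ i ∈ Finset.range N,
          if i = i₀ then Sym.shift a f * (Polynomial.C (MvPolynomial.C (((i : K) + 1) *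
            (a ^ (i + 1) - 1))) * Polynomial.X ^ i) else 0 := by
      rw [Finset.sum_ite_eq', if_pos hi₀]
    rw [hsum, ← Finset.sum_add_distrib]
    refine Finset.sum_congr rfl fun i _ => ?_
    rw [Derivation.leibniz, MvPolynomial.pderiv_X, smul_eq_mul, smul_eq_mul, map_add, map_mul,
      map_mul, Pi.single_apply]
    by_cases hi : i = i₀
    · subst hi
      simp
      ring
    · have hne : i₀.succPNat ≠ i.succPNat := fun h => hi (Nat.succPNat_injective h).symm
      simp [hi, hne]
      ring

/-- The derivative in `u` of `f[X + (a - 1)u]`, read off coefficient by coefficient. -/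
theorem Sym.coeff_shift_succ (a : K) (f : Sym) (m : ℕ) :
    ((m : K) + 1) • (Sym.shift a f).coeff (m + 1) = ∑ i ∈ Finset.range (m + 1),
      (((i : K) + 1) * (a ^ (i + 1) - 1)) •
        (Sym.shift a (MvPolynomial.pderiv i.succPNat f)).coeff (m - i) := by
  obtain ⟨N₀, hN⟩ := Sym.derivative_shift a f
  have h := congrArg (fun p => Polynomial.coeff p m) (hN (max N₀ (m + 1)) (le_max_left _ _))
  simp only [Polynomial.coeff_derivative, Polynomial.finsetSum_coeff, mul_assoc,
    Polynomial.coeff_C_mul, Polynomial.coeff_X_pow_mul'] at h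
  rw [← Finset.sum_subset (Finset.range_subset_range.2 (le_max_right N₀ (m + 1)))] at h
  · rw [MvPolynomial.smul_eq_C_mul, mul_comm]
    simp only [map_add, map_natCast, map_one]
    refine h.trans (Finset.sum_congr rfl fun i hi => ?_)
    rw [if_pos (by rw [Finset.mem_range] at hi; omega), MvPolynomial.smul_eq_C_mul]
  · intro i _ hi
    rw [if_neg (by rw [Finset.mem_range] at hi; omega), mul_zero]

theorem Sym.coeff_zero_shift (a : K) (f : Sym) : (Sym.shift a f).coeff 0 = f := by
  have h : ((Polynomial.aeval (R := Sym) (0 : Sym)).restrictScalars K).comp (Sym.shift a) =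
      AlgHom.id K Sym := by
    ext1 r
    simp [Sym.shift]
  have h1 := AlgHom.congr_fun h f
  simpa [Polynomial.coeff_zero_eq_aeval_zero] using h1

/-- If `p_r` is adjoint to `N_r ∂/∂p_r`, then multiplication by `g_m` is adjoint to taking the
coefficient of `u^m` in `f[X + (a - 1)u]`, up to a factor `c^m`. -/
theorem Sym.adjoint_g {a b c : K} {N : ℕ+ → K} {B : Sym →ₗ[K] Sym →ₗ[K] K}
    (hB : ∀ r f h, B (MvPolynomial.X r * f) h = N r * B f (MvPolynomial.pderiv r h))
    (hN : ∀ r : ℕ+, (1 - b ^ (r : ℕ)) * N r = c ^ (r : ℕ) * ((r : ℕ) * (a ^ (r : ℕ) - 1)))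
    (m : ℕ) (f h : Sym) :
    B (Sym.g b m * f) h = c ^ m * B f ((Sym.shift a h).coeff m) := by
  induction m using Nat.strong_induction_on generalizing h with
  | _ m ih =>
    cases m with
    | zero =>
      rw [Sym.g_zero, one_mul, pow_zero, one_mul, Sym.coeff_zero_shift]
    | succ m =>
      have hm : ((m : K) + 1) ≠ 0 := Nat.cast_add_one_ne_zero m
      apply mul_left_cancel₀ hm
      calc ((m : K) + 1) * B (Sym.g b (m + 1) * f) h
          = B ((((m : K) + 1) • Sym.g b (m + 1)) * f) h := by
            rw [smul_mul_assoc, map_smul, LinearMap.smul_apply, smul_eq_mul]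
        _ = ∑ i ∈ Finset.range (m + 1), (1 - b ^ (i + 1)) *
              (N i.succPNat * B (Sym.g b (m - i) * f) (MvPolynomial.pderiv i.succPNat h)) := by
            rw [Sym.g_succ, Finset.sum_mul, map_sum, LinearMap.sum_apply]
            refine Finset.sum_congr rfl fun i _ => ?_
            rw [smul_mul_assoc, map_smul, LinearMap.smul_apply, smul_eq_mul, mul_assoc, hB]
        _ = ∑ i ∈ Finset.range (m + 1), c ^ (m + 1) * ((((i : K) + 1) * (a ^ (i + 1) - 1)) *
              B f ((Sym.shift a (MvPolynomial.pderiv i.succPNat h)).coeff (m - i))) := by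
            refine Finset.sum_congr rfl fun i hi => ?_
            rw [Finset.mem_range] at hi
            have h1 := hN i.succPNat
            simp only [Nat.succPNat_coe, Nat.succ_eq_add_one, Nat.cast_add, Nat.cast_one] at h1
            rw [ih (m - i) (by omega), ← mul_assoc, h1]
            have h2 : c ^ (m + 1) = c ^ (i + 1) * c ^ (m - i) := by
              rw [← pow_add]; congr 1; omega
            rw [h2]
            ring
        _ = ((m : K) + 1) * (c ^ (m + 1) * B f ((Sym.shift a h).coeff (m + 1))) := by
            rw [← Finset.mul_sum, mul_left_comm, ← smul_eq_mul ((m : K) + 1), ← map_smul,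
              Sym.coeff_shift_succ, map_sum]
            congr 1
            exact Finset.sum_congr rfl fun i _ => by rw [map_smul, smul_eq_mul]

/-- The operator is `∑_m c^{-m} g_m g_m^*` for every form in which `p_r` is adjoint to a suitable
multiple of `∂/∂p_r`, hence self-adjoint. -/
theorem Sym.operator_selfAdjoint {a b c : K} {N : ℕ+ → K} {B : Sym →ₗ[K] Sym →ₗ[K] K}
    (hB : ∀ r f h, B (MvPolynomial.X r * f) h = N r * B f (MvPolynomial.pderiv r h))
    (hB' : ∀ r f h, B f (MvPolynomial.X r * h) = N r * B (MvPolynomial.pderiv r f) h)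
    (hN : ∀ r : ℕ+, (1 - b ^ (r : ℕ)) * N r = c ^ (r : ℕ) * ((r : ℕ) * (a ^ (r : ℕ) - 1)))
    (f h : Sym) : B (Sym.operator a b f) h = B f (Sym.operator a b h) := by
  set M := max (Sym.shift a f).natDegree (Sym.shift a h).natDegree + 1
  rw [Sym.operator_apply b (f := f) (N := M) (Nat.lt_succ_of_le (le_max_left _ _)),
    Sym.operator_apply b (f := h) (N := M) (Nat.lt_succ_of_le (le_max_right _ _)), map_sum, map_sum,
    LinearMap.sum_apply]
  refine Finset.sum_congr rfl fun m _ => ?_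
  rw [Sym.adjoint_g hB hN]
  have h1 := Sym.adjoint_g (B := B.flip) (N := N) (fun r f h => by
    simpa using hB' r h f) hN m ((Sym.shift a h).coeff m) f
  rw [LinearMap.flip_apply, LinearMap.flip_apply] at h1
  rw [h1]

/-! ### The operator in finitely many variables -/

section PartialFractions

variable {F : Type*} [Field F]

open Polynomial in
theorem natDegree_prod_one_sub_le (s : Finset ℕ) (y : ℕ → F) :
    (∏ i ∈ s, (1 - C (y i) * X)).natDegree ≤ s.card := by
  refine (natDegree_prod_le _ _).trans ?_
  rw [Finset.card_eq_sum_ones]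
  refine Finset.sum_le_sum fun i _ => ?_
  refine (natDegree_sub_le _ _).trans ?_
  simpa using natDegree_C_mul_le (y i) X

/-- The coefficient `A_i = (1 - β) ∏_{j ≠ i} (x_i - βx_j) / (x_i - x_j)`. -/
def residue (s : Finset ℕ) (x : ℕ → F) (b : F) (i : ℕ) : F :=
  (1 - b) * ∏ j ∈ s.erase i, (x i - b * x j) / (x i - x j)

open Polynomial in
/-- The partial fraction expansion of `∏_i (1 - βx_iz) / (1 - x_iz)`, multiplied by its
denominator. -/
theorem prod_one_sub_eq_add_sum_residue {s : Finset ℕ} {x : ℕ → F} (hx : ∀ i ∈ s, x i ≠ 0)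
    (hinj : Set.InjOn x s) (b : F) :
    ∏ i ∈ s, (1 - C (b * x i) * X) = ∏ i ∈ s, (1 - C (x i) * X) +
      ∑ i ∈ s, C (residue s x b i * x i) * X * ∏ j ∈ s.erase i, (1 - C (x j) * X) := by
  classical
  -- Both sides have degree at most `#s` and agree at `0` and at the inverses of the `x_i`.
  set T : Finset F := insert 0 (s.image fun i => (x i)⁻¹)
  have hT : T.card = s.card + 1 := by
    rw [Finset.card_insert_of_notMem, Finset.card_image_of_injOn]
    · intro i hi j hj h
      exact hinj hi hj (inv_injective h)
    · rw [Finset.mem_image]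
      rintro ⟨i, hi, h⟩
      exact hx i hi (inv_eq_zero.1 h)
  refine eq_of_degrees_lt_of_eval_finset_eq T ?_ ?_ ?_
  · rw [hT]
    refine lt_of_le_of_lt degree_le_natDegree ?_
    exact_mod_cast Nat.lt_succ_of_le (natDegree_prod_one_sub_le s fun i => b * x i)
  · rw [hT]
    refine lt_of_le_of_lt degree_le_natDegree ?_
    refine WithBot.coe_lt_coe.2 (Nat.lt_succ_of_le ?_)
    refine natDegree_add_le_of_degree_le (natDegree_prod_one_sub_le s x) ?_
    refine natDegree_sum_le_of_forall_le _ _ fun i hi => ?_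
    refine natDegree_mul_le.trans ?_
    have h1 := natDegree_prod_one_sub_le (s.erase i) x
    have h2 : (C (residue s x b i * x i) * X).natDegree ≤ 1 := by
      simpa using natDegree_C_mul_le (residue s x b i * x i) X
    rw [Finset.card_erase_of_mem hi] at h1
    have h3 := Finset.card_pos.2 ⟨i, hi⟩
    omega
  · intro y hy
    rcases Finset.mem_insert.1 hy with rfl | hy
    · simp [eval_prod, eval_finsetSum]
    · obtain ⟨k, hk, rfl⟩ := Finset.mem_image.1 hy
      have hk0 := hx k hk
      simp only [eval_prod, eval_add, eval_finsetSum, eval_mul, eval_sub, eval_one, eval_C, eval_X]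
      rw [Finset.prod_eq_zero (f := fun j => 1 - x j * (x k)⁻¹) hk
          (by rw [mul_inv_cancel₀ hk0, sub_self]), zero_add, Finset.sum_eq_single k]
      · rw [mul_assoc (residue s x b k), mul_inv_cancel₀ hk0, mul_one, residue,
          ← Finset.mul_prod_erase s _ hk, mul_assoc (1 - b), ← Finset.prod_mul_distrib]
        congr 1
        · field_simp
        · refine Finset.prod_congr rfl fun j hj => ?_
          rw [Finset.mem_erase] at hj
          have hne : x k - x j ≠ 0 := fun h =>
            hj.1 (hinj hj.2 hk (sub_eq_zero.1 h).symm)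
          field_simp
      · intro i _ hik
        rw [Finset.prod_eq_zero (Finset.mem_erase.2 ⟨hik.symm, hk⟩)
          (by rw [mul_inv_cancel₀ hk0, sub_self]), mul_zero]
      · exact fun h => absurd hk h

/-- The series `∑_{i ∈ s} ∑_n y_i^{n+1} z^n`. -/
noncomputable def powerSumGenerating (s : Finset ℕ) (y : ℕ → F) : PowerSeries F :=
  PowerSeries.mk fun n => ∑ i ∈ s, y i ^ (n + 1)

theorem one_sub_mul_mk (y : F) : (1 - PowerSeries.C y * PowerSeries.X) *
    PowerSeries.mk (fun n => y ^ (n + 1)) = PowerSeries.C y := by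
  ext n
  rw [sub_mul, one_mul, mul_assoc, map_sub, PowerSeries.coeff_C_mul]
  cases n with
  | zero => simp
  | succ n =>
    rw [PowerSeries.coeff_succ_X_mul, PowerSeries.coeff_mk, PowerSeries.coeff_mk,
      PowerSeries.coeff_C, if_neg (Nat.succ_ne_zero n)]
    ring

theorem derivative_prod_one_sub (s : Finset ℕ) (y : ℕ → F) :
    PowerSeries.derivative F (∏ i ∈ s, (1 - PowerSeries.C (y i) * PowerSeries.X)) =
      -((∏ i ∈ s, (1 - PowerSeries.C (y i) * PowerSeries.X)) * powerSumGenerating s y) := by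
  classical
  induction s using Finset.induction_on with
  | empty =>
    rw [Finset.prod_empty, PowerSeries.derivative_one, one_mul, eq_comm, neg_eq_zero]
    ext n
    simp [powerSumGenerating]
  | insert i s hi ih =>
    have h1 : powerSumGenerating (insert i s) y =
        PowerSeries.mk (fun n => y i ^ (n + 1)) + powerSumGenerating s y := by
      ext n
      simp [powerSumGenerating, Finset.sum_insert hi]
    have h2 : PowerSeries.derivative F (1 - PowerSeries.C (y i) * PowerSeries.X) =
        -PowerSeries.C (y i) := by
      rw [map_sub, PowerSeries.derivative_one, Derivation.leibniz, PowerSeries.derivative_C,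
        PowerSeries.derivative_X]
      simp
    rw [Finset.prod_insert hi, Derivation.leibniz, ih, h2, h1, smul_eq_mul, smul_eq_mul]
    linear_combination (∏ i ∈ s, (1 - PowerSeries.C (y i) * PowerSeries.X)) * one_sub_mul_mk (y i)

/-- The series `1 + ∑_{m ≥ 1} (∑_i A_i x_i^m) z^m`. -/
noncomputable def residueSeries (s : Finset ℕ) (x : ℕ → F) (b : F) : PowerSeries F :=
  1 + PowerSeries.X * PowerSeries.mk fun n => ∑ i ∈ s, residue s x b i * x i ^ (n + 1)

theorem residueSeries_mul_prod {s : Finset ℕ} {x : ℕ → F} (hx : ∀ i ∈ s, x i ≠ 0)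
    (hinj : Set.InjOn x s) (b : F) :
    residueSeries s x b * ∏ i ∈ s, (1 - PowerSeries.C (x i) * PowerSeries.X) =
      ∏ i ∈ s, (1 - PowerSeries.C (b * x i) * PowerSeries.X) := by
  classical
  have h := congrArg (Polynomial.coeToPowerSeries.ringHom (R := F))
    (prod_one_sub_eq_add_sum_residue hx hinj b)
  simp only [map_prod, map_sub, map_one, map_add, map_sum,
    Polynomial.coeToPowerSeries.ringHom_apply, Polynomial.coe_C, Polynomial.coe_X,
    Polynomial.coe_mul] at h
  have hcoe : ∀ i, ((∏ j ∈ s.erase i, (1 - Polynomial.C (x j) * Polynomial.X) : Polynomial F) :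
      PowerSeries F) = ∏ j ∈ s.erase i, (1 - PowerSeries.C (x j) * PowerSeries.X) := fun i => by
    rw [← Polynomial.coeToPowerSeries.ringHom_apply, map_prod]
    simp
  simp only [hcoe] at h
  have hmk : (PowerSeries.mk fun n => ∑ i ∈ s, residue s x b i * x i ^ (n + 1)) =
      ∑ i ∈ s, PowerSeries.C (residue s x b i) * PowerSeries.mk fun n => x i ^ (n + 1) := by
    ext n
    simp
  rw [h, residueSeries, hmk, add_mul, one_mul, Finset.mul_sum, Finset.sum_mul]
  congr 1
  refine Finset.sum_congr rfl fun i hi => ?_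
  rw [← Finset.mul_prod_erase s _ hi, map_mul]
  linear_combination PowerSeries.X * PowerSeries.C (residue s x b i) *
    (∏ j ∈ s.erase i, (1 - PowerSeries.C (x j) * PowerSeries.X)) * one_sub_mul_mk (x i)

theorem derivative_residueSeries {s : Finset ℕ} {x : ℕ → F} (hx : ∀ i ∈ s, x i ≠ 0)
    (hinj : Set.InjOn x s) (b : F) :
    PowerSeries.derivative F (residueSeries s x b) = residueSeries s x b *
      (powerSumGenerating s x - powerSumGenerating s fun i => b * x i) := by
  have h := residueSeries_mul_prod hx hinj b
  have hd := congrArg (PowerSeries.derivative F) h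
  rw [Derivation.leibniz, derivative_prod_one_sub, derivative_prod_one_sub s fun i => b * x i,
    smul_eq_mul, smul_eq_mul] at hd
  have hne : ∏ i ∈ s, (1 - PowerSeries.C (x i) * PowerSeries.X) ≠ 0 := by
    rw [Finset.prod_ne_zero_iff]
    intro i _ h0
    have := congrArg PowerSeries.constantCoeff h0
    simp at this
  apply mul_right_cancel₀ hne
  linear_combination hd + (powerSumGenerating s fun i => b * x i) * h

/-- In the variables `x_i` the function `g_m` is `∑_i A_i x_i^m` for `m ≥ 1`. -/
theorem map_g [Algebra K F] {s : Finset ℕ} {x : ℕ → F} (hx : ∀ i ∈ s, x i ≠ 0)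
    (hinj : Set.InjOn x s) (b : K) {χ : Sym →ₐ[K] F}
    (hχ : ∀ r : ℕ+, χ (MvPolynomial.X r) = ∑ i ∈ s, x i ^ (r : ℕ)) (m : ℕ) :
    χ (Sym.g b m) = PowerSeries.coeff m (residueSeries s x (algebraMap K F b)) := by
  induction m using Nat.strong_induction_on with
  | _ m ih =>
    cases m with
    | zero => simp [Sym.g_zero, residueSeries]
    | succ m =>
      have hm : ((m : F) + 1) ≠ 0 := by
        have := (map_ne_zero (algebraMap K F)).2 (Nat.cast_add_one_ne_zero (R := K) m)
        simpa using this
      apply mul_left_cancel₀ hm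
      have h1 := congrArg χ (Sym.g_succ b m)
      have h2 := congrArg (PowerSeries.coeff m) (derivative_residueSeries hx hinj (algebraMap K F b))
      rw [PowerSeries.coeff_derivative, mul_comm (residueSeries _ _ _), PowerSeries.coeff_mul,
        Finset.Nat.sum_antidiagonal_eq_sum_range_succ_mk] at h2
      rw [mul_comm _ (PowerSeries.coeff _ _), h2]
      rw [map_smul, Algebra.smul_def, map_sum] at h1
      simp only [map_add, map_natCast, map_one] at h1
      rw [h1]
      refine Finset.sum_congr rfl fun i hi => ?_
      rw [map_smul, map_mul, hχ, ih (m - i) (by omega), Nat.succPNat_coe, Algebra.smul_def,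
        ← mul_assoc]
      congr 1
      simp only [powerSumGenerating, map_sub, PowerSeries.coeff_mk, map_one, map_pow, mul_pow,
        ← Finset.mul_sum, Nat.succ_eq_add_one]
      ring

/-- The operator in the variables `x_i`: it is `f ↦ f + ∑_i A_i (T_i f - f)`, where `T_i f` is `f`
with `x_i` replaced by `a x_i`. -/
theorem map_operator [Algebra K F] {s : Finset ℕ} {x : ℕ → F} (hx : ∀ i ∈ s, x i ≠ 0)
    (hinj : Set.InjOn x s) (a b : K) {χ : Sym →ₐ[K] F}
    (hχ : ∀ r : ℕ+, χ (MvPolynomial.X r) = ∑ i ∈ s, x i ^ (r : ℕ)) (f : Sym) :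
    χ (Sym.operator a b f) = χ f + ∑ i ∈ s, residue s x (algebraMap K F b) i *
      (Polynomial.eval₂ χ.toRingHom (x i) (Sym.shift a f) - χ f) := by
  set M := (Sym.shift a f).natDegree
  have h1 : ∀ i, Polynomial.eval₂ χ.toRingHom (x i) (Sym.shift a f) = χ f +
      ∑ m ∈ Finset.range M, χ ((Sym.shift a f).coeff (m + 1)) * x i ^ (m + 1) := by
    intro i
    rw [Polynomial.eval₂_eq_sum_range, Finset.sum_range_succ', pow_zero, mul_one,
      Sym.coeff_zero_shift, add_comm]
    rfl
  rw [Sym.operator_apply b (N := M + 1) (Nat.lt_succ_self _), Finset.sum_range_succ', map_add,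
    Sym.coeff_zero_shift, Sym.g_zero, one_mul, add_comm, map_sum]
  congr 1
  simp only [h1, add_sub_cancel_left]
  simp only [Finset.mul_sum]
  rw [Finset.sum_comm]
  refine Finset.sum_congr rfl fun m _ => ?_
  rw [map_mul, map_g hx hinj b hχ, residueSeries, map_add, PowerSeries.coeff_succ_X_mul,
    PowerSeries.coeff_mk, PowerSeries.coeff_one, if_neg (Nat.succ_ne_zero m), zero_add,
    Finset.sum_mul]
  exact Finset.sum_congr rfl fun i _ => by ring

end PartialFractions

/-! ### Power series with bounded exponents -/

/-- The power series whose exponents satisfy the bounds `D` on the functionals `W`. -/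
def boundedSeries {σ Ω : Type} (W : Ω → (σ →₀ ℕ) →+ ℕ) (D : Ω → ℕ) :
    Submodule K (MvPowerSeries σ K) where
  carrier := {F | ∀ e, MvPowerSeries.coeff e F ≠ 0 → ∀ o, W o e ≤ D o}
  zero_mem' := fun e he => by simp at he
  add_mem' := by
    intro F G hF hG e he
    by_cases h : MvPowerSeries.coeff e F = 0
    · rw [map_add, h, zero_add] at he
      exact hG e he
    · exact hF e h
  smul_mem' := by
    intro c F hF e he
    rw [MvPowerSeries.coeff_smul] at he
    exact hF e (right_ne_zero_of_mul he)

section BoundedSeries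

variable {σ Ω : Type} {W : Ω → (σ →₀ ℕ) →+ ℕ} {D D' : Ω → ℕ} {F G : MvPowerSeries σ K}

theorem boundedSeries_mono (h : ∀ o, D o ≤ D' o) : boundedSeries W D ≤ boundedSeries W D' :=
  fun _ hF e he o => (hF e he o).trans (h o)

theorem mul_mem_boundedSeries (hF : F ∈ boundedSeries W D) (hG : G ∈ boundedSeries W D') :
    F * G ∈ boundedSeries W (D + D') := by
  classical
  intro e he o
  rw [MvPowerSeries.coeff_mul] at he
  obtain ⟨⟨x, y⟩, hxy, hne⟩ := Finset.exists_ne_zero_of_sum_ne_zero he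
  rw [Finset.HasAntidiagonal.mem_antidiagonal] at hxy
  rw [← hxy, map_add]
  exact add_le_add (hF x (left_ne_zero_of_mul hne) o) (hG y (right_ne_zero_of_mul hne) o)

theorem one_mem_boundedSeries : (1 : MvPowerSeries σ K) ∈ boundedSeries W 0 := by
  classical
  intro e he o
  rw [MvPowerSeries.coeff_one] at he
  have : e = 0 := by by_contra h; simp [h] at he
  simp [this]

theorem multiset_prod_mem_boundedSeries {ι : Type} {s : Multiset ι} {F : ι → MvPowerSeries σ K}
    {D : ι → Ω → ℕ} (h : ∀ i ∈ s, F i ∈ boundedSeries W (D i)) :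
    (s.map F).prod ∈ boundedSeries W (s.map D).sum := by
  induction s using Multiset.induction_on with
  | empty => simpa using one_mem_boundedSeries
  | cons i s ih =>
    simp only [Multiset.map_cons, Multiset.prod_cons, Multiset.sum_cons]
    exact mul_mem_boundedSeries (h i (Multiset.mem_cons_self i s))
      (ih fun j hj => h j (Multiset.mem_cons_of_mem hj))

end BoundedSeries

/-! ### Leading exponents -/

/-- The exponents of `F` are bounded by `e₀` for every linear functional of the family `W`. -/
def ExponentsLe {σ Ω : Type} (W : Ω → (σ →₀ ℕ) →+ ℕ) (F : MvPowerSeries σ K) (e₀ : σ →₀ ℕ) :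
    Prop :=
  F ∈ boundedSeries W fun o => W o e₀

section ExponentsLe

variable {σ Ω : Type} {W : Ω → (σ →₀ ℕ) →+ ℕ} {F G : MvPowerSeries σ K} {e₀ e₁ : σ →₀ ℕ}

theorem exponentsLe_one : ExponentsLe W (1 : MvPowerSeries σ K) 0 :=
  boundedSeries_mono (fun _ => Nat.zero_le _) one_mem_boundedSeries

theorem ExponentsLe.mul (hF : ExponentsLe W F e₀) (hG : ExponentsLe W G e₁) :
    ExponentsLe W (F * G) (e₀ + e₁) :=
  boundedSeries_mono (fun o => (map_add (W o) e₀ e₁).ge) (mul_mem_boundedSeries hF hG)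

theorem ExponentsLe.smul (hF : ExponentsLe W F e₀) (c : K) : ExponentsLe W (c • F) e₀ :=
  Submodule.smul_mem _ c hF

theorem ExponentsLe.add (hF : ExponentsLe W F e₀) (hG : ExponentsLe W G e₀) :
    ExponentsLe W (F + G) e₀ :=
  Submodule.add_mem _ hF hG

theorem exponentsLe_sum {ι : Type*} {s : Finset ι} {F : ι → MvPowerSeries σ K}
    (h : ∀ i ∈ s, ExponentsLe W (F i) e₀) : ExponentsLe W (∑ i ∈ s, F i) e₀ :=
  Submodule.sum_mem _ h

/-- Leading coefficients multiply: a decomposition of the sum of the leading exponents into two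
exponents of the factors must be an equality for every functional. -/
theorem ExponentsLe.coeff_mul (hW : ∀ e e', (∀ o, W o e = W o e') → e = e')
    (hF : ExponentsLe W F e₀) (hG : ExponentsLe W G e₁) :
    MvPowerSeries.coeff (e₀ + e₁) (F * G) =
      MvPowerSeries.coeff e₀ F * MvPowerSeries.coeff e₁ G := by
  classical
  rw [MvPowerSeries.coeff_mul, Finset.sum_eq_single (e₀, e₁)]
  · rintro ⟨x, y⟩ hxy hne
    rw [Finset.HasAntidiagonal.mem_antidiagonal] at hxy
    by_contra h0
    apply hne
    have hx : ∀ o, W o x ≤ W o e₀ := hF x (left_ne_zero_of_mul h0)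
    have hy : ∀ o, W o y ≤ W o e₁ := hG y (right_ne_zero_of_mul h0)
    have hsum : ∀ o, W o x + W o y = W o e₀ + W o e₁ := fun o => by
      rw [← map_add, ← map_add]; exact congrArg _ hxy
    refine Prod.ext (hW _ _ fun o => ?_) (hW _ _ fun o => ?_)
    · have := hx o; have := hy o; have := hsum o
      change W o x = W o e₀; omega
    · have := hx o; have := hy o; have := hsum o
      change W o y = W o e₁; omega
  · intro h
    simp at h

theorem exponentsLe_prod_and_coeff {ι : Type*} (hW : ∀ e e', (∀ o, W o e = W o e') → e = e')
    {s : Finset ι} {F : ι → MvPowerSeries σ K} {d : ι → σ →₀ ℕ}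
    (h : ∀ i ∈ s, ExponentsLe W (F i) (d i)) :
    ExponentsLe W (∏ i ∈ s, F i) (∑ i ∈ s, d i) ∧
      MvPowerSeries.coeff (∑ i ∈ s, d i) (∏ i ∈ s, F i) =
        ∏ i ∈ s, MvPowerSeries.coeff (d i) (F i) := by
  classical
  induction s using Finset.induction_on with
  | empty =>
    refine ⟨?_, by simp⟩
    rw [Finset.sum_empty, Finset.prod_empty]
    exact exponentsLe_one
  | insert i s hi ih =>
    obtain ⟨h1, h2⟩ := ih fun j hj => h j (Finset.mem_insert_of_mem hj)
    have h3 := h i (Finset.mem_insert_self _ _)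
    rw [Finset.sum_insert hi, Finset.prod_insert hi, Finset.prod_insert hi]
    exact ⟨h3.mul h1, by rw [h3.coeff_mul hW h1, h2]⟩

end ExponentsLe

theorem coeff_add_single_X_mul {σ : Type} (h : MvPowerSeries σ K) (e : σ →₀ ℕ) (k : σ) :
    MvPowerSeries.coeff (e + Finsupp.single k 1) (MvPowerSeries.X k * h) =
      MvPowerSeries.coeff e h := by
  rw [MvPowerSeries.X, add_comm, MvPowerSeries.coeff_add_monomial_mul, one_mul]

theorem exists_of_coeff_X_mul_ne_zero {σ : Type} {h : MvPowerSeries σ K} {e : σ →₀ ℕ} {k : σ}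
    (hne : MvPowerSeries.coeff e (MvPowerSeries.X k * h) ≠ 0) :
    ∃ e', e' + Finsupp.single k 1 = e ∧ MvPowerSeries.coeff e' h ≠ 0 := by
  classical
  rw [MvPowerSeries.X, MvPowerSeries.coeff_monomial_mul] at hne
  split_ifs at hne with hle
  · exact ⟨e - Finsupp.single k 1, tsub_add_cancel_of_le hle, by simpa using hne⟩
  · exact absurd rfl hne

theorem functional_le_of_X_sub_X_mul_aux {σ : Type} {w : (σ →₀ ℕ) →+ ℕ} {k l : σ} (hkl : k ≠ l)
    (hw : w (Finsupp.single l 1) ≤ w (Finsupp.single k 1)) {h : MvPowerSeries σ K} {d : ℕ}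
    (hb : ∀ e, MvPowerSeries.coeff e ((MvPowerSeries.X k - MvPowerSeries.X l) * h) ≠ 0 →
      w e ≤ d + w (Finsupp.single k 1)) :
    ∀ e, MvPowerSeries.coeff e h ≠ 0 → w e ≤ d := by
  -- Moving a unit of an offending exponent from `l` to `k` gives another one, which cannot go on
  -- for ever.
  intro e
  induction hn : e l using Nat.strong_induction_on generalizing e with
  | _ n ih =>
    intro he
    by_contra hlt
    have h1 : MvPowerSeries.coeff (e + Finsupp.single k 1)
        ((MvPowerSeries.X k - MvPowerSeries.X l) * h) = 0 := by
      by_contra h0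
      have := hb _ h0
      rw [map_add] at this
      omega
    rw [sub_mul, map_sub, coeff_add_single_X_mul, sub_eq_zero] at h1
    obtain ⟨e', he', hne⟩ := exists_of_coeff_X_mul_ne_zero (h1 ▸ he)
    have h2 : e' l + 1 = e l := by
      have := DFunLike.congr_fun he' l
      simpa [Finsupp.single_apply, hkl] using this
    have h3 := ih (e' l) (by omega) e' rfl hne
    have h4 := congrArg w he'
    rw [map_add, map_add] at h4
    omega

/-- A linear functional is maximal on a product with `X_k - X_l` at the sum of its maxima. -/
theorem functional_le_of_X_sub_X_mul {σ : Type} {w : (σ →₀ ℕ) →+ ℕ} {k l : σ} (hkl : k ≠ l)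
    {h : MvPowerSeries σ K} {d : ℕ}
    (hb : ∀ e, MvPowerSeries.coeff e ((MvPowerSeries.X k - MvPowerSeries.X l) * h) ≠ 0 →
      w e ≤ d + max (w (Finsupp.single k 1)) (w (Finsupp.single l 1))) :
    ∀ e, MvPowerSeries.coeff e h ≠ 0 → w e ≤ d := by
  rcases le_total (w (Finsupp.single l 1)) (w (Finsupp.single k 1)) with hw | hw
  · exact functional_le_of_X_sub_X_mul_aux hkl hw (by simpa [max_eq_left hw] using hb)
  · refine functional_le_of_X_sub_X_mul_aux hkl.symm hw fun e he => ?_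
    rw [max_eq_right hw] at hb
    refine hb e fun h0 => he ?_
    rw [← neg_sub, neg_mul, map_neg, h0, neg_zero]

theorem functional_le_of_prod_X_sub_X_mul {σ ι : Type} {w : (σ →₀ ℕ) →+ ℕ} {s : Finset ι}
    {k l : ι → σ} (hkl : ∀ i ∈ s, k i ≠ l i) {h : MvPowerSeries σ K} {d : ℕ}
    (hb : ∀ e, MvPowerSeries.coeff e
        ((∏ i ∈ s, (MvPowerSeries.X (k i) - MvPowerSeries.X (l i))) * h) ≠ 0 →
      w e ≤ d + ∑ i ∈ s, max (w (Finsupp.single (k i) 1)) (w (Finsupp.single (l i) 1))) :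
    ∀ e, MvPowerSeries.coeff e h ≠ 0 → w e ≤ d := by
  classical
  induction s using Finset.induction_on with
  | empty => simpa using hb
  | insert i s hi ih =>
    refine ih (fun j hj => hkl j (Finset.mem_insert_of_mem hj)) ?_
    refine functional_le_of_X_sub_X_mul (hkl i (Finset.mem_insert_self _ _)) fun e he => ?_
    rw [Finset.prod_insert hi, Finset.sum_insert hi, mul_assoc] at hb
    refine (hb e he).trans (le_of_eq ?_)
    omega

/-- The functional `e ↦ e_0 + ⋯ + e_{j-1}`. -/
def prefixSum (j : ℕ) : (ℕ →₀ ℕ) →+ ℕ where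
  toFun e := ∑ i ∈ Finset.range j, e i
  map_zero' := by simp
  map_add' := by simp [Finset.sum_add_distrib]

theorem prefixSum_apply (j : ℕ) (e : ℕ →₀ ℕ) : prefixSum j e = ∑ i ∈ Finset.range j, e i := rfl

theorem eq_of_prefixSum_eq (e e' : ℕ →₀ ℕ) (h : ∀ j, prefixSum j e = prefixSum j e') : e = e' := by
  ext i
  have h1 := h (i + 1)
  have h2 := h i
  rw [prefixSum_apply, prefixSum_apply] at h1 h2
  rw [Finset.sum_range_succ, Finset.sum_range_succ, h2] at h1
  exact Nat.add_left_cancel h1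

theorem prefixSum_single (j i : ℕ) : prefixSum j (Finsupp.single i 1) = if i < j then 1 else 0 := by
  simp [prefixSum_apply, Finsupp.single_apply]

/-! ### Triangularity of the operator -/

/-- The product `∏_{k ≠ j} (x_k - c_k x_j)` over the variables with index less than `N`. -/
noncomputable def differenceProduct (N : ℕ) (c : ℕ → K) : MvPowerSeries ℕ K :=
  ∏ k ∈ Finset.range N, ∏ j ∈ (Finset.range N).erase k,
    (MvPowerSeries.X k - MvPowerSeries.C (c k) * MvPowerSeries.X j)

/-- The leading exponent of `differenceProduct`. -/
noncomputable def differenceExponent (N : ℕ) : ℕ →₀ ℕ :=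
  ∑ k ∈ Finset.range N, ∑ j ∈ (Finset.range N).erase k, Finsupp.single (min k j) 1

theorem exponentsLe_X_sub {k j : ℕ} (c : K) :
    ExponentsLe prefixSum (MvPowerSeries.X k - MvPowerSeries.C c * MvPowerSeries.X j)
      (Finsupp.single (min k j) 1) := by
  classical
  intro e he o
  have h : e = Finsupp.single k 1 ∨ e = Finsupp.single j 1 := by
    by_contra! hne
    rw [map_sub, MvPowerSeries.coeff_C_mul, MvPowerSeries.coeff_X, MvPowerSeries.coeff_X,
      if_neg hne.1, if_neg hne.2] at he
    simp at he
  rcases h with rfl | rfl <;> simp only [prefixSum_single] <;> split_ifs <;> omega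

theorem coeff_X_sub {k j : ℕ} (hkj : j ≠ k) (c : K) :
    MvPowerSeries.coeff (Finsupp.single (min k j) 1)
      (MvPowerSeries.X k - MvPowerSeries.C c * MvPowerSeries.X j) = if k < j then 1 else -c := by
  classical
  rw [map_sub, MvPowerSeries.coeff_C_mul, MvPowerSeries.coeff_X, MvPowerSeries.coeff_X]
  simp only [Finsupp.single_left_inj (one_ne_zero (α := ℕ))]
  split_ifs <;> first | omega | simp

theorem exponentsLe_differenceProduct (N : ℕ) (c : ℕ → K) :
    ExponentsLe prefixSum (differenceProduct N c) (differenceExponent N) :=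
  (exponentsLe_prod_and_coeff eq_of_prefixSum_eq fun _ _ =>
    (exponentsLe_prod_and_coeff eq_of_prefixSum_eq fun _ _ => exponentsLe_X_sub _).1).1

theorem coeff_differenceProduct (N : ℕ) (c : ℕ → K) :
    MvPowerSeries.coeff (differenceExponent N) (differenceProduct N c) =
      ∏ k ∈ Finset.range N, ∏ j ∈ (Finset.range N).erase k, if k < j then 1 else -c k := by
  rw [differenceExponent, differenceProduct, (exponentsLe_prod_and_coeff eq_of_prefixSum_eq
    fun _ _ => (exponentsLe_prod_and_coeff eq_of_prefixSum_eq fun _ _ => exponentsLe_X_sub _).1).2]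
  refine Finset.prod_congr rfl fun k _ => ?_
  rw [(exponentsLe_prod_and_coeff eq_of_prefixSum_eq fun _ _ => exponentsLe_X_sub _).2]
  exact Finset.prod_congr rfl fun j hj => coeff_X_sub (Finset.ne_of_mem_erase hj) _

theorem coeff_differenceProduct_one_ne_zero (N : ℕ) :
    MvPowerSeries.coeff (differenceExponent N) (differenceProduct N 1) ≠ 0 := by
  rw [coeff_differenceProduct]
  refine Finset.prod_ne_zero_iff.2 fun k _ => Finset.prod_ne_zero_iff.2 fun j _ => ?_
  split_ifs <;> simp

theorem coeff_differenceProduct_update {N i : ℕ} (hi : i < N) (b : K) :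
    MvPowerSeries.coeff (differenceExponent N) (differenceProduct N (Function.update 1 i b)) =
      b ^ i * MvPowerSeries.coeff (differenceExponent N) (differenceProduct N 1) := by
  have hiN : i ∈ Finset.range N := Finset.mem_range.2 hi
  rw [coeff_differenceProduct, coeff_differenceProduct, ← Finset.mul_prod_erase _ _ hiN,
    ← Finset.mul_prod_erase (Finset.range N) _ hiN, ← mul_assoc]
  congr 1
  · have h1 : ∀ j ∈ (Finset.range N).erase i,
        (if i < j then (1 : K) else -(Function.update 1 i b : ℕ → K) i) =
          (if i < j then 1 else b) * if i < j then 1 else -(1 : ℕ → K) i := by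
      intro j _
      split_ifs <;> simp
    have h2 : (((Finset.range N).erase i).filter fun j => ¬ i < j) = Finset.range i := by
      ext j
      simp only [Finset.mem_filter, Finset.mem_erase, Finset.mem_range]
      omega
    rw [Finset.prod_congr rfl h1, Finset.prod_mul_distrib, Finset.prod_ite, Finset.prod_const_one,
      one_mul, Finset.prod_const, h2, Finset.card_range]
  · refine Finset.prod_congr rfl fun k hk => Finset.prod_congr rfl fun j _ => ?_
    rw [Function.update_of_ne (Finset.ne_of_mem_erase hk)]

theorem prefixSum_le_of_differenceProduct_mul {N j d : ℕ} {h : MvPowerSeries ℕ K}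
    (hb : ∀ e, MvPowerSeries.coeff e (differenceProduct N 1 * h) ≠ 0 →
      prefixSum j e ≤ prefixSum j (differenceExponent N) + d) :
    ∀ e, MvPowerSeries.coeff e h ≠ 0 → prefixSum j e ≤ d := by
  have h1 : differenceProduct N 1 = ∏ p ∈ (Finset.range N).sigma fun k => (Finset.range N).erase k,
      (MvPowerSeries.X p.1 - MvPowerSeries.X p.2) := by
    rw [Finset.prod_sigma]
    simp [differenceProduct]
  have h2 : prefixSum j (differenceExponent N) =
      ∑ p ∈ (Finset.range N).sigma fun k => (Finset.range N).erase k,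
        max (prefixSum j (Finsupp.single p.1 1)) (prefixSum j (Finsupp.single p.2 1)) := by
    rw [Finset.sum_sigma, differenceExponent, map_sum]
    refine Finset.sum_congr rfl fun k _ => ?_
    rw [map_sum]
    refine Finset.sum_congr rfl fun l _ => ?_
    simp only [prefixSum_single]
    split_ifs <;> omega
  refine functional_le_of_prod_X_sub_X_mul (s := (Finset.range N).sigma fun k =>
    (Finset.range N).erase k) (k := fun p => p.1) (l := fun p => p.2) ?_ ?_
  · intro p hp
    rw [Finset.mem_sigma] at hp
    exact (Finset.ne_of_mem_erase hp.2).symm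
  · intro e he
    rw [← h1] at he
    rw [add_comm d, ← h2]
    exact hb e he

theorem powerSumSeries_Iio (N : ℕ) (r : ℕ+) :
    powerSumSeries (Set.Iio N) r = ∑ i ∈ Finset.range N, MvPowerSeries.X i ^ (r : ℕ) := by
  classical
  ext e
  rw [coeff_powerSumSeries, map_sum]
  simp only [MvPowerSeries.coeff_X_pow]
  by_cases h : ∃ v ∈ Set.Iio N, e = Finsupp.single v (r : ℕ)
  · obtain ⟨v, hv, rfl⟩ := h
    rw [if_pos ⟨v, hv, rfl⟩, Finset.sum_eq_single v]
    · simp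
    · intro i _ hi
      rw [if_neg]
      rw [Finsupp.single_left_inj (PNat.ne_zero r)]
      exact hi.symm
    · exact fun h => absurd (Finset.mem_range.2 hv) h
  · rw [if_neg h, Finset.sum_eq_zero]
    intro i hi
    rw [if_neg]
    rintro rfl
    exact h ⟨i, Finset.mem_range.1 hi, rfl⟩

theorem eval₂_shift (a : K) {N i : ℕ} (hi : i < N) (f : Sym) :
    Polynomial.eval₂ (Sym.inAlphabet (Set.Iio N)).toRingHom (MvPowerSeries.X i) (Sym.shift a f) =
      MvPowerSeries.rescale (Function.update (1 : ℕ → K) i a) (Sym.inAlphabet (Set.Iio N) f) := by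
  have hC : ∀ c : K, Sym.inAlphabet (Set.Iio N) (MvPolynomial.C c) = MvPowerSeries.C c := by
    intro c
    simp [Sym.inAlphabet, MvPowerSeries.c_eq_algebraMap]
  have hX : ∀ j, MvPowerSeries.rescale (Function.update (1 : ℕ → K) i a) (MvPowerSeries.X j) =
      MvPowerSeries.C (Function.update (1 : ℕ → K) i a j) * (MvPowerSeries.X j : MvPowerSeries ℕ K) := by
    classical
    intro j
    ext n
    rw [MvPowerSeries.coeff_rescale, MvPowerSeries.coeff_C_mul, MvPowerSeries.coeff_X]
    split_ifs with h
    · rw [h]; simp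
    · simp
  have hrC : ∀ c : K, MvPowerSeries.rescale (Function.update (1 : ℕ → K) i a)
      (MvPowerSeries.C c : MvPowerSeries ℕ K) = MvPowerSeries.C c := by
    classical
    intro c
    ext n
    rw [MvPowerSeries.coeff_rescale, MvPowerSeries.coeff_C]
    split_ifs with h
    · rw [h]; simp
    · simp
  have h : (Polynomial.eval₂RingHom (Sym.inAlphabet (Set.Iio N)).toRingHom
      (MvPowerSeries.X i)).comp (Sym.shift a).toRingHom =
      (MvPowerSeries.rescale (Function.update (1 : ℕ → K) i a)).comp
        (Sym.inAlphabet (Set.Iio N)).toRingHom := by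
    refine MvPolynomial.ringHom_ext (fun c => ?_) fun r => ?_
    · have h1 : Sym.shift a (MvPolynomial.C c) = Polynomial.C (MvPolynomial.C c) := by
        rw [← MvPolynomial.algebraMap_eq, AlgHom.commutes]
        rfl
      simp [h1, hC, hrC]
    · have h1 : Sym.inAlphabet (Set.Iio N) (MvPolynomial.X r) =
          ∑ j ∈ Finset.range N, (MvPowerSeries.X j : MvPowerSeries ℕ K) ^ (r : ℕ) := by
        rw [← powerSumSeries_Iio]
        simp [Sym.inAlphabet]
      have h2 : Sym.shift a (MvPolynomial.X r) = Polynomial.C (MvPolynomial.X r) +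
          Polynomial.C (MvPolynomial.C (a ^ (r : ℕ) - 1)) * Polynomial.X ^ (r : ℕ) := by
        simp [Sym.shift]
      have hiN : i ∈ Finset.range N := Finset.mem_range.2 hi
      simp only [RingHom.comp_apply, AlgHom.toRingHom_eq_coe, RingHom.coe_coe, h1, h2, map_sum,
        map_pow, hX, Polynomial.coe_eval₂RingHom, Polynomial.eval₂_add, Polynomial.eval₂_mul,
        Polynomial.eval₂_C, Polynomial.eval₂_pow, Polynomial.eval₂_X, hC, mul_pow]
      rw [← Finset.add_sum_erase _ _ hiN, ← Finset.add_sum_erase (Finset.range N) _ hiN,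
        Function.update_self]
      have hupdate : ∑ j ∈ (Finset.range N).erase i,
          MvPowerSeries.C (Function.update (1 : ℕ → K) i a j) ^ (r : ℕ) *
            (MvPowerSeries.X j : MvPowerSeries ℕ K) ^ (r : ℕ) =
          ∑ j ∈ (Finset.range N).erase i, MvPowerSeries.X j ^ (r : ℕ) :=
        Finset.sum_congr rfl fun j hj => by
          rw [Function.update_of_ne (Finset.ne_of_mem_erase hj)]
          simp
      rw [hupdate]
      simp
      ring
  exact RingHom.congr_fun h f

/-- The operator in finitely many variables, with the denominators cleared. -/
theorem differenceProduct_mul_operator (a b : K) (N : ℕ) (f : Sym) :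
    differenceProduct N 1 * (Sym.inAlphabet (Set.Iio N) (Sym.operator a b f) -
        Sym.inAlphabet (Set.Iio N) f) =
      ∑ i ∈ Finset.range N, (1 - b) • (differenceProduct N (Function.update 1 i b) *
        (MvPowerSeries.rescale (Function.update (1 : ℕ → K) i a) (Sym.inAlphabet (Set.Iio N) f) -
          Sym.inAlphabet (Set.Iio N) f)) := by
  classical
  let R := MvPowerSeries ℕ K
  let F := FractionRing R
  let ι : R →ₐ[K] F := IsScalarTower.toAlgHom K R F
  have hι : Function.Injective ι := IsFractionRing.injective R F
  have hιC : ∀ c : K, ι (MvPowerSeries.C c) = algebraMap K F c := fun c => by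
    rw [MvPowerSeries.c_eq_algebraMap, AlgHom.commutes]
  let x : ℕ → F := fun i => ι (MvPowerSeries.X i)
  have hx : ∀ i, x i ≠ 0 := fun i h => by
    have h1 : (MvPowerSeries.X i : R) = 0 := hι (h.trans (map_zero ι).symm)
    have h2 := congrArg (MvPowerSeries.coeff (Finsupp.single i 1)) h1
    rw [MvPowerSeries.coeff_index_single_self_X, map_zero] at h2
    exact one_ne_zero h2
  have hinj : Function.Injective x := fun i j h => MvPowerSeries.X_inj.1 (hι h)
  let ρ := Sym.inAlphabet (Set.Iio N)
  have hχ : ∀ r : ℕ+, (ι.comp ρ) (MvPolynomial.X r) = ∑ i ∈ Finset.range N, x i ^ (r : ℕ) := by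
    intro r
    have h1 : ρ (MvPolynomial.X r) = powerSumSeries (Set.Iio N) r := by simp [ρ, Sym.inAlphabet]
    rw [AlgHom.comp_apply, h1, powerSumSeries_Iio, map_sum]
    simp [x]
  have hmain := map_operator (s := Finset.range N) (fun i _ => hx i) hinj.injOn a b hχ f
  have heval : ∀ i ∈ Finset.range N,
      Polynomial.eval₂ (ι.comp ρ).toRingHom (x i) (Sym.shift a f) =
        ι (MvPowerSeries.rescale (Function.update (1 : ℕ → K) i a) (ρ f)) := by
    intro i hi
    rw [← eval₂_shift a (Finset.mem_range.1 hi) f]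
    exact (Polynomial.hom_eval₂ (Sym.shift a f) ρ.toRingHom ι.toRingHom _).symm
  have hres : ∀ i ∈ Finset.range N, ι (differenceProduct N 1) *
      residue (Finset.range N) x (algebraMap K F b) i =
        algebraMap K F (1 - b) * ι (differenceProduct N (Function.update 1 i b)) := by
    intro i hi
    simp only [differenceProduct, map_prod, map_sub, map_mul, hιC, residue, Pi.one_apply, map_one,
      one_mul]
    rw [← Finset.mul_prod_erase _ _ hi, ← Finset.mul_prod_erase (Finset.range N) _ hi]
    simp only [Function.update_self]
    have hupdate : ∏ k ∈ (Finset.range N).erase i, ∏ j ∈ (Finset.range N).erase k,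
        (x k - algebraMap K F ((Function.update (1 : ℕ → K) i b) k) * x j) =
          ∏ k ∈ (Finset.range N).erase i, ∏ j ∈ (Finset.range N).erase k, (x k - x j) :=
      Finset.prod_congr rfl fun k hk => Finset.prod_congr rfl fun j _ => by
        rw [Function.update_of_ne (Finset.ne_of_mem_erase hk), Pi.one_apply, map_one, one_mul]
    have hne : ∏ j ∈ (Finset.range N).erase i, (x i - x j) ≠ 0 :=
      Finset.prod_ne_zero_iff.2 fun j hj =>
        sub_ne_zero.2 fun h => Finset.ne_of_mem_erase hj (hinj h).symm
    rw [Finset.prod_div_distrib]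
    change (∏ j ∈ (Finset.range N).erase i, (x i - x j)) * (∏ k ∈ (Finset.range N).erase i,
      ∏ j ∈ (Finset.range N).erase k, (x k - x j)) * _ = _ * ((∏ j ∈ _,
      (x i - algebraMap K F b * x j)) * ∏ k ∈ (Finset.range N).erase i,
        ∏ j ∈ (Finset.range N).erase k,
          (x k - algebraMap K F ((Function.update (1 : ℕ → K) i b) k) * x j))
    rw [hupdate]
    linear_combination ((1 - algebraMap K F b) * ∏ k ∈ (Finset.range N).erase i,
      ∏ j ∈ (Finset.range N).erase k, (x k - x j)) * div_mul_cancel₀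
        (∏ j ∈ (Finset.range N).erase i, (x i - algebraMap K F b * x j)) hne
  apply hι
  rw [map_mul, map_sub, map_sum]
  change ι _ * ((ι.comp ρ) _ - (ι.comp ρ) _) = _
  rw [hmain, add_sub_cancel_left, Finset.mul_sum]
  refine Finset.sum_congr rfl fun i hi => ?_
  rw [heval i hi, ← mul_assoc, hres i hi, map_smul, map_mul, Algebra.smul_def, map_sub ι, mul_assoc]
  rfl

/-- The operator preserves bounds on prefix sums of exponents. -/
theorem operator_triangular (a b : K) {f : Sym} {e₀ : ℕ →₀ ℕ}
    (hf : ExponentsLe prefixSum (Sym.toSeries f) e₀) :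
    ExponentsLe prefixSum (Sym.toSeries (Sym.operator a b f)) e₀ ∧
      MvPowerSeries.coeff e₀ (Sym.toSeries (Sym.operator a b f)) =
        (1 + (1 - b) * e₀.sum fun i n => b ^ i * (a ^ n - 1)) *
          MvPowerSeries.coeff e₀ (Sym.toSeries f) := by
  classical
  have hρf : ∀ N : ℕ, ExponentsLe prefixSum (Sym.inAlphabet (Set.Iio N) f) e₀ := by
    intro N e he
    rw [coeff_inAlphabet_of_support_subset (support_subset_of_coeff_inAlphabet_ne_zero he)] at he
    exact hf e he
  have hdiff : ∀ (N i : ℕ) (e : ℕ →₀ ℕ), MvPowerSeries.coeff e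
      (MvPowerSeries.rescale (Function.update (1 : ℕ → K) i a) (Sym.inAlphabet (Set.Iio N) f) -
        Sym.inAlphabet (Set.Iio N) f) =
      (a ^ e i - 1) * MvPowerSeries.coeff e (Sym.inAlphabet (Set.Iio N) f) := by
    intro N i e
    rw [map_sub, MvPowerSeries.coeff_rescale, sub_mul, one_mul]
    congr 2
    rw [Finsupp.prod, Finset.prod_eq_single i]
    · simp
    · intro j _ hj
      simp [Function.update_of_ne hj]
    · intro hi
      simp [Finsupp.notMem_support_iff.1 hi]
  have hdiffLe : ∀ N i : ℕ, ExponentsLe prefixSum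
      (MvPowerSeries.rescale (Function.update (1 : ℕ → K) i a) (Sym.inAlphabet (Set.Iio N) f) -
        Sym.inAlphabet (Set.Iio N) f) e₀ := by
    intro N i e he
    rw [hdiff] at he
    exact hρf N e (right_ne_zero_of_mul he)
  have hh : ∀ N : ℕ, ExponentsLe prefixSum (Sym.inAlphabet (Set.Iio N) (Sym.operator a b f) -
      Sym.inAlphabet (Set.Iio N) f) e₀ := by
    intro N e he j
    refine prefixSum_le_of_differenceProduct_mul (N := N) (fun e' he' => ?_) e he
    rw [differenceProduct_mul_operator] at he'
    rw [← map_add]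
    exact exponentsLe_sum (fun i _ => ((exponentsLe_differenceProduct N
      (Function.update 1 i b)).mul (hdiffLe N i)).smul (1 - b)) e' he' j
  have hmem : ∀ e : ℕ →₀ ℕ, ∃ N, ∀ v ∈ e.support, v ∈ Set.Iio N := by
    intro e
    obtain ⟨N, hN⟩ := e.support.bddAbove
    exact ⟨N + 1, fun v hv => Nat.lt_succ_of_le (hN hv)⟩
  constructor
  · intro e he
    obtain ⟨N, hN⟩ := hmem e
    rw [Sym.toSeries_eq_inAlphabet, ← coeff_inAlphabet_of_support_subset hN] at he
    refine ((hh N).add (hρf N)) e ?_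
    rwa [sub_add_cancel]
  · obtain ⟨N, hN⟩ := hmem e₀
    have h1 := congrArg (MvPowerSeries.coeff (differenceExponent N + e₀))
      (differenceProduct_mul_operator a b N f)
    rw [(exponentsLe_differenceProduct N 1).coeff_mul eq_of_prefixSum_eq (hh N), map_sum] at h1
    rw [Finset.sum_congr rfl fun i hi => by
      rw [MvPowerSeries.coeff_smul, (exponentsLe_differenceProduct N
        (Function.update 1 i b)).coeff_mul eq_of_prefixSum_eq (hdiffLe N i), hdiff,
        coeff_differenceProduct_update (Finset.mem_range.1 hi)]] at h1
    have h2 : MvPowerSeries.coeff e₀ (Sym.inAlphabet (Set.Iio N) (Sym.operator a b f) -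
        Sym.inAlphabet (Set.Iio N) f) = (1 - b) * (∑ i ∈ Finset.range N, b ^ i * (a ^ e₀ i - 1)) *
          MvPowerSeries.coeff e₀ (Sym.inAlphabet (Set.Iio N) f) := by
      apply mul_left_cancel₀ (coeff_differenceProduct_one_ne_zero N)
      rw [h1, Finset.mul_sum, Finset.sum_mul, Finset.mul_sum]
      exact Finset.sum_congr rfl fun i _ => by ring
    have h3 : (e₀.sum fun i n => b ^ i * (a ^ n - 1)) =
        ∑ i ∈ Finset.range N, b ^ i * (a ^ e₀ i - 1) := by
      rw [Finsupp.sum]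
      refine Finset.sum_subset (fun v hv => Finset.mem_range.2 (hN v hv)) fun i _ hi => ?_
      simp [Finsupp.notMem_support_iff.1 hi]
    rw [map_sub, coeff_inAlphabet_of_support_subset hN, coeff_inAlphabet_of_support_subset hN] at h2
    rw [Sym.toSeries_eq_inAlphabet, h3]
    linear_combination h2

/-! ### Forms that are diagonal on monomials -/

section Diagonal

variable {J : Type} {B : MvPolynomial J K →ₗ[K] MvPolynomial J K →ₗ[K] K} {ζ : (J →₀ ℕ) → K}
  {w : J → K}

/-- If monomials are orthogonal with norms growing as indicated, then multiplication by a variable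
is adjoint to a multiple of the partial derivative. -/
theorem X_mul_adjoint_of_diagonal [DecidableEq (J →₀ ℕ)]
    (hB : ∀ α β, B (MvPolynomial.monomial α 1) (MvPolynomial.monomial β 1) =
      if α = β then ζ α else 0)
    (hζ : ∀ α j, ζ (α + Finsupp.single j 1) = ((α j : K) + 1) * w j * ζ α) (j : J)
    (f h : MvPolynomial J K) :
    B (MvPolynomial.X j * f) h = w j * B f (MvPolynomial.pderiv j h) := by
  have key : B ∘ₗ LinearMap.mulLeft K (MvPolynomial.X j) =
      w j • B.compl₂ (MvPolynomial.pderiv j).toLinearMap := by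
    refine (MvPolynomial.basisMonomials J K).ext fun α =>
      (MvPolynomial.basisMonomials J K).ext fun β => ?_
    simp only [MvPolynomial.coe_basisMonomials, LinearMap.comp_apply, LinearMap.mulLeft_apply,
      LinearMap.smul_apply, LinearMap.compl₂_apply, Derivation.coeFn_coe, smul_eq_mul]
    have h1 : (MvPolynomial.X j * MvPolynomial.monomial α 1 : MvPolynomial J K) =
        MvPolynomial.monomial (α + Finsupp.single j 1) 1 := by
      rw [MvPolynomial.X, MvPolynomial.monomial_mul, one_mul, add_comm]
    have h2 : MvPolynomial.pderiv j (MvPolynomial.monomial β (1 : K)) =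
        (β j : K) • MvPolynomial.monomial (β - Finsupp.single j 1) 1 := by
      rw [MvPolynomial.pderiv_monomial, MvPolynomial.smul_monomial, one_mul, smul_eq_mul, mul_one]
    rw [h1, h2, map_smul, hB, hB, smul_eq_mul]
    by_cases hβ : β j = 0
    · rw [if_neg, hβ]
      · simp
      · rintro rfl
        simp at hβ
    · have hadd : β - Finsupp.single j 1 + Finsupp.single j 1 = β :=
        tsub_add_cancel_of_le (by simpa using Nat.one_le_iff_ne_zero.2 hβ)
      by_cases hα : α + Finsupp.single j 1 = β
      · subst hα
        rw [if_pos rfl, if_pos (by simp), hζ]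
        simp
        ring
      · rw [if_neg hα, if_neg]
        · simp
        · rintro rfl
          exact hα hadd
  exact LinearMap.congr_fun (LinearMap.congr_fun key f) h

theorem X_mul_adjoint_of_diagonal' [DecidableEq (J →₀ ℕ)]
    (hB : ∀ α β, B (MvPolynomial.monomial α 1) (MvPolynomial.monomial β 1) =
      if α = β then ζ α else 0)
    (hζ : ∀ α j, ζ (α + Finsupp.single j 1) = ((α j : K) + 1) * w j * ζ α) (j : J)
    (f h : MvPolynomial J K) :
    B f (MvPolynomial.X j * h) = w j * B (MvPolynomial.pderiv j f) h := by
  refine X_mul_adjoint_of_diagonal (B := B.flip) (fun α β => ?_) hζ j h f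
  rw [LinearMap.flip_apply, hB]
  by_cases h : α = β
  · rw [h]
  · rw [if_neg h, if_neg (Ne.symm h)]

theorem eq_zero_of_diagonal [DecidableEq (J →₀ ℕ)]
    (hB : ∀ α β, B (MvPolynomial.monomial α 1) (MvPolynomial.monomial β 1) =
      if α = β then ζ α else 0)
    (hζ : ∀ α, ζ α ≠ 0) (x : MvPolynomial J K) (hx : ∀ y, B x y = 0) : x = 0 := by
  classical
  ext β
  have h1 : B.flip (MvPolynomial.monomial β 1) = ζ β • MvPolynomial.lcoeff K β := by
    refine (MvPolynomial.basisMonomials J K).ext fun α => ?_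
    rw [MvPolynomial.coe_basisMonomials, LinearMap.flip_apply, hB]
    rw [LinearMap.smul_apply, MvPolynomial.lcoeff_apply, smul_eq_mul]
    by_cases h : α = β
    · rw [if_pos h, h, MvPolynomial.coeff_monomial, if_pos rfl, mul_one]
    · rw [if_neg h, MvPolynomial.coeff_monomial, if_neg h, mul_zero]
  have h2 := LinearMap.congr_fun h1 x
  rw [LinearMap.flip_apply, hx, LinearMap.smul_apply, MvPolynomial.lcoeff_apply, smul_eq_mul] at h2
  simpa [hζ β] using h2.symm

end Diagonal

theorem Par.z_cons (r : ℕ+) (la : Par) :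
    Par.z (r ::ₘ la) = ((la.count r + 1) * r) * Par.z la := by
  classical
  have h : ∀ mu : Par, mu ≤ r ::ₘ la → mu.z =
      ∏ i ∈ (r ::ₘ la).toFinset, (i : ℕ) ^ mu.count i * (mu.count i).factorial := by
    intro mu hmu
    refine Finset.prod_subset (Multiset.toFinset_subset.2 (Multiset.subset_of_le hmu))
      fun i _ hi => ?_
    rw [Multiset.count_eq_zero_of_notMem (by simpa using hi)]
    simp
  have hr : r ∈ (r ::ₘ la).toFinset := by simp
  rw [h _ le_rfl, h la (Multiset.le_cons_self _ _), ← Finset.mul_prod_erase _ _ hr,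
    ← Finset.mul_prod_erase (r ::ₘ la).toFinset _ hr, ← mul_assoc]
  congr 1
  · rw [Multiset.count_cons_self, pow_succ, Nat.factorial_succ]
    ring
  · refine Finset.prod_congr rfl fun i hi => ?_
    rw [Multiset.count_cons_of_ne (Finset.ne_of_mem_erase hi)]

theorem Par.ratio_cons (a b : K) (r : ℕ+) (la : Par) :
    Par.ratio a b (r ::ₘ la) = (1 - a ^ (r : ℕ)) / (1 - b ^ (r : ℕ)) * Par.ratio a b la := by
  simp [Par.ratio]

theorem Par.z_ne_zero (la : Par) : (la.z : K) ≠ 0 := by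
  rw [Nat.cast_ne_zero, Par.z, Finset.prod_ne_zero_iff]
  intro i _
  exact mul_ne_zero (pow_ne_zero _ (PNat.ne_zero i)) (Nat.factorial_ne_zero _)

theorem Par.ratio_ne_zero {a b : K} (ha : ∀ r : ℕ+, a ^ (r : ℕ) ≠ 1)
    (hb : ∀ r : ℕ+, b ^ (r : ℕ) ≠ 1) (la : Par) : la.ratio a b ≠ 0 := by
  rw [Par.ratio]
  refine Multiset.prod_ne_zero fun h => ?_
  obtain ⟨r, -, hr⟩ := Multiset.mem_map.1 h
  rcases div_eq_zero_iff.1 hr with h | h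
  · exact ha r (sub_eq_zero.1 h).symm
  · exact hb r (sub_eq_zero.1 h).symm

theorem toFinsupp_symm_add_single (α : ℕ+ →₀ ℕ) (r : ℕ+) :
    (Multiset.toFinsupp.symm (α + Finsupp.single r 1) : Par) =
      r ::ₘ (Multiset.toFinsupp.symm α : Par) := by
  rw [map_add, add_comm, ← Multiset.toFinsupp_singleton, AddEquiv.symm_apply_apply,
    Multiset.singleton_add]

theorem count_toFinsupp_symm (α : ℕ+ →₀ ℕ) (r : ℕ+) :
    (Multiset.toFinsupp.symm α : Par).count r = α r := by
  rw [← Multiset.toFinsupp_apply, AddEquiv.apply_symm_apply]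

/-- The norm of a monomial in the power sums. -/
noncomputable def Sym.monomialNorm (a b : K) (α : ℕ+ →₀ ℕ) : K :=
  (Par.z (Multiset.toFinsupp.symm α) : K) * Par.ratio a b (Multiset.toFinsupp.symm α)

theorem Sym.scalar_monomial (a b : K) (α β : ℕ+ →₀ ℕ) :
    Sym.scalar a b (MvPolynomial.monomial α 1) (MvPolynomial.monomial β 1) =
      if α = β then Sym.monomialNorm a b α else 0 := by
  have h : ∀ γ : ℕ+ →₀ ℕ, (MvPolynomial.monomial γ 1 : Sym) =
      Sym.p (Multiset.toFinsupp.symm γ) := fun γ => by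
    rw [Sym.p_eq_monomial, AddEquiv.apply_symm_apply]
  rw [h, h, Sym.scalar_p]
  simp only [EmbeddingLike.apply_eq_iff_eq, Sym.monomialNorm]

theorem Sym.monomialNorm_add_single (a b : K) (α : ℕ+ →₀ ℕ) (r : ℕ+) :
    Sym.monomialNorm a b (α + Finsupp.single r 1) =
      ((α r : K) + 1) * ((r : ℕ) * ((1 - a ^ (r : ℕ)) / (1 - b ^ (r : ℕ)))) *
        Sym.monomialNorm a b α := by
  rw [Sym.monomialNorm, toFinsupp_symm_add_single, Par.z_cons, Par.ratio_cons,
    count_toFinsupp_symm, Sym.monomialNorm]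
  push_cast
  ring

/-! ### Dominance -/

theorem Par.dominated_iff {mu la : Par} : mu.Dominated la ↔
    ∀ j, prefixSum j (canonicalExponent mu) ≤ prefixSum j (canonicalExponent la) := by
  simp only [Par.Dominated, prefixSum_apply, sum_range_canonicalExponent]

theorem Par.Dominated.antisymm {mu la : Par} (h : mu.Dominated la) (h' : la.Dominated mu) :
    mu = la :=
  Par.eq_of_partialSum_eq fun j => le_antisymm (h j) (h' j)

theorem Par.Dominated.trans {nu mu la : Par} (h : nu.Dominated mu) (h' : mu.Dominated la) :
    nu.Dominated la := fun j => (h j).trans (h' j)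

theorem Par.Dominated.size_le {mu la : Par} (h : mu.Dominated la) : mu.size ≤ la.size := by
  rw [← Par.partialSum_eq_size (le_refl (Multiset.card mu))]
  exact (h _).trans (la.partialSum_le_size _)

/-- The number of partitions dominated by a given one. -/
noncomputable def Par.rank (la : Par) : ℕ := {mu : Par | mu.Dominated la}.ncard

theorem Par.rank_lt (la mu : Par) (h : mu.Dominated la ∧ mu ≠ la) : mu.rank < la.rank := by
  refine Set.ncard_lt_ncard ⟨fun nu hnu => hnu.trans h.1, fun hsub => ?_⟩
    ((finite_setOf_size_le la.size).subset fun nu hnu => Par.Dominated.size_le hnu)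
  have : la.Dominated la := fun _ => le_rfl
  exact h.2 (h.1.antisymm (hsub this))

theorem Par.strictDominated_trans (nu mu la : Par) (h : nu.Dominated mu ∧ nu ≠ mu)
    (h' : mu.Dominated la ∧ mu ≠ la) : nu.Dominated la ∧ nu ≠ la :=
  ⟨h.1.trans h'.1, by rintro rfl; exact h.2 (h.1.antisymm h'.1)⟩

theorem exponentsLe_monomialSeries (la : Par) :
    ExponentsLe prefixSum (monomialSeries Set.univ la) (canonicalExponent la) := by
  classical
  intro e he j
  rw [coeff_monomialSeries] at he
  have hla : exponentType e = la := by by_contra h; simp [h] at he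
  simp only [prefixSum_apply, sum_range_canonicalExponent]
  rw [← hla]
  simpa using sum_le_partialSum_exponentType e (Finset.range j)

theorem Sym.mem_span_m_of_exponentsLe {f : Sym} {la : Par}
    (hf : ExponentsLe prefixSum (Sym.toSeries f) (canonicalExponent la)) :
    f - MvPowerSeries.coeff (canonicalExponent la) (Sym.toSeries f) • Sym.m la ∈
      Submodule.span K (Sym.m '' {mu : Par | mu.Dominated la ∧ mu ≠ la}) := by
  have hm : (Sym.mBasis : Par → Sym) = Sym.m := funext Sym.mBasis_apply
  rw [← hm, Sym.mBasis.mem_span_image]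
  intro mu hmu
  rw [Finset.mem_coe, Finsupp.mem_support_iff, map_sub, map_smul, Module.Basis.repr_self,
    Finsupp.sub_apply, Finsupp.smul_apply, Sym.mBasis_repr] at hmu
  have hne : mu ≠ la := by
    rintro rfl
    simp at hmu
  rw [Finsupp.single_apply, if_neg hne.symm, smul_zero, sub_zero] at hmu
  exact ⟨Par.dominated_iff.2 (hf _ hmu), hne⟩

/-! ### Existence and uniqueness of the Macdonald polynomials -/

/-- The eigenvalue `1 + (1 - b⁻¹) ∑_i b^{-i} (a^{λ_{i+1}} - 1)` of the Macdonald operator. -/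
noncomputable def eigenvalue (a b : K) (la : Par) : K :=
  1 + (1 - b⁻¹) * (canonicalExponent la).sum fun i n => b⁻¹ ^ i * (a ^ n - 1)

/-- The genericity conditions under which the Macdonald polynomials are eigenvectors for distinct
eigenvalues and the scalar product is non-degenerate. -/
structure GenericParameters (a b : K) : Prop where
  left_pow_ne_one : ∀ r : ℕ+, a ^ (r : ℕ) ≠ 1
  right_pow_ne_one : ∀ r : ℕ+, b ^ (r : ℕ) ≠ 1
  right_ne_zero : b ≠ 0
  eigenvalue_injective : Function.Injective (eigenvalue a b)

theorem GenericParameters.weight_relation {a b : K} (h : GenericParameters a b) (c : K) (r : ℕ+) :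
    (1 - b⁻¹ ^ (r : ℕ)) *
        ((r : ℕ) * (c ^ (r : ℕ) * ((1 - a ^ (r : ℕ)) / (1 - b ^ (r : ℕ))))) =
      (c / b) ^ (r : ℕ) * ((r : ℕ) * (a ^ (r : ℕ) - 1)) := by
  have h1 : b ^ (r : ℕ) ≠ 0 := pow_ne_zero _ h.right_ne_zero
  have h2 : 1 - b ^ (r : ℕ) ≠ 0 := sub_ne_zero.2 (h.right_pow_ne_one r).symm
  rw [inv_pow, div_pow]
  field_simp
  ring

theorem exists_isMacdonald_eigenvector {a b : K} (h : GenericParameters a b) :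
    ∃ P : Par → Sym, IsMacdonald a b P ∧ ∀ la,
      P la - Sym.m la ∈ Submodule.span K (Sym.m '' {mu : Par | mu.Dominated la ∧ mu ≠ la}) ∧
      Sym.operator a b⁻¹ (P la) = eigenvalue a b la • P la := by
  classical
  have hE : ∀ la : Par, Sym.operator a b⁻¹ (Sym.m la) - eigenvalue a b la • Sym.m la ∈
      Submodule.span K (Sym.m '' {mu : Par | mu.Dominated la ∧ mu ≠ la}) := by
    intro la
    have h1 : ExponentsLe prefixSum (Sym.toSeries (Sym.m la)) (canonicalExponent la) := by
      rw [Sym.toSeries_m]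
      exact exponentsLe_monomialSeries la
    obtain ⟨h2, h3⟩ := operator_triangular a b⁻¹ h1
    have h4 := Sym.mem_span_m_of_exponentsLe h2
    rwa [h3, Sym.toSeries_m, coeff_canonicalExponent_monomialSeries, if_pos rfl, mul_one] at h4
  choose P hP hPE using exists_eigenvector_of_triangular Par.rank_lt Par.strictDominated_trans
    (fun la mu hlt heq => hlt.2 (h.eigenvalue_injective heq)) hE
  refine ⟨P, ⟨?_, ?_, ?_, ?_⟩, fun la => ⟨hP la, hPE la⟩⟩
  · exact linearIndependent_of_unitriangular Par.rank_lt hP Sym.linearIndependent_m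
  · have h1 := span_image_eq_of_unitriangular (S := Set.univ) Par.rank_lt hP
      (fun _ _ _ _ => Set.mem_univ _)
    rw [Set.image_univ, Set.image_univ] at h1
    rw [h1, Sym.span_m]
  · intro la
    have h1 := Submodule.mem_map_of_mem (f := Sym.toSeries.toLinearMap) (hP la)
    rw [Submodule.map_span, ← Set.image_comp] at h1
    have h2 : Sym.toSeries.toLinearMap ∘ Sym.m = monomialSeries Set.univ := funext Sym.toSeries_m
    rw [h2, AlgHom.toLinearMap_apply, map_sub, Sym.toSeries_m] at h1
    exact h1
  · intro la mu hne
    have hN := fun r => h.weight_relation 1 r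
    simp only [one_pow, one_mul] at hN
    have h1 := Sym.operator_selfAdjoint (B := Sym.scalar a b)
      (X_mul_adjoint_of_diagonal (Sym.scalar_monomial a b) (Sym.monomialNorm_add_single a b))
      (X_mul_adjoint_of_diagonal' (Sym.scalar_monomial a b) (Sym.monomialNorm_add_single a b))
      hN (P la) (P mu)
    rw [hPE, hPE, map_smul, map_smul, LinearMap.smul_apply, smul_eq_mul, smul_eq_mul,
      ← sub_eq_zero, ← sub_mul] at h1
    exact (mul_eq_zero.1 h1).resolve_left
      (sub_ne_zero.2 fun heq => hne (h.eigenvalue_injective heq))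

theorem IsMacdonald.unique {a b : K} (h : GenericParameters a b) {P Q : Par → Sym}
    (hP : IsMacdonald a b P) (hQ : IsMacdonald a b Q) : P = Q := by
  classical
  exact eq_of_orthogonal_of_unitriangular (τ := Sym.toSeries.toLinearMap) Par.rank_lt
    Par.strictDominated_trans Sym.toSeries_injective
    (eq_zero_of_diagonal (Sym.scalar_monomial a b) fun α =>
      mul_ne_zero (Par.z_ne_zero _) (Par.ratio_ne_zero h.left_pow_ne_one h.right_pow_ne_one _))
    hP.span_eq_top hP.triangular hQ.triangular hP.orthogonal hQ.orthogonal

theorem existsUnique_isMacdonald {a b : K} (h : GenericParameters a b) :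
    ∃! P : Par → Sym, IsMacdonald a b P := by
  obtain ⟨P, hP, -⟩ := exists_isMacdonald_eigenvector h
  exact ⟨P, hP, fun Q hQ => hQ.unique h hP⟩

theorem macdonald_spec {a b : K} (h : GenericParameters a b) (la : Par) :
    macdonald a b la - Sym.m la ∈
        Submodule.span K (Sym.m '' {mu : Par | mu.Dominated la ∧ mu ≠ la}) ∧
      Sym.operator a b⁻¹ (macdonald a b la) = eigenvalue a b la • macdonald a b la := by
  obtain ⟨P, hP, hPE⟩ := exists_isMacdonald_eigenvector h
  have hex : ∃ P, IsMacdonald a b P := ⟨P, hP⟩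
  have heq : macdonald a b = P := by
    rw [macdonald, dif_pos hex]
    exact hex.choose_spec.unique h hP
  rw [heq]
  exact hPE la

/-! ### Genericity of the parameters -/

/-- The monomial `q^x t^y`. -/
noncomputable def qt (x y : ℕ) : K := q ^ x * t ^ y

theorem qt_eq_algebraMap (x y : ℕ) : qt x y = algebraMap (MvPolynomial (Fin 2) ℚ) K
    (MvPolynomial.monomial (Finsupp.single 0 x + Finsupp.single 1 y) 1) := by
  rw [qt, q, t, ← map_pow, ← map_pow, ← map_mul, MvPolynomial.X_pow_eq_monomial,
    MvPolynomial.X_pow_eq_monomial, MvPolynomial.monomial_mul, one_mul]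

theorem single_add_single_inj {x y x' y' : ℕ}
    (h : (Finsupp.single 0 x + Finsupp.single 1 y : Fin 2 →₀ ℕ) =
      Finsupp.single 0 x' + Finsupp.single 1 y') : x = x' ∧ y = y' := by
  constructor
  · simpa using DFunLike.congr_fun h 0
  · simpa using DFunLike.congr_fun h 1

theorem qt_inj {x y x' y' : ℕ} (h : qt x y = qt x' y') : x = x' ∧ y = y' := by
  rw [qt_eq_algebraMap, qt_eq_algebraMap] at h
  exact single_add_single_inj (MvPolynomial.monomial_left_injective one_ne_zero
    (IsFractionRing.injective (MvPolynomial (Fin 2) ℚ) K h))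

theorem qt_ne_zero (x y : ℕ) : qt x y ≠ 0 := by
  rw [qt_eq_algebraMap]
  intro h
  have h1 := IsFractionRing.injective (MvPolynomial (Fin 2) ℚ) K (h.trans (map_zero _).symm)
  rw [MvPolynomial.monomial_eq_zero] at h1
  exact one_ne_zero h1

theorem qt_pow (x y r : ℕ) : qt x y ^ r = qt (r * x) (r * y) := by
  rw [qt, qt, mul_pow, ← pow_mul, ← pow_mul, mul_comm x, mul_comm y]

theorem qt_mul (x y x' y' : ℕ) : qt x y * qt x' y' = qt (x + x') (y + y') := by
  rw [qt, qt, qt, pow_add, pow_add]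
  ring

/-- A sum of distinct monomials `q^x t^y` determines the set of its terms. -/
theorem eq_of_sum_qt_eq {N : ℕ} {φ : ℕ → ℕ → ℕ × ℕ}
    (hφ : ∀ i l i' l', i < N → i' < N → φ i l = φ i' l' → i = i' ∧ l = l') {u v : ℕ → ℕ}
    (h : ∑ i ∈ Finset.range N, qt (φ i (u i)).1 (φ i (u i)).2 =
      ∑ i ∈ Finset.range N, qt (φ i (v i)).1 (φ i (v i)).2) :
    ∀ i < N, u i = v i := by
  intro i hi
  let m : ℕ → ℕ → (Fin 2 →₀ ℕ) := fun i l =>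
    Finsupp.single 0 (φ i l).1 + Finsupp.single 1 (φ i l).2
  have hm : ∀ i l i' l', i < N → i' < N → m i l = m i' l' → i = i' ∧ l = l' := by
    intro i l i' l' hi hi' h
    obtain ⟨h1, h2⟩ := single_add_single_inj h
    exact hφ i l i' l' hi hi' (Prod.ext h1 h2)
  simp only [qt_eq_algebraMap, ← map_sum] at h
  have h1 := congrArg (MvPolynomial.coeff (m i (u i)))
    (IsFractionRing.injective (MvPolynomial (Fin 2) ℚ) K h)
  rw [MvPolynomial.coeff_sum, MvPolynomial.coeff_sum] at h1
  simp only [MvPolynomial.coeff_monomial] at h1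
  change (∑ j ∈ Finset.range N, if m j (u j) = m i (u i) then (1 : ℚ) else 0) =
    ∑ j ∈ Finset.range N, if m j (v j) = m i (u i) then (1 : ℚ) else 0 at h1
  rw [Finset.sum_eq_single i (fun j hj hji => if_neg fun h =>
    hji (hm _ _ _ _ (Finset.mem_range.1 hj) hi h).1)
    (fun h => absurd (Finset.mem_range.2 hi) h), if_pos rfl] at h1
  by_contra hne
  rw [Finset.sum_eq_zero fun j hj => if_neg fun h => by
    obtain ⟨rfl, h3⟩ := hm _ _ _ _ (Finset.mem_range.1 hj) hi h
    exact hne h3.symm] at h1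
  exact one_ne_zero h1

theorem genericParameters_qt {x₁ y₁ x₂ y₂ : ℕ} (hdet : x₁ * y₂ ≠ x₂ * y₁) :
    GenericParameters (qt x₁ y₁) (qt x₂ y₂) := by
  have hone : ∀ x y : ℕ, (x ≠ 0 ∨ y ≠ 0) → ∀ r : ℕ+, qt x y ^ (r : ℕ) ≠ 1 := by
    intro x y hxy r h
    have h1 : qt (r * x) (r * y) = qt 0 0 := by
      rw [← qt_pow, h]; simp [qt]
    obtain ⟨h2, h3⟩ := qt_inj h1
    simp only [mul_eq_zero, PNat.ne_zero, false_or] at h2 h3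
    rcases hxy with h | h <;> contradiction
  have hb1 := hone x₂ y₂ (by
    by_contra! h
    rw [h.1, h.2] at hdet
    simp at hdet)
  refine ⟨hone x₁ y₁ ?_, hb1, qt_ne_zero _ _, ?_⟩
  · by_contra! h
    rw [h.1, h.2] at hdet
    simp at hdet
  · intro la mu h
    set a := qt x₁ y₁ with ha
    set b := qt x₂ y₂ with hb
    have hb0 : b ≠ 0 := qt_ne_zero _ _
    obtain ⟨N, hN⟩ : ∃ N, (canonicalExponent la).support ⊆ Finset.range N ∧
        (canonicalExponent mu).support ⊆ Finset.range N := by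
      obtain ⟨N, hN⟩ := ((canonicalExponent la).support ∪ (canonicalExponent mu).support).bddAbove
      refine ⟨N + 1, fun i hi => ?_, fun i hi => ?_⟩
      · exact Finset.mem_range.2 (Nat.lt_succ_of_le (hN (Finset.mem_union_left _ hi)))
      · exact Finset.mem_range.2 (Nat.lt_succ_of_le (hN (Finset.mem_union_right _ hi)))
    have hsum : ∀ nu : Par, (canonicalExponent nu).support ⊆ Finset.range N →
        b ^ N * (canonicalExponent nu).sum (fun i n => b⁻¹ ^ i * (a ^ n - 1)) =
          ∑ i ∈ Finset.range N, qt ((N - i) * x₂ + canonicalExponent nu i * x₁)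
            ((N - i) * y₂ + canonicalExponent nu i * y₁) - ∑ i ∈ Finset.range N, b ^ (N - i) := by
      intro nu hnu
      rw [Finsupp.sum, Finset.sum_subset hnu fun i _ hi => by
        simp [Finsupp.notMem_support_iff.1 hi], Finset.mul_sum, ← Finset.sum_sub_distrib]
      refine Finset.sum_congr rfl fun i hi => ?_
      rw [← qt_mul, ← qt_pow, ← qt_pow, ← ha, ← hb, ← mul_assoc, inv_pow,
        ← pow_sub₀ _ hb0 (Finset.mem_range.1 hi).le]
      ring
    have h1 : (canonicalExponent la).sum (fun i n => b⁻¹ ^ i * (a ^ n - 1)) =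
        (canonicalExponent mu).sum (fun i n => b⁻¹ ^ i * (a ^ n - 1)) := by
      have hb2 : 1 - b⁻¹ ≠ 0 := by
        rw [sub_ne_zero, ne_comm, inv_ne_one]
        simpa using hb1 1
      exact mul_left_cancel₀ hb2 (add_left_cancel h)
    have h2 := congrArg (b ^ N * ·) h1
    simp only [hsum la hN.1, hsum mu hN.2, sub_left_inj] at h2
    have h3 := eq_of_sum_qt_eq (N := N)
      (φ := fun i l => ((N - i) * x₂ + l * x₁, (N - i) * y₂ + l * y₁)) (by
        intro i l i' l' hi hi' h
        rw [Prod.mk.injEq] at h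
        obtain ⟨h4, h5⟩ := h
        -- Cramer's rule for a system with determinant `x₁ y₂ - x₂ y₁ ≠ 0`.
        zify at h4 h5 hdet
        have hd : ((x₁ : ℤ) * y₂ - x₂ * y₁) ≠ 0 := sub_ne_zero.2 hdet
        have h6 : (l : ℤ) = l' := by
          apply mul_left_cancel₀ hd
          linear_combination y₂ * h4 - x₂ * h5
        have h7 : ((N - i : ℕ) : ℤ) = (N - i' : ℕ) := by
          apply mul_left_cancel₀ hd
          linear_combination x₁ * h5 - y₁ * h4
        constructor <;> omega) h2
    have h4 : canonicalExponent la = canonicalExponent mu := by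
      ext i
      by_cases hi : i < N
      · exact h3 i hi
      · have h5 : ∀ nu : Par, (canonicalExponent nu).support ⊆ Finset.range N →
            canonicalExponent nu i = 0 := fun nu hnu => by
          by_contra hne
          exact hi (Finset.mem_range.1 (hnu (Finsupp.mem_support_iff.2 hne)))
        rw [h5 la hN.1, h5 mu hN.2]
    rw [← exponentType_canonicalExponent la, h4, exponentType_canonicalExponent]

theorem genericParameters_param {n k : ℕ} (hk : k < n) :
    GenericParameters (firstParam n k) (secondParam n k) := by
  have h2 : secondParam n k = qt (n - 1 - k) 1 := by simp [secondParam, qt]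
  rw [h2]
  rcases Nat.eq_zero_or_pos k with rfl | hpos
  · have h1 : firstParam n 0 = qt 1 0 := by simp [firstParam, qt]
    rw [h1]
    exact genericParameters_qt (by simp)
  · have h1 : firstParam n k = qt (n - k) 1 := by simp [firstParam, qt, hpos.ne']
    rw [h1]
    exact genericParameters_qt (by omega)

/-! ### Several alphabets -/

/-- The variables `x^{(k+1)}_1, x^{(k+1)}_2, …` inside all variables. -/
def alphabetEmbedding {n : ℕ} (k : Fin n) : ℕ ↪ Fin n × ℕ := ⟨fun v => (k, v), fun _ _ h => by
  simpa using h⟩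

theorem alphabetEmbedding_apply {n : ℕ} (k : Fin n) (v : ℕ) : alphabetEmbedding k v = (k, v) := rfl

theorem image_alphabetEmbedding {n : ℕ} (k : Fin n) :
    alphabetEmbedding k '' Set.univ = alphabet k := by
  ext ⟨i, v⟩
  simp [alphabetEmbedding_apply, alphabet, eq_comm]

/-- The symmetric function `f(x^{(k+1)})`. -/
noncomputable def colorHom {n : ℕ} (k : Fin n) : Sym →ₐ[K] MultiSym n :=
  MvPolynomial.rename fun r => (k, r)

theorem colorHom_X {n : ℕ} (k : Fin n) (r : ℕ+) :
    colorHom k (MvPolynomial.X r) = MvPolynomial.X (k, r) := by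
  simp [colorHom]

theorem toSeries_X {n : ℕ} (v : Fin n × ℕ+) :
    MultiSym.toSeries n (MvPolynomial.X v) = powerSumSeries (alphabet v.1) v.2 := by
  simp [MultiSym.toSeries]

theorem toSeries_colorHom {n : ℕ} (k : Fin n) (f : Sym) :
    MultiSym.toSeries n (colorHom k f) =
      MvPowerSeries.rename (alphabetEmbedding k) (Sym.toSeries f) := by
  rw [Sym.toSeries_eq_inAlphabet, rename_inAlphabet, image_alphabetEmbedding, ← AlgHom.comp_apply]
  congr 1
  ext1 r
  simp [colorHom_X, toSeries_X, Sym.inAlphabet]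

theorem multiMonomialSeries_eq_prod_rename {n : ℕ} (la : MultiPar n) :
    multiMonomialSeries la = ∏ k : Fin n,
      MvPowerSeries.rename (alphabetEmbedding k) (monomialSeries Set.univ (la k)) := by
  refine Finset.prod_congr rfl fun k _ => ?_
  rw [rename_monomialSeries, image_alphabetEmbedding]

/-- The exponent with components `ε_1, …, ε_n` in the `n` alphabets. -/
noncomputable def joinExponents {n : ℕ} (ε : Fin n → ℕ →₀ ℕ) : Fin n × ℕ →₀ ℕ :=
  ∑ k, (ε k).embDomain (alphabetEmbedding k)

theorem embDomain_alphabetEmbedding_apply {n : ℕ} (k i : Fin n) (e : ℕ →₀ ℕ) (v : ℕ) :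
    e.embDomain (alphabetEmbedding k) (i, v) = if k = i then e v else 0 := by
  split_ifs with h
  · subst h
    exact Finsupp.embDomain_apply_self (alphabetEmbedding k) e v
  · rw [Finsupp.embDomain_of_notMem_range]
    rintro ⟨u, hu⟩
    exact h (by simpa [alphabetEmbedding_apply] using congrArg Prod.fst hu)

theorem joinExponents_apply {n : ℕ} (ε : Fin n → ℕ →₀ ℕ) (k : Fin n) (v : ℕ) :
    joinExponents ε (k, v) = ε k v := by
  simp [joinExponents, Finsupp.finsetSum_apply, embDomain_alphabetEmbedding_apply]

theorem joinExponents_injective {n : ℕ} :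
    Function.Injective (joinExponents : (Fin n → ℕ →₀ ℕ) → Fin n × ℕ →₀ ℕ) := by
  intro ε ε' h
  funext k
  ext v
  rw [← joinExponents_apply, h, joinExponents_apply]

theorem exists_embDomain_of_coeff_rename_ne_zero {σ τ : Type} {φ : σ ↪ τ} {G : MvPowerSeries σ K}
    {e : τ →₀ ℕ} (h : MvPowerSeries.coeff e (MvPowerSeries.rename φ G) ≠ 0) :
    ∃ x : σ →₀ ℕ, x.embDomain φ = e ∧ MvPowerSeries.coeff x G ≠ 0 := by
  have h2 : e ∈ Set.range (Finsupp.mapDomain φ) := by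
    by_contra hc
    exact h (MvPowerSeries.coeff_rename_eq_zero _ _ hc)
  obtain ⟨x, rfl⟩ := h2
  rw [← Finsupp.embDomain_eq_mapDomain] at h ⊢
  exact ⟨x, rfl, by rwa [MvPowerSeries.coeff_embDomain_rename] at h⟩

/-- The coefficients of a product of power series in different alphabets. -/
theorem coeff_joinExponents_prod_rename {n : ℕ} (ε : Fin n → ℕ →₀ ℕ)
    (G : Fin n → MvPowerSeries ℕ K) :
    MvPowerSeries.coeff (joinExponents ε)
      (∏ k : Fin n, MvPowerSeries.rename (alphabetEmbedding k) (G k)) =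
        ∏ k : Fin n, MvPowerSeries.coeff (ε k) (G k) := by
  classical
  have key : ∀ s : Finset (Fin n),
      (∀ e, MvPowerSeries.coeff e
        (∏ k ∈ s, MvPowerSeries.rename (alphabetEmbedding k) (G k)) ≠ 0 →
          ∀ v, v.1 ∉ s → e v = 0) ∧
      MvPowerSeries.coeff (∑ k ∈ s, (ε k).embDomain (alphabetEmbedding k))
        (∏ k ∈ s, MvPowerSeries.rename (alphabetEmbedding k) (G k)) =
          ∏ k ∈ s, MvPowerSeries.coeff (ε k) (G k) := by
    intro s
    induction s using Finset.induction_on with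
    | empty =>
      refine ⟨fun e he v _ => ?_, by simp⟩
      rw [Finset.prod_empty, MvPowerSeries.coeff_one] at he
      have : e = 0 := by by_contra h; simp [h] at he
      simp [this]
    | insert i s hi ih =>
      rw [Finset.prod_insert hi, Finset.prod_insert hi, Finset.sum_insert hi]
      constructor
      · intro e he v hv
        rw [Finset.mem_insert, not_or] at hv
        rw [MvPowerSeries.coeff_mul] at he
        obtain ⟨⟨x, y⟩, hxy, hne⟩ := Finset.exists_ne_zero_of_sum_ne_zero he
        rw [Finset.HasAntidiagonal.mem_antidiagonal] at hxy
        simp only at hxy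
        subst hxy
        obtain ⟨x', rfl, -⟩ := exists_embDomain_of_coeff_rename_ne_zero (left_ne_zero_of_mul hne)
        rw [Finsupp.add_apply, ih.1 y (right_ne_zero_of_mul hne) v hv.2, add_zero,
          embDomain_alphabetEmbedding_apply i v.1 x' v.2, if_neg (Ne.symm hv.1)]
      · rw [MvPowerSeries.coeff_mul, Finset.sum_eq_single
          ((ε i).embDomain (alphabetEmbedding i),
            ∑ k ∈ s, (ε k).embDomain (alphabetEmbedding k)), ih.2,
          MvPowerSeries.coeff_embDomain_rename]
        · rintro ⟨x, y⟩ hxy hne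
          rw [Finset.HasAntidiagonal.mem_antidiagonal] at hxy
          by_contra h0
          apply hne
          obtain ⟨x', rfl, -⟩ := exists_embDomain_of_coeff_rename_ne_zero (left_ne_zero_of_mul h0)
          have hy := ih.1 y (right_ne_zero_of_mul h0)
          simp only at hxy
          have hx' : x' = ε i := by
            ext v
            have h1 := DFunLike.congr_fun hxy (i, v)
            have h2 : (∑ k ∈ s, (ε k).embDomain (alphabetEmbedding k)) (i, v) = 0 := by
              rw [Finsupp.finsetSum_apply]
              refine Finset.sum_eq_zero fun k hk => ?_
              rw [embDomain_alphabetEmbedding_apply, if_neg]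
              rintro rfl
              exact hi hk
            have h3 : ∀ e : ℕ →₀ ℕ, e.embDomain (alphabetEmbedding i) (i, v) = e v :=
              fun e => Finsupp.embDomain_apply_self (alphabetEmbedding i) e v
            rw [Finsupp.add_apply, Finsupp.add_apply, h2, hy (i, v) hi, h3, h3] at h1
            exact h1
          subst hx'
          rw [add_left_cancel hxy]
        · intro h
          exfalso
          apply h
          rw [Finset.HasAntidiagonal.mem_antidiagonal]
  exact (key Finset.univ).2

/-- The leading exponent of `m_λ(x^{(1)}, …, x^{(n)})`. -/
noncomputable def MultiPar.canonicalExponent {n : ℕ} (la : MultiPar n) : Fin n × ℕ →₀ ℕ :=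
  joinExponents fun k => MultiMacdonald.canonicalExponent (la k)

theorem coeff_canonicalExponent_multiMonomialSeries {n : ℕ} (la mu : MultiPar n)
    [Decidable (la = mu)] :
    MvPowerSeries.coeff la.canonicalExponent (multiMonomialSeries mu) =
      if la = mu then 1 else 0 := by
  classical
  rw [multiMonomialSeries_eq_prod_rename, MultiPar.canonicalExponent,
    coeff_joinExponents_prod_rename]
  simp only [coeff_canonicalExponent_monomialSeries]
  split_ifs with h
  · subst h
    simp
  · obtain ⟨k, hk⟩ := Function.ne_iff.1 h
    exact Finset.prod_eq_zero (Finset.mem_univ k) (if_neg hk)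

/-- The monomial multi-symmetric function as a polynomial in the power sums. -/
noncomputable def MultiSym.m {n : ℕ} (la : MultiPar n) : MultiSym n :=
  ∏ k : Fin n, colorHom k (Sym.m (la k))

theorem MultiSym.toSeries_m {n : ℕ} (la : MultiPar n) :
    MultiSym.toSeries n (MultiSym.m la) = multiMonomialSeries la := by
  rw [MultiSym.m, map_prod, multiMonomialSeries_eq_prod_rename]
  refine Finset.prod_congr rfl fun k _ => ?_
  rw [toSeries_colorHom, Sym.toSeries_m]

theorem MultiSym.linearIndependent_multiMonomialSeries (n : ℕ) :
    LinearIndependent K (fun la : MultiPar n => multiMonomialSeries la) := by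
  classical
  rw [linearIndependent_iff']
  intro s g hg mu hmu
  have := congrArg (MvPowerSeries.coeff mu.canonicalExponent) hg
  simpa [map_sum, MvPowerSeries.coeff_smul, coeff_canonicalExponent_multiMonomialSeries, hmu]
    using this

theorem MultiSym.linearIndependent_m (n : ℕ) :
    LinearIndependent K (MultiSym.m : MultiPar n → MultiSym n) := by
  refine LinearIndependent.of_comp (MultiSym.toSeries n).toLinearMap ?_
  have h : (MultiSym.toSeries n).toLinearMap ∘ MultiSym.m =
      fun la : MultiPar n => multiMonomialSeries la := funext MultiSym.toSeries_m
  rw [h]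
  exact MultiSym.linearIndependent_multiMonomialSeries n

theorem submodule_prod_mem_prod {ι R A : Type*} [CommSemiring R] [CommSemiring A] [Algebra R A]
    {s : Finset ι} {x : ι → A} {M : ι → Submodule R A} (h : ∀ i ∈ s, x i ∈ M i) :
    ∏ i ∈ s, x i ∈ ∏ i ∈ s, M i := by
  classical
  induction s using Finset.induction_on with
  | empty => exact Submodule.one_le.1 le_rfl
  | insert i s hi ih =>
    rw [Finset.prod_insert hi, Finset.prod_insert hi]
    exact Submodule.mul_mem_mul (h i (Finset.mem_insert_self i s))
      (ih fun j hj => h j (Finset.mem_insert_of_mem hj))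

open scoped Pointwise in
theorem MultiSym.prod_colorHom_mem_span_m {n : ℕ} (f : Fin n → Sym) :
    ∏ k, colorHom k (f k) ∈ Submodule.span K (Set.range (MultiSym.m : MultiPar n → MultiSym n)) := by
  have h1 : ∏ k, colorHom k (f k) ∈
      ∏ k : Fin n, Submodule.span K (Set.range fun la => colorHom k (Sym.m la)) := by
    refine submodule_prod_mem_prod fun k _ => ?_
    have h2 : Submodule.span K (Set.range fun la => colorHom k (Sym.m la)) =
        Submodule.map (colorHom k).toLinearMap (Submodule.span K (Set.range Sym.m)) := by
      rw [Submodule.map_span, ← Set.range_comp]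
      rfl
    rw [h2, Sym.span_m]
    exact Submodule.mem_map_of_mem (f := (colorHom k).toLinearMap) Submodule.mem_top
  rw [Submodule.prod_span] at h1
  refine Submodule.span_mono ?_ h1
  intro x hx
  rw [Set.mem_fintype_prod] at hx
  obtain ⟨g, hg, rfl⟩ := hx
  choose la hla using hg
  exact ⟨la, Finset.prod_congr rfl fun k _ => hla k⟩

theorem MultiSym.span_m (n : ℕ) :
    Submodule.span K (Set.range (MultiSym.m : MultiPar n → MultiSym n)) = ⊤ := by
  rw [eq_top_iff, ← (MvPolynomial.basisMonomials (Fin n × ℕ+) K).span_eq, Submodule.span_le]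
  rintro _ ⟨α, rfl⟩
  rw [MvPolynomial.coe_basisMonomials, ← (MultiPar.exponentEquiv n).symm_apply_apply α]
  beta_reduce
  rw [MultiPar.monomial_exponentEquiv_symm]
  have h : ∀ (k : Fin n) (la : Par),
      (la.map fun r => (MvPolynomial.X (k, r) : MultiSym n)).prod = colorHom k (Sym.p la) := by
    intro k la
    rw [Sym.p, map_multiset_prod, Multiset.map_map]
    simp [colorHom_X]
  simp only [h]
  exact MultiSym.prod_colorHom_mem_span_m _

/-- The basis `(m_λ)_λ` of the ring of multi-symmetric functions. -/
noncomputable def MultiSym.mBasis (n : ℕ) : Module.Basis (MultiPar n) K (MultiSym n) :=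
  Module.Basis.mk (MultiSym.linearIndependent_m n) (MultiSym.span_m n).ge

theorem MultiSym.mBasis_apply {n : ℕ} (la : MultiPar n) : MultiSym.mBasis n la = MultiSym.m la := by
  rw [MultiSym.mBasis, Module.Basis.mk_apply]

theorem MultiSym.mBasis_repr {n : ℕ} (f : MultiSym n) (la : MultiPar n) :
    (MultiSym.mBasis n).repr f la =
      MvPowerSeries.coeff la.canonicalExponent (MultiSym.toSeries n f) := by
  classical
  have h : (MultiSym.mBasis n).coord la =
      (MvPowerSeries.coeff la.canonicalExponent).comp (MultiSym.toSeries n).toLinearMap := by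
    refine (MultiSym.mBasis n).ext fun mu => ?_
    rw [Module.Basis.coord_apply, Module.Basis.repr_self, LinearMap.comp_apply,
      AlgHom.toLinearMap_apply, MultiSym.mBasis_apply, MultiSym.toSeries_m,
      coeff_canonicalExponent_multiMonomialSeries, Finsupp.single_apply]
    simp only [eq_comm]
  exact LinearMap.congr_fun h f

theorem MultiSym.toSeries_injective (n : ℕ) : Function.Injective (MultiSym.toSeries n) := by
  refine injective_of_linearIndependent_comp_basis (MultiSym.mBasis n)
    (MultiSym.toSeries n).toLinearMap ?_
  have h : (fun la => (MultiSym.toSeries n).toLinearMap (MultiSym.mBasis n la)) =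
      fun la : MultiPar n => multiMonomialSeries la := by
    funext la
    rw [MultiSym.mBasis_apply]
    exact MultiSym.toSeries_m la
  rw [h]
  exact MultiSym.linearIndependent_multiMonomialSeries n

/-! ### Dominance of multi-partitions -/

/-- The total exponent of the variables `x^{(i)}_j` that precede `x^{(k+1)}_{j+1}`, where
`o = (k, j)`, in the lexicographic order. -/
noncomputable def multiPrefix {n : ℕ} (o : Fin n × ℕ) : (Fin n × ℕ →₀ ℕ) →+ ℕ :=
  Finsupp.weight fun v => if v.1 < o.1 ∨ v.1 = o.1 ∧ v.2 < o.2 then 1 else 0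

theorem prefixSum_eq_weight (j : ℕ) (e : ℕ →₀ ℕ) :
    prefixSum j e = Finsupp.weight (fun v => if v < j then 1 else 0) e := by
  have h : prefixSum j = Finsupp.weight (fun v => if v < j then 1 else 0) := by
    ext i
    simp [prefixSum_single, Finsupp.weight_single]
  rw [h]

theorem multiPrefix_embDomain {n : ℕ} (o : Fin n × ℕ) (k : Fin n) (e : ℕ →₀ ℕ) :
    multiPrefix o (e.embDomain (alphabetEmbedding k)) =
      if k < o.1 then e.degree else if k = o.1 then prefixSum o.2 e else 0 := by
  rw [multiPrefix, Finsupp.weight_apply, Finsupp.sum_embDomain]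
  simp only [alphabetEmbedding_apply]
  split_ifs with h1 h2
  · simp [h1, Finsupp.degree_apply, Finsupp.sum]
  · rw [prefixSum_eq_weight, Finsupp.weight_apply]
    simp [h2]
  · simp [h1, h2]

theorem multiPrefix_joinExponents {n : ℕ} (o : Fin n × ℕ) (ε : Fin n → ℕ →₀ ℕ) :
    multiPrefix o (joinExponents ε) =
      (∑ i ∈ Finset.Iio o.1, (ε i).degree) + prefixSum o.2 (ε o.1) := by
  classical
  rw [joinExponents, map_sum]
  simp only [multiPrefix_embDomain]
  have h : ∀ k : Fin n, (if k < o.1 then (ε k).degree else if k = o.1 then prefixSum o.2 (ε k)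
      else 0) = (if k ∈ Finset.Iio o.1 then (ε k).degree else 0) +
        if k = o.1 then prefixSum o.2 (ε k) else 0 := by
    intro k
    simp only [Finset.mem_Iio]
    split_ifs with h1 h2
    · exact absurd h2 h1.ne
    · simp
    · simp
    · simp
  rw [Finset.sum_congr rfl fun k _ => h k, Finset.sum_add_distrib, Finset.sum_ite_mem,
    Finset.univ_inter, Finset.sum_ite_eq' Finset.univ o.1, if_pos (Finset.mem_univ _)]

theorem joinExponents_surjective {n : ℕ} :
    Function.Surjective (joinExponents : (Fin n → ℕ →₀ ℕ) → Fin n × ℕ →₀ ℕ) := by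
  intro e
  refine ⟨fun k => e.comapDomain (alphabetEmbedding k) (alphabetEmbedding k).injective.injOn, ?_⟩
  ext ⟨k, v⟩
  rw [joinExponents_apply]
  rfl

theorem eq_of_multiPrefix_eq {n : ℕ} (e e' : Fin n × ℕ →₀ ℕ)
    (h : ∀ o, multiPrefix o e = multiPrefix o e') : e = e' := by
  obtain ⟨ε, rfl⟩ := joinExponents_surjective e
  obtain ⟨ε', rfl⟩ := joinExponents_surjective e'
  congr 1
  funext k
  refine eq_of_prefixSum_eq _ _ fun j => ?_
  have h1 := h (k, j)
  have h0 := h (k, 0)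
  simp only [multiPrefix_joinExponents] at h0 h1
  have h2 : ∀ e : ℕ →₀ ℕ, prefixSum 0 e = 0 := fun e => by simp [prefixSum_apply]
  rw [h2, h2] at h0
  omega

theorem degree_canonicalExponent (la : Par) : (canonicalExponent la).degree = la.size := by
  rw [← size_exponentType_eq_degree, exponentType_canonicalExponent]

theorem MultiPar.dominated_iff {n : ℕ} {mu la : MultiPar n} : mu.Dominated la ↔
    ∀ o, multiPrefix o mu.canonicalExponent ≤ multiPrefix o la.canonicalExponent := by
  simp only [MultiPar.Dominated, MultiPar.canonicalExponent, multiPrefix_joinExponents, Prod.forall,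
    degree_canonicalExponent, prefixSum_apply, sum_range_canonicalExponent]

theorem MultiPar.canonicalExponent_injective (n : ℕ) :
    Function.Injective (MultiPar.canonicalExponent : MultiPar n → Fin n × ℕ →₀ ℕ) := by
  intro la mu h
  funext k
  have h1 : MultiMacdonald.canonicalExponent (la k) = MultiMacdonald.canonicalExponent (mu k) :=
    congrFun (joinExponents_injective h) k
  rw [← exponentType_canonicalExponent (la k), h1, exponentType_canonicalExponent]

theorem MultiPar.Dominated.antisymm {n : ℕ} {mu la : MultiPar n} (h : mu.Dominated la)
    (h' : la.Dominated mu) : mu = la := by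
  rw [MultiPar.dominated_iff] at h h'
  exact MultiPar.canonicalExponent_injective n
    (eq_of_multiPrefix_eq _ _ fun o => le_antisymm (h o) (h' o))

theorem MultiPar.Dominated.trans {n : ℕ} {nu mu la : MultiPar n} (h : nu.Dominated mu)
    (h' : mu.Dominated la) : nu.Dominated la := fun k j => (h k j).trans (h' k j)

theorem MultiPar.Dominated.size_le {n : ℕ} {mu la : MultiPar n} (h : mu.Dominated la) (k : Fin n) :
    (mu k).size ≤ ∑ i, (la i).size := by
  calc (mu k).size = (mu k).partialSum (Multiset.card (mu k)) :=
        (Par.partialSum_eq_size le_rfl).symm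
    _ ≤ (∑ i ∈ Finset.Iio k, (la i).size) + (la k).partialSum (Multiset.card (mu k)) :=
        (Nat.le_add_left _ _).trans (h k _)
    _ ≤ (∑ i ∈ Finset.Iio k, (la i).size) + (la k).size :=
        Nat.add_le_add_left (Par.partialSum_le_size _ _) _
    _ = ∑ i ∈ Finset.Iic k, (la i).size := by
        rw [← Finset.Iio_insert, Finset.sum_insert (by simp), add_comm]
    _ ≤ ∑ i, (la i).size := Finset.sum_le_sum_of_subset (Finset.subset_univ _)

/-- The number of multi-partitions dominated by a given one. -/
noncomputable def MultiPar.rank {n : ℕ} (la : MultiPar n) : ℕ :=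
  {mu : MultiPar n | mu.Dominated la}.ncard

theorem MultiPar.rank_lt {n : ℕ} (la mu : MultiPar n) (h : mu.Dominated la ∧ mu ≠ la) :
    mu.rank < la.rank := by
  have hfin : {mu : MultiPar n | mu.Dominated la}.Finite :=
    (Set.Finite.pi' fun _ => finite_setOf_size_le (∑ i, (la i).size)).subset
      fun nu hnu k => MultiPar.Dominated.size_le hnu k
  refine Set.ncard_lt_ncard ⟨fun nu hnu => hnu.trans h.1, fun hsub => ?_⟩ hfin
  have : la.Dominated la := fun _ _ => le_rfl
  exact h.2 (h.1.antisymm (hsub this))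

theorem MultiPar.strictDominated_trans {n : ℕ} (nu mu la : MultiPar n)
    (h : nu.Dominated mu ∧ nu ≠ mu) (h' : mu.Dominated la ∧ mu ≠ la) :
    nu.Dominated la ∧ nu ≠ la :=
  ⟨h.1.trans h'.1, by rintro rfl; exact h.2 (h.1.antisymm h'.1)⟩

theorem MultiSym.mem_span_m_of_exponentsLe {n : ℕ} {f : MultiSym n} {la : MultiPar n}
    (hf : ExponentsLe multiPrefix (MultiSym.toSeries n f) la.canonicalExponent) :
    f - MvPowerSeries.coeff la.canonicalExponent (MultiSym.toSeries n f) • MultiSym.m la ∈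
      Submodule.span K (MultiSym.m '' {mu : MultiPar n | mu.Dominated la ∧ mu ≠ la}) := by
  have hm : (MultiSym.mBasis n : MultiPar n → MultiSym n) = MultiSym.m :=
    funext MultiSym.mBasis_apply
  rw [← hm, (MultiSym.mBasis n).mem_span_image]
  intro mu hmu
  rw [Finset.mem_coe, Finsupp.mem_support_iff, map_sub, map_smul, Module.Basis.repr_self,
    Finsupp.sub_apply, Finsupp.smul_apply, MultiSym.mBasis_repr] at hmu
  have hne : mu ≠ la := by
    rintro rfl
    simp at hmu
  rw [Finsupp.single_apply, if_neg hne.symm, smul_zero, sub_zero] at hmu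
  exact ⟨MultiPar.dominated_iff.2 (hf _ hmu), hne⟩

/-! ### Symmetric functions of a union of alphabets -/

/-- The symmetric function `f(x^{(1)}, x^{(2)})`. -/
noncomputable def coproductHom : Sym →ₐ[K] MultiSym 2 :=
  MvPolynomial.aeval fun r => MvPolynomial.X (0, r) + MvPolynomial.X (1, r)

theorem powerSumSeries_union {σ : Type} {S T : Set σ} (h : Disjoint S T) (r : ℕ+) :
    powerSumSeries (S ∪ T) r = powerSumSeries S r + powerSumSeries T r := by
  classical
  ext e
  rw [map_add, coeff_powerSumSeries, coeff_powerSumSeries, coeff_powerSumSeries]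
  by_cases h1 : ∃ v ∈ S, e = Finsupp.single v (r : ℕ)
  · have h2 : ¬ ∃ v ∈ T, e = Finsupp.single v (r : ℕ) := by
      rintro ⟨v, hv, hev⟩
      obtain ⟨u, hu, heu⟩ := h1
      rw [heu, Finsupp.single_left_inj (PNat.ne_zero r)] at hev
      exact Set.disjoint_left.1 h hu (hev ▸ hv)
    rw [if_pos h1, if_neg h2, add_zero, if_pos]
    obtain ⟨u, hu, heu⟩ := h1
    exact ⟨u, Or.inl hu, heu⟩
  · rw [if_neg h1, zero_add]
    congr 1
    apply propext
    constructor
    · rintro ⟨v, hv | hv, hev⟩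
      · exact absurd ⟨v, hv, hev⟩ h1
      · exact ⟨v, hv, hev⟩
    · rintro ⟨v, hv, hev⟩
      exact ⟨v, Or.inr hv, hev⟩

theorem toSeries_coproductHom (f : Sym) :
    MultiSym.toSeries 2 (coproductHom f) = Sym.inAlphabet Set.univ f := by
  rw [← AlgHom.comp_apply]
  congr 1
  ext1 r
  have hdisj : Disjoint (alphabet (0 : Fin 2)) (alphabet 1) := by
    rw [Set.disjoint_left]
    intro v hv hv'
    have h : (0 : Fin 2) = 1 := hv.symm.trans hv'
    exact absurd h (by decide)
  have hunion : alphabet (0 : Fin 2) ∪ alphabet 1 = Set.univ := by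
    ext ⟨i, v⟩
    fin_cases i <;> simp [alphabet]
  rw [AlgHom.comp_apply, coproductHom, MvPolynomial.aeval_X, map_add, toSeries_X, toSeries_X,
    Sym.inAlphabet, MvPolynomial.aeval_X, ← powerSumSeries_union hdisj, hunion]

theorem exponentType_canonicalExponent_two (la : MultiPar 2) :
    exponentType la.canonicalExponent = la 0 + la 1 := by
  have h : la.canonicalExponent =
      (canonicalExponent (la 0)).embDomain (alphabetEmbedding 0) +
        (canonicalExponent (la 1)).embDomain (alphabetEmbedding 1) := by
    rw [MultiPar.canonicalExponent, joinExponents, Fin.sum_univ_two]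
  rw [h, exponentType_add_of_disjoint, exponentType_embDomain, exponentType_embDomain,
    exponentType_canonicalExponent, exponentType_canonicalExponent]
  rw [Finset.disjoint_left]
  simp only [Finsupp.support_embDomain, Finset.mem_map, not_exists, not_and]
  rintro _ ⟨u, -, rfl⟩ v - h
  simpa [alphabetEmbedding_apply] using congrArg Prod.fst h

/-- The expansion of `m_ν(x^{(1)}, x^{(2)})` only has terms `m_α(x^{(1)}) m_β(x^{(2)})` for which
`ν` is the union of `α` and `β`. -/
theorem coproductHom_m_mem_span (nu : Par) : coproductHom (Sym.m nu) ∈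
    Submodule.span K (MultiSym.m '' {la : MultiPar 2 | la 0 + la 1 = nu}) := by
  classical
  have hm : (MultiSym.mBasis 2 : MultiPar 2 → MultiSym 2) = MultiSym.m :=
    funext MultiSym.mBasis_apply
  obtain ⟨φ⟩ : Nonempty (ℕ ≃ Fin 2 × ℕ) := nonempty_equiv_of_countable
  have h1 : MultiSym.toSeries 2 (coproductHom (Sym.m nu)) = monomialSeries Set.univ nu := by
    have h2 : (Set.univ : Set (Fin 2 × ℕ)) = φ.toEmbedding '' Set.univ := by simp
    rw [toSeries_coproductHom, h2, ← rename_inAlphabet, ← Sym.toSeries_eq_inAlphabet,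
      Sym.toSeries_m, rename_monomialSeries]
  rw [← hm, (MultiSym.mBasis 2).mem_span_image]
  intro la hla
  rw [Finset.mem_coe, Finsupp.mem_support_iff, MultiSym.mBasis_repr, h1, coeff_monomialSeries,
    exponentType_canonicalExponent_two] at hla
  by_contra h
  exact hla (if_neg fun h' => h h'.2)

/-! ### Triangularity of plethysms -/

section Tail

variable {n : ℕ} {k : Fin n} {y : ℕ+ → MultiSym n}

/-- The bound for a series of degree at most `d` in the alphabets after the one indexed by `k`. -/
def tailBound (k : Fin n) (d : ℕ) (o : Fin n × ℕ) : ℕ := if o.1 ≤ k then 0 else d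

theorem powerSumSeries_mem_tailBound {i : Fin n} (hi : k < i) (r : ℕ+) :
    powerSumSeries (alphabet i) r ∈ boundedSeries multiPrefix (tailBound k r) := by
  classical
  intro e he o
  rw [coeff_powerSumSeries] at he
  obtain ⟨v, hv, rfl⟩ : ∃ v ∈ alphabet i, e = Finsupp.single v (r : ℕ) := by
    by_contra h
    simp [h] at he
  have hv' : v.1 = i := hv
  rw [multiPrefix, Finsupp.weight_single, tailBound, hv']
  split_ifs with h1 h2 <;> simp
  rcases h1 with h1 | h1
  · exact absurd (h1.trans_le h2) hi.asymm
  · exact absurd (h1.1.trans_le h2) hi.not_ge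

theorem toSeries_aeval_mem_tailBound
    (hy : ∀ r, y r ∈ Submodule.span K ((fun i : Fin n => (MvPolynomial.X (i, r) : MultiSym n)) ''
      Set.Ioi k)) {d : ℕ} {f : Sym} (hf : f ∈ Sym.ofDegree d) :
    MultiSym.toSeries n (MvPolynomial.aeval y f) ∈ boundedSeries multiPrefix (tailBound k d) := by
  have hle : Sym.ofDegree d ≤ Submodule.comap
      ((MultiSym.toSeries n).comp (MvPolynomial.aeval y)).toLinearMap
        (boundedSeries multiPrefix (tailBound k d)) := by
    rw [Sym.ofDegree, Submodule.span_le]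
    rintro _ ⟨mu, rfl, rfl⟩
    have h1 : ∀ r : ℕ+, MultiSym.toSeries n (y r) ∈ boundedSeries multiPrefix (tailBound k r) := by
      intro r
      have h2 : Submodule.span K ((fun i : Fin n => (MvPolynomial.X (i, r) : MultiSym n)) ''
          Set.Ioi k) ≤ Submodule.comap (MultiSym.toSeries n).toLinearMap
            (boundedSeries multiPrefix (tailBound k r)) := by
        rw [Submodule.span_le]
        rintro _ ⟨i, hi, rfl⟩
        rw [SetLike.mem_coe, Submodule.mem_comap, AlgHom.toLinearMap_apply, toSeries_X]
        exact powerSumSeries_mem_tailBound hi r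
      exact h2 (hy r)
    have h3 := multiset_prod_mem_boundedSeries (s := mu) fun r _ => h1 r
    have h4 : (mu.map fun r : ℕ+ => tailBound k r).sum = tailBound k (Par.size mu) := by
      funext o
      rw [Par.size]
      clear hf h3
      induction mu using Multiset.induction_on with
      | empty => simp [tailBound]
      | cons r mu ih =>
        rw [Multiset.map_cons, Multiset.sum_cons, Multiset.map_cons, Multiset.sum_cons,
          Pi.add_apply, ih, tailBound, tailBound, tailBound]
        split_ifs <;> simp
    rw [h4] at h3
    rw [SetLike.mem_coe, Submodule.mem_comap, AlgHom.toLinearMap_apply, AlgHom.comp_apply, Sym.p,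
      map_multiset_prod, map_multiset_prod, Multiset.map_map, Multiset.map_map]
    simpa using h3
  exact hle hf

/-- The exponents of a plethystic substitution of the alphabet `x^{(k+1)}`, modified by later
alphabets, into a monomial symmetric function. -/
theorem toSeries_aeval_m_mem_boundedSeries
    (hy : ∀ r, y r ∈ Submodule.span K ((fun i : Fin n => (MvPolynomial.X (i, r) : MultiSym n)) ''
      Set.Ioi k)) (nu : Par) :
    MultiSym.toSeries n (MvPolynomial.aeval (fun r => MvPolynomial.X (k, r) + y r) (Sym.m nu)) ∈
      boundedSeries multiPrefix fun o =>
        multiPrefix o ((canonicalExponent nu).embDomain (alphabetEmbedding k)) := by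
  let Ξ : MultiSym 2 →ₐ[K] MultiSym n := MvPolynomial.aeval fun v =>
    if v.1 = 0 then MvPolynomial.X (k, v.2) else y v.2
  have h0 : Ξ.comp (colorHom 0) = colorHom k := by
    ext1 r
    simp [Ξ, colorHom_X]
  have h1 : Ξ.comp (colorHom 1) = MvPolynomial.aeval y := by
    ext1 r
    simp [Ξ, colorHom_X]
  have h2 : MvPolynomial.aeval (fun r => MvPolynomial.X (k, r) + y r) = Ξ.comp coproductHom := by
    ext1 r
    simp [Ξ, coproductHom]
  rw [h2, AlgHom.comp_apply]
  have hle : Submodule.span K (MultiSym.m '' {la : MultiPar 2 | la 0 + la 1 = nu}) ≤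
      Submodule.comap ((MultiSym.toSeries n).comp Ξ).toLinearMap
        (boundedSeries multiPrefix fun o =>
          multiPrefix o ((canonicalExponent nu).embDomain (alphabetEmbedding k))) := by
    rw [Submodule.span_le]
    rintro _ ⟨la, rfl, rfl⟩
    have h3 : Ξ (MultiSym.m la) = colorHom k (Sym.m (la 0)) *
        MvPolynomial.aeval y (Sym.m (la 1)) := by
      rw [MultiSym.m, Fin.prod_univ_two, map_mul, ← AlgHom.comp_apply, ← AlgHom.comp_apply, h0, h1]
    rw [SetLike.mem_coe, Submodule.mem_comap, AlgHom.toLinearMap_apply, AlgHom.comp_apply, h3,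
      map_mul, toSeries_colorHom, Sym.toSeries_m]
    have h4 : MvPowerSeries.rename (alphabetEmbedding k) (monomialSeries Set.univ (la 0)) ∈
        boundedSeries multiPrefix fun o =>
          multiPrefix o ((canonicalExponent (la 0)).embDomain (alphabetEmbedding k)) := by
      intro e he o
      obtain ⟨x, rfl, hx⟩ := exists_embDomain_of_coeff_rename_ne_zero he
      beta_reduce
      rw [multiPrefix_embDomain, multiPrefix_embDomain]
      split_ifs
      · classical
        rw [coeff_monomialSeries] at hx
        have hla : exponentType x = la 0 := by by_contra h; simp [h] at hx
        rw [degree_canonicalExponent, ← hla, size_exponentType_eq_degree]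
      · exact exponentsLe_monomialSeries (la 0) x hx _
      · exact le_rfl
    refine boundedSeries_mono (fun o => ?_) (mul_mem_boundedSeries h4
      (toSeries_aeval_mem_tailBound hy (Sym.m_mem_ofDegree (la 1))))
    rw [Pi.add_apply, multiPrefix_embDomain, multiPrefix_embDomain, tailBound,
      degree_canonicalExponent, degree_canonicalExponent, prefixSum_apply, prefixSum_apply,
      sum_range_canonicalExponent, sum_range_canonicalExponent, Par.size_add]
    split_ifs with h5 h6 h7 h8 h9
    · exact absurd h5 h6.not_gt
    · exact le_rfl
    · exact Par.partialSum_mono (Multiset.le_add_right _ _) _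
    · exact absurd h7.ge h8
    · exact le_rfl
    · exact absurd (le_of_not_gt h5) h9
  exact hle (coproductHom_m_mem_span nu)

/-- Setting the variables of all alphabets but one to zero. -/
theorem killCompl_toSeries_aeval
    (hy : ∀ r, y r ∈ Submodule.span K ((fun i : Fin n => (MvPolynomial.X (i, r) : MultiSym n)) ''
      Set.Ioi k)) (f : Sym) :
    MvPowerSeries.killCompl (alphabetEmbedding k)
      (MultiSym.toSeries n (MvPolynomial.aeval (fun r => MvPolynomial.X (k, r) + y r) f)) =
        Sym.toSeries f := by
  have hpre : alphabetEmbedding k ⁻¹' alphabet k = Set.univ := by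
    ext v
    simp [alphabetEmbedding_apply, alphabet]
  have hy0 : ∀ r, MvPowerSeries.killCompl (alphabetEmbedding k) (MultiSym.toSeries n (y r)) = 0 := by
    intro r
    have hle : Submodule.span K ((fun i : Fin n => (MvPolynomial.X (i, r) : MultiSym n)) ''
        Set.Ioi k) ≤ LinearMap.ker ((MvPowerSeries.killCompl (alphabetEmbedding k)).comp
          (MultiSym.toSeries n)).toLinearMap := by
      rw [Submodule.span_le]
      rintro _ ⟨i, hi, rfl⟩
      rw [SetLike.mem_coe, LinearMap.mem_ker, AlgHom.toLinearMap_apply, AlgHom.comp_apply,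
        toSeries_X, killCompl_powerSumSeries]
      have hempty : alphabetEmbedding k ⁻¹' alphabet i = ∅ := by
        ext v
        simpa [alphabetEmbedding_apply, alphabet] using ne_of_lt hi
      classical
      ext e
      rw [hempty, coeff_powerSumSeries]
      simp
    exact hle (hy r)
  rw [← AlgHom.comp_apply, ← AlgHom.comp_apply]
  congr 1
  ext1 r
  simp [toSeries_X, killCompl_powerSumSeries, hpre, hy0, Sym.toSeries]

/-- A plethystic substitution of an alphabet, modified by later alphabets, into a symmetric function
that is unitriangular over the monomial ones. -/
theorem exponentsLe_toSeries_aeval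
    (hy : ∀ r, y r ∈ Submodule.span K ((fun i : Fin n => (MvPolynomial.X (i, r) : MultiSym n)) ''
      Set.Ioi k)) {la : Par} {f : Sym}
    (hf : f - Sym.m la ∈ Submodule.span K (Sym.m '' {mu : Par | mu.Dominated la ∧ mu ≠ la})) :
    ExponentsLe multiPrefix
        (MultiSym.toSeries n (MvPolynomial.aeval (fun r => MvPolynomial.X (k, r) + y r) f))
        ((canonicalExponent la).embDomain (alphabetEmbedding k)) ∧
      MvPowerSeries.coeff ((canonicalExponent la).embDomain (alphabetEmbedding k))
        (MultiSym.toSeries n (MvPolynomial.aeval (fun r => MvPolynomial.X (k, r) + y r) f)) =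
          1 := by
  classical
  constructor
  · have h1 : f ∈ Submodule.span K (Sym.m '' {mu : Par | mu.Dominated la}) := by
      have h2 : Sym.m la ∈ Submodule.span K (Sym.m '' {mu : Par | mu.Dominated la}) :=
        Submodule.subset_span ⟨la, fun _ => le_rfl, rfl⟩
      have h3 := add_mem (Submodule.span_mono (Set.image_mono fun mu hmu => hmu.1) hf) h2
      rwa [sub_add_cancel] at h3
    have hle : Submodule.span K (Sym.m '' {mu : Par | mu.Dominated la}) ≤ Submodule.comap
        ((MultiSym.toSeries n).comp
          (MvPolynomial.aeval (fun r => MvPolynomial.X (k, r) + y r))).toLinearMap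
        (boundedSeries multiPrefix fun o =>
          multiPrefix o ((canonicalExponent la).embDomain (alphabetEmbedding k))) := by
      rw [Submodule.span_le]
      rintro _ ⟨mu, hmu, rfl⟩
      refine boundedSeries_mono (fun o => ?_) (toSeries_aeval_m_mem_boundedSeries hy mu)
      rw [multiPrefix_embDomain, multiPrefix_embDomain]
      split_ifs
      · rw [degree_canonicalExponent, degree_canonicalExponent]
        exact Par.Dominated.size_le hmu
      · exact Par.dominated_iff.1 hmu _
      · exact le_rfl
    exact hle h1
  · rw [← MvPowerSeries.coeff_killCompl, killCompl_toSeries_aeval hy]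
    have hle : Submodule.span K (Sym.m '' {mu : Par | mu.Dominated la ∧ mu ≠ la}) ≤
        LinearMap.ker ((MvPowerSeries.coeff (canonicalExponent la)).comp
          Sym.toSeries.toLinearMap) := by
      rw [Submodule.span_le]
      rintro _ ⟨mu, hmu, rfl⟩
      rw [SetLike.mem_coe, LinearMap.mem_ker, LinearMap.comp_apply, AlgHom.toLinearMap_apply,
        Sym.toSeries_m, coeff_canonicalExponent_monomialSeries, if_neg (Ne.symm hmu.2)]
    have h1 := hle hf
    rw [LinearMap.mem_ker, LinearMap.comp_apply, AlgHom.toLinearMap_apply, map_sub, map_sub,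
      Sym.toSeries_m, coeff_canonicalExponent_monomialSeries, if_pos rfl, sub_eq_zero] at h1
    exact h1

end Tail

theorem adams_alphabetSum {n : ℕ} (r : ℕ+) (k : Fin n) :
    adams r (alphabetSum k) = MvPolynomial.X (k, r) := by
  simp [adams, alphabetSum]

/-- The alphabet `A_i` is `X^{(n-i)}` plus a combination of later alphabets. -/
theorem adams_alphabetA_sub_mem {n : ℕ} (r : ℕ+) (i : ℕ) (hi : i < n) :
    adams r (alphabetA n i hi) - MvPolynomial.X (⟨n - 1 - i, by omega⟩, r) ∈
      Submodule.span K ((fun j : Fin n => (MvPolynomial.X (j, r) : MultiSym n)) ''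
        Set.Ioi ⟨n - 1 - i, by omega⟩) := by
  induction i with
  | zero => simp [alphabetA, adams_alphabetSum]
  | succ i ih =>
    have h1 := ih (by omega)
    have h2 : (MvPolynomial.X (⟨n - 1 - i, by omega⟩, r) : MultiSym n) ∈
        Submodule.span K ((fun j : Fin n => (MvPolynomial.X (j, r) : MultiSym n)) ''
          Set.Ioi ⟨n - 1 - (i + 1), by omega⟩) :=
      Submodule.subset_span ⟨⟨n - 1 - i, by omega⟩, by simp; omega, rfl⟩
    have h3 : adams r (alphabetA n i (by omega)) ∈
        Submodule.span K ((fun j : Fin n => (MvPolynomial.X (j, r) : MultiSym n)) ''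
          Set.Ioi ⟨n - 1 - (i + 1), by omega⟩) := by
      have h4 := add_mem (Submodule.span_mono (Set.image_mono (Set.Ioi_subset_Ioi (by
        simp; omega))) h1) h2
      rwa [sub_add_cancel] at h4
    rw [alphabetA, map_add, adams_alphabetSum, add_sub_cancel_left, map_mul]
    have h5 : ∀ c : K, adams r (MvPolynomial.C c : MultiSym n) =
        MvPolynomial.C (adamsK r c) := fun c => by simp [adams]
    rw [h5, ← MvPolynomial.smul_eq_C_mul]
    exact Submodule.smul_mem _ _ h3

theorem reverseIndex_lt {n : ℕ} (k : Fin n) : n - 1 - (k : ℕ) < n := by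
  omega

/-- Products of plethysms in the alphabets `A_{n-1}, …, A_0` are unitriangular. -/
theorem prod_plethysm_sub_m_mem {n : ℕ} {la : MultiPar n} {f : Fin n → Sym}
    (hf : ∀ k, f k - Sym.m (la k) ∈
      Submodule.span K (Sym.m '' {mu : Par | mu.Dominated (la k) ∧ mu ≠ la k})) :
    (∏ k : Fin n, plethysm (alphabetA n (n - 1 - k) (reverseIndex_lt k)) (f k)) - MultiSym.m la ∈
      Submodule.span K (MultiSym.m '' {mu : MultiPar n | mu.Dominated la ∧ mu ≠ la}) := by
  have hθ : ∀ k : Fin n,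
      ExponentsLe multiPrefix
        (MultiSym.toSeries n (plethysm (alphabetA n (n - 1 - k) (reverseIndex_lt k)) (f k)))
        ((canonicalExponent (la k)).embDomain (alphabetEmbedding k)) ∧
      MvPowerSeries.coeff ((canonicalExponent (la k)).embDomain (alphabetEmbedding k))
        (MultiSym.toSeries n (plethysm (alphabetA n (n - 1 - k) (reverseIndex_lt k)) (f k))) = 1 := by
    intro k
    have hk : (⟨n - 1 - (n - 1 - k), by omega⟩ : Fin n) = k := by
      ext
      simp
      omega
    have h1 := exponentsLe_toSeries_aeval (k := k)
      (y := fun r => adams r (alphabetA n (n - 1 - k) (reverseIndex_lt k)) - MvPolynomial.X (k, r))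
      (fun r => by
        have h2 := adams_alphabetA_sub_mem r (n - 1 - k) (n := n) (by omega)
        rwa [hk] at h2) (hf k)
    simp only [add_sub_cancel] at h1
    exact h1
  obtain ⟨h1, h2⟩ := exponentsLe_prod_and_coeff (s := Finset.univ) eq_of_multiPrefix_eq
    fun k _ => (hθ k).1
  have h3 := MultiSym.mem_span_m_of_exponentsLe (la := la) (f := ∏ k : Fin n,
    plethysm (alphabetA n (n - 1 - k) (reverseIndex_lt k)) (f k)) (by rw [map_prod]; exact h1)
  rw [map_prod] at h3
  rw [Finset.prod_congr rfl fun k _ => (hθ k).2, Finset.prod_const_one] at h2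
  have h4 : MvPowerSeries.coeff la.canonicalExponent (∏ k : Fin n,
      MultiSym.toSeries n (plethysm (alphabetA n (n - 1 - k) (reverseIndex_lt k)) (f k))) = 1 := h2
  rwa [h4, one_smul] at h3

/-! ### The scalar product in the power sums of unions of alphabets -/

/-- The contribution of the component indexed by `k` to the norm of a product of power sums. -/
noncomputable def normFactor (n k : ℕ) (la : Par) : K :=
  q ^ ((n - 1 - k) * la.size) * la.z * if k + 1 = n then la.ratio q t else 1

/-- The factor by which a further part `r` in the component indexed by `k` changes the norm, up to
the multiplicity of `r`. -/
noncomputable def normWeight (n k : ℕ) (r : ℕ+) : K :=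
  (r : ℕ) * ((q ^ (r : ℕ)) ^ (n - 1 - k) *
    if k + 1 = n then (1 - q ^ (r : ℕ)) / (1 - t ^ (r : ℕ)) else 1)

theorem q_pow_ne_one (r : ℕ+) : q ^ (r : ℕ) ≠ 1 := by
  have h := (genericParameters_param (n := 1) (k := 0) one_pos).left_pow_ne_one r
  simpa [firstParam] using h

theorem t_pow_ne_one (r : ℕ+) : t ^ (r : ℕ) ≠ 1 := by
  have h := (genericParameters_param (n := 1) (k := 0) one_pos).right_pow_ne_one r
  simpa [secondParam] using h

theorem q_ne_zero : q ≠ 0 := by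
  simpa [qt] using qt_ne_zero 1 0

theorem MultiPar.zqt_eq_prod {n : ℕ} (la : MultiPar n) :
    la.zqt = ∏ k : Fin n, normFactor n k (la k) := by
  have h : la.qExponent = ((∑ k : Fin n, (n - 1 - k) * (la k).size : ℕ) : ℤ) := by
    rw [MultiPar.qExponent, Finset.mul_sum, ← Finset.sum_sub_distrib, Nat.cast_sum]
    refine Finset.sum_congr rfl fun k _ => ?_
    have hk : (k : ℕ) + 1 ≤ n := k.2
    push_cast [Nat.sub_sub, Nat.cast_sub (show 1 + (k : ℕ) ≤ n by omega)]
    ring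
  rw [MultiPar.zqt, h, zpow_natCast, ← Finset.prod_pow_eq_pow_sum, ← Finset.prod_mul_distrib,
    ← Finset.prod_mul_distrib]
  rfl

theorem normFactor_ne_zero (n k : ℕ) (la : Par) : normFactor n k la ≠ 0 := by
  rw [normFactor]
  refine mul_ne_zero (mul_ne_zero (pow_ne_zero _ q_ne_zero) (Par.z_ne_zero la)) ?_
  split_ifs
  · exact Par.ratio_ne_zero q_pow_ne_one t_pow_ne_one la
  · exact one_ne_zero

theorem normFactor_cons (n k : ℕ) (r : ℕ+) (la : Par) :
    normFactor n k (r ::ₘ la) = ((la.count r : K) + 1) * normWeight n k r * normFactor n k la := by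
  have h : Par.size (r ::ₘ la) = r + la.size := by simp [Par.size]
  rw [normFactor, normFactor, normWeight, h, Par.z_cons, Par.ratio_cons, mul_add, pow_add,
    ← pow_mul q (r : ℕ), mul_comm (r : ℕ) (n - 1 - k)]
  push_cast
  split_ifs <;> ring

theorem count_exponentEquiv {n : ℕ} (α : Fin n × ℕ+ →₀ ℕ) (k : Fin n) (r : ℕ+) :
    (MultiPar.exponentEquiv n α k).count r = α (k, r) := by
  rw [← Multiset.toFinsupp_apply]
  simp [MultiPar.exponentEquiv, Finsupp.curryEquiv]

theorem exponentEquiv_add_single {n : ℕ} (α : Fin n × ℕ+ →₀ ℕ) (j k : Fin n) (r : ℕ+) :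
    MultiPar.exponentEquiv n (α + Finsupp.single (j, r) 1) k =
      if k = j then r ::ₘ MultiPar.exponentEquiv n α k else MultiPar.exponentEquiv n α k := by
  classical
  ext s
  rw [count_exponentEquiv, Finsupp.add_apply, Finsupp.single_apply]
  split_ifs with h1 h2 h3
  · obtain ⟨rfl, rfl⟩ := Prod.mk.inj h1
    rw [Multiset.count_cons_self, count_exponentEquiv]
  · exact absurd (Prod.mk.inj h1).1.symm h2
  · subst h3
    rw [Multiset.count_cons_of_ne (fun h => h1 (by rw [h])), count_exponentEquiv, add_zero]
  · rw [count_exponentEquiv, add_zero]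

theorem zqt_exponentEquiv_add_single {n : ℕ} (α : Fin n × ℕ+ →₀ ℕ) (v : Fin n × ℕ+) :
    (MultiPar.exponentEquiv n (α + Finsupp.single v 1)).zqt =
      ((α v : K) + 1) * normWeight n v.1 v.2 * (MultiPar.exponentEquiv n α).zqt := by
  classical
  obtain ⟨j, r⟩ := v
  rw [MultiPar.zqt_eq_prod, MultiPar.zqt_eq_prod, ← Finset.mul_prod_erase _ _ (Finset.mem_univ j),
    ← Finset.mul_prod_erase Finset.univ (fun k : Fin n => normFactor n k (MultiPar.exponentEquiv n α k))
      (Finset.mem_univ j), exponentEquiv_add_single, if_pos rfl, normFactor_cons,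
    count_exponentEquiv, ← mul_assoc]
  congr 1
  refine Finset.prod_congr rfl fun k hk => ?_
  rw [exponentEquiv_add_single, if_neg (Finset.ne_of_mem_erase hk)]

/-- The scalar product, with the power sums of the unions `x^{(1)}, …, x^{(k)}` as variables. -/
noncomputable def unionScalar (n : ℕ) : MultiSym n →ₗ[K] MultiSym n →ₗ[K] K :=
  (MultiSym.scalar n).compl₁₂ (MultiSym.unionEquiv n).toLinearMap (MultiSym.unionEquiv n).toLinearMap

theorem unionScalar_apply {n : ℕ} (f h : MultiSym n) :
    unionScalar n f h =
      MultiSym.scalar n (MultiSym.unionEquiv n f) (MultiSym.unionEquiv n h) := rfl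

open Classical in
theorem unionScalar_monomial {n : ℕ} (α β : Fin n × ℕ+ →₀ ℕ) :
    unionScalar n (MvPolynomial.monomial α 1) (MvPolynomial.monomial β 1) =
      if α = β then (MultiPar.exponentEquiv n α).zqt else 0 := by
  have h : ∀ γ : Fin n × ℕ+ →₀ ℕ, MultiSym.unionEquiv n (MvPolynomial.monomial γ 1) =
      MultiSym.p (MultiPar.exponentEquiv n γ) := fun γ => by
    rw [← MultiSym.pBasis_apply]
    simp [MultiSym.pBasis]
  rw [unionScalar_apply, h, h, MultiSym.scalar_p]
  simp only [EmbeddingLike.apply_eq_iff_eq]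

theorem scalar_nondegenerate {n : ℕ} (x : MultiSym n) (hx : ∀ y, MultiSym.scalar n x y = 0) :
    x = 0 := by
  classical
  have h := eq_zero_of_diagonal (B := unionScalar n) unionScalar_monomial
    (fun α => by
      rw [MultiPar.zqt_eq_prod]
      exact Finset.prod_ne_zero_iff.2 fun k _ => normFactor_ne_zero n k _)
    ((MultiSym.unionEquiv n).symm x) (fun y => by
      rw [unionScalar_apply, AlgEquiv.apply_symm_apply, hx])
  simpa using h

/-! ### Orthogonality of the alphabets `A_0, …, A_{n-1}` -/

/-- Gram–Schmidt orthogonalization of the differences `e_i - e_{i+1}` of orthogonal vectors: since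
only neighbouring differences fail to be orthogonal, each step involves the previous vector only. -/
theorem gram_of_recursion {V : Type*} [AddCommGroup V] [Module K V] {G : V →ₗ[K] V →ₗ[K] K}
    (hsymm : ∀ u v, G u v = G v u) {e v : ℕ → V} {c W M : ℕ → K} {n : ℕ}
    (hG : ∀ i j, G (e i) (e j) = if i = j then W i else 0)
    (hv0 : v 0 = e 0 - e 1) (hv : ∀ i, v (i + 1) = e (i + 1) - e (i + 2) + c i • v i)
    (hM0 : M 0 = W 0 + W 1) (hc : ∀ i, i + 1 < n → c i * M i = W (i + 1))
    (hM : ∀ i, i + 1 < n → M (i + 1) = W (i + 1) + W (i + 2) - c i * W (i + 1)) :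
    ∀ i j, i < n → j < n → G (v i) (v j) = if i = j then M i else 0 := by
  have h1 : ∀ i j, i + 1 < j → G (v i) (e j) = 0 := by
    intro i
    induction i with
    | zero =>
      intro j hj
      rw [hv0, map_sub, LinearMap.sub_apply, hG, hG, if_neg (by omega), if_neg (by omega), sub_zero]
    | succ i ih =>
      intro j hj
      rw [hv, map_add, map_sub, map_smul, LinearMap.add_apply, LinearMap.sub_apply,
        LinearMap.smul_apply, hG, hG, if_neg (by omega), if_neg (by omega), ih j (by omega)]
      simp
  have h2 : ∀ i, G (v i) (e (i + 1)) = -W (i + 1) := by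
    intro i
    cases i with
    | zero =>
      rw [hv0, map_sub, LinearMap.sub_apply, hG, hG, if_neg (by omega), if_pos rfl, zero_sub]
    | succ i =>
      rw [hv, map_add, map_sub, map_smul, LinearMap.add_apply, LinearMap.sub_apply,
        LinearMap.smul_apply, hG, hG, if_neg (by omega), if_pos rfl, h1 i _ (by omega)]
      simp
  have h3 : ∀ i, i < n → G (v i) (v i) = M i := by
    intro i
    induction i with
    | zero =>
      intro _
      rw [hM0]
      simp only [hv0, map_sub, LinearMap.sub_apply, hG]
      norm_num
    | succ i ih =>
      intro hi
      have h4 := ih (by omega)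
      have h5 := hc i hi
      have h6 := h2 i
      have h7 := h1 i (i + 2) (by omega)
      rw [hM i hi, hv]
      simp only [map_sub, map_add, map_smul, LinearMap.sub_apply, LinearMap.add_apply,
        LinearMap.smul_apply, hG, smul_eq_mul, hsymm (e (i + 1)) (v i), hsymm (e (i + 2)) (v i),
        h4, h6, h7]
      rw [if_pos trivial, if_pos trivial, if_neg (by omega), if_neg (by omega)]
      linear_combination c i * h5
  have h4 : ∀ i d, i + d + 1 < n → G (v i) (v (i + d + 1)) = 0 := by
    intro i d
    induction d with
    | zero =>
      intro hi
      rw [add_zero] at hi ⊢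
      rw [hv, map_add, map_sub, map_smul, h2, h1 i _ (by omega), h3 i (by omega), smul_eq_mul,
        hc i hi]
      ring
    | succ d ih =>
      intro hi
      have h5 := ih (by omega)
      rw [show i + (d + 1) + 1 = (i + d + 1) + 1 by ring, hv, map_add, map_sub, map_smul, h5,
        h1 i _ (by omega), h1 i _ (by omega)]
      simp
  intro i j hi hj
  rcases lt_trichotomy i j with h | rfl | h
  · obtain ⟨d, rfl⟩ := Nat.exists_eq_add_of_lt h
    rw [if_neg h.ne, h4 i d hj]
  · rw [if_pos rfl, h3 i hi]
  · obtain ⟨d, rfl⟩ := Nat.exists_eq_add_of_lt h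
    rw [if_neg h.ne', hsymm, h4 j d hi]

section LinearForms

variable {n : ℕ}

/-- The linear form `∑_j u_j p_r(x^{(1)}, …, x^{(j+1)})`, with the power sums of unions as
variables. -/
noncomputable def linearForm (r : ℕ+) (u : Fin n → K) : MultiSym n :=
  ∑ j, u j • MvPolynomial.X (j, r)

/-- The scalar product of linear forms. -/
noncomputable def gramForm (n : ℕ) (r : ℕ+) : (Fin n → K) →ₗ[K] (Fin n → K) →ₗ[K] K :=
  LinearMap.mk₂ K (fun u v => ∑ j, u j * (normWeight n j r * v j))
    (fun u u' v => by simp [add_mul, Finset.sum_add_distrib])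
    (fun c u v => by simp [Finset.mul_sum, mul_assoc])
    (fun u v v' => by simp [mul_add, Finset.sum_add_distrib])
    (fun c u v => by
      rw [smul_eq_mul, Finset.mul_sum]
      refine Finset.sum_congr rfl fun j _ => ?_
      rw [Pi.smul_apply, smul_eq_mul]
      ring)

theorem gramForm_apply (r : ℕ+) (u v : Fin n → K) :
    gramForm n r u v = ∑ j : Fin n, u j * (normWeight n j r * v j) := rfl

/-- The derivation adjoint to multiplication by a linear form. -/
noncomputable def adjointDerivation (r : ℕ+) (u : Fin n → K) :
    Derivation K (MultiSym n) (MultiSym n) :=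
  ∑ j : Fin n, (u j * normWeight n j r) • MvPolynomial.pderiv (j, r)

theorem adjointDerivation_apply (r : ℕ+) (u : Fin n → K) (f : MultiSym n) :
    adjointDerivation r u f =
      ∑ j : Fin n, (u j * normWeight n j r) • MvPolynomial.pderiv (j, r) f := by
  rw [adjointDerivation, ← Derivation.coeFnAddMonoidHom_apply, map_sum, Finset.sum_apply]
  rfl

theorem adjointDerivation_linearForm (r s : ℕ+) (u v : Fin n → K) :
    adjointDerivation r u (linearForm s v) =
      if r = s then MvPolynomial.C (gramForm n r u v) else 0 := by
  classical
  have h : ∀ j : Fin n, MvPolynomial.pderiv (j, r) (linearForm s v) =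
      if r = s then MvPolynomial.C (v j) else 0 := by
    intro j
    rw [linearForm, map_sum, Finset.sum_eq_single j]
    · rw [Derivation.map_smul, MvPolynomial.pderiv_X, Pi.single_apply]
      simp only [Prod.mk.injEq, true_and, eq_comm]
      split_ifs
      · simp [MvPolynomial.smul_eq_C_mul]
      · simp
    · intro i _ hi
      rw [Derivation.map_smul, MvPolynomial.pderiv_X, Pi.single_apply, if_neg, smul_zero]
      exact fun h => hi (Prod.mk.inj h).1
    · exact fun h => absurd (Finset.mem_univ _) h
  rw [adjointDerivation_apply]
  simp only [h]
  split_ifs with hrs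
  · rw [gramForm_apply, map_sum]
    refine Finset.sum_congr rfl fun j _ => ?_
    rw [MvPolynomial.smul_eq_C_mul, ← map_mul, mul_assoc]
  · simp

theorem unionScalar_linearForm_mul (r : ℕ+) (u : Fin n → K) (f h : MultiSym n) :
    unionScalar n (linearForm r u * f) h = unionScalar n f (adjointDerivation r u h) := by
  classical
  rw [linearForm, Finset.sum_mul, map_sum, LinearMap.sum_apply, adjointDerivation_apply, map_sum]
  refine Finset.sum_congr rfl fun j _ => ?_
  rw [smul_mul_assoc, map_smul, LinearMap.smul_apply, map_smul,
    X_mul_adjoint_of_diagonal (B := unionScalar n) unionScalar_monomial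
      (w := fun v => normWeight n v.1 v.2) zqt_exponentEquiv_add_single, smul_eq_mul, smul_eq_mul,
    mul_assoc]

theorem unionScalar_mul_linearForm (r : ℕ+) (u : Fin n → K) (f h : MultiSym n) :
    unionScalar n f (linearForm r u * h) = unionScalar n (adjointDerivation r u f) h := by
  classical
  rw [linearForm, Finset.sum_mul, map_sum, adjointDerivation_apply, map_sum, LinearMap.sum_apply]
  refine Finset.sum_congr rfl fun j _ => ?_
  rw [smul_mul_assoc, map_smul, map_smul, LinearMap.smul_apply,
    X_mul_adjoint_of_diagonal' (B := unionScalar n) unionScalar_monomial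
      (w := fun v => normWeight n v.1 v.2) zqt_exponentEquiv_add_single, smul_eq_mul, smul_eq_mul,
    mul_assoc]

/-- The power sum of the union of all but the last `i` alphabets, as a vector; it is zero for
`i ≥ n`. -/
noncomputable def unionVector (n i : ℕ) (j : Fin n) : K := if (j : ℕ) + i + 1 = n then 1 else 0

theorem unionVector_of_lt {i : ℕ} (hi : i < n) :
    unionVector n i = Pi.single ⟨n - 1 - i, by omega⟩ 1 := by
  classical
  funext j
  rw [unionVector, Pi.single_apply]
  congr 1
  rw [Fin.ext_iff]
  apply propext
  simp only
  omega

theorem unionVector_of_le {i : ℕ} (hi : n ≤ i) : unionVector n i = 0 := by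
  funext j
  rw [unionVector, if_neg (by omega), Pi.zero_apply]

theorem gramForm_unionVector (r : ℕ+) (i j : ℕ) :
    gramForm n r (unionVector n i) (unionVector n j) =
      if i = j then (if i < n then normWeight n (n - 1 - i) r else 0) else 0 := by
  classical
  by_cases hi : i < n
  · rw [unionVector_of_lt hi, gramForm_apply, Finset.sum_eq_single ⟨n - 1 - i, by omega⟩]
    · rw [Pi.single_eq_same, one_mul, unionVector, if_pos hi]
      simp only
      split_ifs <;> first | omega | simp
    · intro l _ hl
      rw [Pi.single_eq_of_ne hl, zero_mul]
    · exact fun h => absurd (Finset.mem_univ _) h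
  · rw [unionVector_of_le (not_lt.1 hi), map_zero, LinearMap.zero_apply, if_neg hi, ite_self]

/-- The coefficient `q^r (1 - q^{ri} t^r) / (1 - q^{r(i+1)} t^r)` of the recursion for `p_r[A_i]`. -/
noncomputable def recursionCoeff (r : ℕ+) (i : ℕ) : K :=
  adamsK r (q * (1 - q ^ i * t) / (1 - q ^ (i + 1) * t))

/-- The power sum `p_r[A_i]` as a vector. -/
noncomputable def alphabetVector (n : ℕ) (r : ℕ+) : ℕ → Fin n → K
  | 0 => unionVector n 0 - unionVector n 1
  | i + 1 => unionVector n (i + 1) - unionVector n (i + 2) +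
      recursionCoeff r i • alphabetVector n r i

theorem linearForm_add (r : ℕ+) (u v : Fin n → K) :
    linearForm r (u + v) = linearForm r u + linearForm r v := by
  simp [linearForm, add_smul, Finset.sum_add_distrib]

theorem linearForm_smul (r : ℕ+) (c : K) (u : Fin n → K) :
    linearForm r (c • u) = c • linearForm r u := by
  simp [linearForm, mul_smul, Finset.smul_sum]

theorem linearForm_zero (r : ℕ+) : linearForm r (0 : Fin n → K) = 0 := by
  simp [linearForm]

theorem linearForm_unionVector (r : ℕ+) {i : ℕ} (hi : i < n) :
    linearForm r (unionVector n i) = MvPolynomial.X (⟨n - 1 - i, by omega⟩, r) := by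
  classical
  rw [unionVector_of_lt hi, linearForm, Finset.sum_eq_single ⟨n - 1 - i, by omega⟩]
  · simp
  · intro j _ hj
    rw [Pi.single_eq_of_ne hj, zero_smul]
  · exact fun h => absurd (Finset.mem_univ _) h

theorem unionEquiv_linearForm_sub (r : ℕ+) {i : ℕ} (hi : i < n) :
    MultiSym.unionEquiv n (linearForm r (unionVector n i - unionVector n (i + 1))) =
      MvPolynomial.X (⟨n - 1 - i, by omega⟩, r) := by
  have h1 : linearForm r (unionVector n i - unionVector n (i + 1)) =
      MultiSym.pDiff ⟨n - 1 - i, by omega⟩ r := by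
    rw [sub_eq_add_neg, ← neg_one_smul K, linearForm_add, linearForm_smul, neg_one_smul,
      ← sub_eq_add_neg, linearForm_unionVector r hi, MultiSym.pDiff]
    congr 1
    split_ifs with h
    · simp only at h
      rw [linearForm_unionVector r (show i + 1 < n by omega)]
      congr 3
    · simp only at h
      rw [unionVector_of_le (show n ≤ i + 1 by omega), linearForm_zero]
  have h2 : (MultiSym.unionEquiv n).symm (MvPolynomial.X (⟨n - 1 - i, by omega⟩, r)) =
      MultiSym.pDiff ⟨n - 1 - i, by omega⟩ r := by
    simp [MultiSym.unionEquiv]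
  rw [h1, ← h2, AlgEquiv.apply_symm_apply]

theorem adams_alphabetA (r : ℕ+) (i : ℕ) (hi : i < n) :
    adams r (alphabetA n i hi) =
      MultiSym.unionEquiv n (linearForm r (alphabetVector n r i)) := by
  induction i with
  | zero =>
    rw [alphabetA, alphabetVector, unionEquiv_linearForm_sub r hi, adams_alphabetSum]
    simp
  | succ i ih =>
    have h5 : ∀ c : K, adams r (MvPolynomial.C c : MultiSym n) =
        MvPolynomial.C (adamsK r c) := fun c => by simp [adams]
    rw [alphabetA, alphabetVector, map_add, map_mul, h5, ih (by omega), adams_alphabetSum, linearForm_add,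
      linearForm_smul, map_add, unionEquiv_linearForm_sub r hi, map_smul,
      MvPolynomial.smul_eq_C_mul, recursionCoeff]

/-- The power sums `p_r[A_i]` are orthogonal, and their norms are those of the power sums for the
scalar products of the corresponding Macdonald polynomials, up to the power `q^{ri}`. -/
theorem gramForm_alphabetVector (r : ℕ+) (i j : ℕ) (hi : i < n) (hj : j < n) :
    gramForm n r (alphabetVector n r i) (alphabetVector n r j) =
      if i = j then (r : ℕ) * ((q ^ i) ^ (r : ℕ) *
        ((1 - firstParam n (n - 1 - i) ^ (r : ℕ)) / (1 - secondParam n (n - 1 - i) ^ (r : ℕ))))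
      else 0 := by
  set Q := q ^ (r : ℕ) with hQ
  set T := t ^ (r : ℕ) with hT
  have hne : ∀ i : ℕ, 1 - Q ^ i * T ≠ 0 := by
    intro i h
    have h1 := (genericParameters_param (n := i + 1) (k := 0) i.succ_pos).right_pow_ne_one r
    apply h1
    rw [secondParam, mul_pow, ← pow_mul, mul_comm, pow_mul]
    simpa [hQ, hT, ← pow_mul, mul_comm] using (sub_eq_zero.1 h).symm
  have hb : ∀ i, i < n → secondParam n (n - 1 - i) ^ (r : ℕ) = Q ^ i * T := by
    intro i hi
    rw [secondParam, mul_pow, ← pow_mul, mul_comm _ (r : ℕ), pow_mul,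
      show n - 1 - (n - 1 - i) = i by omega]
  have ha : ∀ i, i < n → firstParam n (n - 1 - i) ^ (r : ℕ) =
      if i + 1 = n then Q else Q ^ (i + 1) * T := by
    intro i hi
    rw [firstParam]
    split_ifs
    · rfl
    · omega
    · omega
    · rw [mul_pow, ← pow_mul, mul_comm _ (r : ℕ), pow_mul, show n - (n - 1 - i) = i + 1 by omega]
  have hc : ∀ i, recursionCoeff r i = Q * (1 - Q ^ i * T) / (1 - Q ^ (i + 1) * T) := by
    intro i
    rw [recursionCoeff]
    simp only [map_div₀, map_mul, map_sub, map_one, map_pow, adamsK_q, adamsK_t, hQ, hT]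
  let W : ℕ → K := fun i => if i < n then normWeight n (n - 1 - i) r else 0
  have hW0 : 0 < n → W 0 = r * ((1 - Q) / (1 - T)) := by
    intro h
    simp only [W, if_pos h, normWeight]
    rw [if_pos (by omega), show n - 1 - (n - 1 - 0) = 0 by omega, pow_zero, one_mul]
  have hW : ∀ i, i + 1 < n → W (i + 1) = r * Q ^ (i + 1) := by
    intro i h
    simp only [W, if_pos h, normWeight]
    rw [if_neg (by omega), show n - 1 - (n - 1 - (i + 1)) = i + 1 by omega, mul_one]
  have hW' : ∀ i, n ≤ i → W i = 0 := fun i h => if_neg (by omega)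
  have key := gram_of_recursion (G := gramForm n r) (n := n) (e := unionVector n)
    (v := alphabetVector n r) (W := W) (c := recursionCoeff r)
    (M := fun i => r * (Q ^ i * ((1 - if i + 1 = n then Q else Q ^ (i + 1) * T) /
      (1 - Q ^ i * T))))
    (fun u v => by
      rw [gramForm_apply, gramForm_apply]
      exact Finset.sum_congr rfl fun j _ => by ring)
    (gramForm_unionVector r) rfl (fun _ => rfl)
    (by
      have h0 := hne 0
      rw [pow_zero, one_mul] at h0
      rw [hW0 (by omega)]
      simp only [pow_zero, one_mul, zero_add, pow_one]
      split_ifs with h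
      · rw [hW' 1 (by omega), add_zero]
      · rw [hW 0 (by omega), zero_add, pow_one]
        field_simp
        ring)
    (fun i h => by
      have h0 := hne i
      have h1 := hne (i + 1)
      rw [hW i h, hc, if_neg (by omega)]
      generalize 1 - Q ^ i * T = x at h0 ⊢
      generalize 1 - Q ^ (i + 1) * T = y at h1 ⊢
      field_simp
      ring)
    (fun i h => by
      have h1 := hne (i + 1)
      rw [hW i h, hc]
      split_ifs with h2
      · rw [hW' (i + 2) (by omega)]
        field_simp
        ring
      · rw [hW (i + 1) (by omega)]
        field_simp
        ring) i j hi hj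
  rw [key, ha i hi, hb i hi, ← pow_mul q i, mul_comm i, pow_mul q (r : ℕ)]

end LinearForms

/-! ### Orthogonality of products of plethysms -/

section Orthogonality

variable {n : ℕ}

/-- The substitution `p_r(x^{(k+1)}) ↦ p_r[A_{n-1-k}]`, with values in the polynomials in the power
sums of unions of alphabets. -/
noncomputable def alphabetHom (n : ℕ) : MultiSym n →ₐ[K] MultiSym n :=
  MvPolynomial.aeval fun v => linearForm v.2 (alphabetVector n v.2 (n - 1 - v.1))

theorem alphabetHom_X (v : Fin n × ℕ+) : alphabetHom n (MvPolynomial.X v) =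
    linearForm v.2 (alphabetVector n v.2 (n - 1 - v.1)) := by
  rw [alphabetHom, MvPolynomial.aeval_X]

theorem plethysm_alphabetA (k : Fin n) (f : Sym) :
    plethysm (alphabetA n (n - 1 - k) (reverseIndex_lt k)) f =
      MultiSym.unionEquiv n (alphabetHom n (colorHom k f)) := by
  have h : plethysm (alphabetA n (n - 1 - k) (reverseIndex_lt k)) =
      ((MultiSym.unionEquiv n).toAlgHom.comp (alphabetHom n)).comp (colorHom k) := by
    ext1 r
    rw [plethysm, MvPolynomial.aeval_X, adams_alphabetA]
    simp [colorHom_X, alphabetHom_X]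
  rw [h]
  rfl

/-- The norm of `p_r[A_{n-1-k}]`. -/
noncomputable def alphabetNorm (n k : ℕ) (r : ℕ+) : K :=
  (r : ℕ) * ((q ^ (n - 1 - k)) ^ (r : ℕ) *
    ((1 - firstParam n k ^ (r : ℕ)) / (1 - secondParam n k ^ (r : ℕ))))

theorem adjointDerivation_alphabetHom (k : Fin n) (r : ℕ+) (f : MultiSym n) :
    adjointDerivation r (alphabetVector n r (n - 1 - k)) (alphabetHom n f) =
      alphabetNorm n k r • alphabetHom n (MvPolynomial.pderiv (k, r) f) := by
  classical
  induction f using MvPolynomial.induction_on with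
  | C c =>
    have h : alphabetHom n (MvPolynomial.C c) = algebraMap K (MultiSym n) c := by
      rw [← MvPolynomial.algebraMap_eq, AlgHom.commutes]
    rw [h, Derivation.map_algebraMap, MvPolynomial.pderiv_C, map_zero, smul_zero]
  | add f g hf hg => rw [map_add, map_add, hf, hg, map_add, map_add, smul_add]
  | mul_X f v hf =>
    obtain ⟨i, s⟩ := v
    have h1 : adjointDerivation r (alphabetVector n r (n - 1 - k))
        (alphabetHom n (MvPolynomial.X (i, s))) =
          alphabetNorm n k r • alphabetHom n
            (MvPolynomial.pderiv (k, r) (MvPolynomial.X (i, s) : MultiSym n)) := by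
      rw [alphabetHom_X, adjointDerivation_linearForm, MvPolynomial.pderiv_X, Pi.single_apply]
      by_cases hrs : r = s
      · subst hrs
        rw [if_pos rfl, gramForm_alphabetVector r _ _ (by omega) (by omega)]
        by_cases hik : i = k
        · subst hik
          rw [if_pos rfl, if_pos rfl, map_one, MvPolynomial.smul_eq_C_mul, mul_one, alphabetNorm]
          rw [show n - 1 - (n - 1 - (i : ℕ)) = i by omega]
        · have h2 : n - 1 - (k : ℕ) ≠ n - 1 - i := fun h => hik (by ext; omega)
          rw [if_neg h2, if_neg (fun h => hik (Prod.mk.inj h).1), map_zero, map_zero, smul_zero]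
      · rw [if_neg hrs, if_neg (fun h => hrs (Prod.mk.inj h).2.symm), map_zero, smul_zero]
    rw [map_mul, Derivation.leibniz, Derivation.leibniz, h1, hf, map_add, smul_eq_mul, smul_eq_mul,
      smul_eq_mul, smul_eq_mul, map_mul, map_mul, smul_add, mul_smul_comm, mul_smul_comm]

/-- The scalar product of substitutions of symmetric functions into `A_{n-1-k}`, each multiplied by
a fixed function of the other alphabets. -/
noncomputable def colorScalar (k : Fin n) (F G : MultiSym n) : Sym →ₗ[K] Sym →ₗ[K] K :=
  (unionScalar n).compl₁₂
    ((alphabetHom n).toLinearMap ∘ₗ LinearMap.mulRight K F ∘ₗ (colorHom k).toLinearMap)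
    ((alphabetHom n).toLinearMap ∘ₗ LinearMap.mulRight K G ∘ₗ (colorHom k).toLinearMap)

theorem colorScalar_apply (k : Fin n) (F G : MultiSym n) (f g : Sym) :
    colorScalar k F G f g =
      unionScalar n (alphabetHom n (colorHom k f * F)) (alphabetHom n (colorHom k g * G)) := rfl

theorem pderiv_colorHom_mul (k : Fin n) (r : ℕ+) (f : Sym) {F : MultiSym n}
    (hF : ∀ r, MvPolynomial.pderiv (k, r) F = 0) :
    MvPolynomial.pderiv (k, r) (colorHom k f * F) =
      colorHom k (MvPolynomial.pderiv r f) * F := by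
  have h1 : MvPolynomial.pderiv (k, r) (colorHom k f) = colorHom k (MvPolynomial.pderiv r f) :=
    MvPolynomial.pderiv_rename (f := fun s : ℕ+ => (k, s)) (fun a b h => by simpa using h) r f
  rw [Derivation.leibniz, hF, h1, smul_zero, zero_add, smul_eq_mul, mul_comm]

theorem colorScalar_X_mul (k : Fin n) {F G : MultiSym n}
    (hG : ∀ r, MvPolynomial.pderiv (k, r) G = 0) (r : ℕ+) (f g : Sym) :
    colorScalar k F G (MvPolynomial.X r * f) g =
      alphabetNorm n k r * colorScalar k F G f (MvPolynomial.pderiv r g) := by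
  rw [colorScalar_apply, colorScalar_apply, map_mul (colorHom k), colorHom_X, mul_assoc,
    map_mul (alphabetHom n) (MvPolynomial.X (k, r)), alphabetHom_X, unionScalar_linearForm_mul,
    adjointDerivation_alphabetHom, pderiv_colorHom_mul k r g hG, map_smul, smul_eq_mul]

theorem colorScalar_mul_X (k : Fin n) {F G : MultiSym n}
    (hF : ∀ r, MvPolynomial.pderiv (k, r) F = 0) (r : ℕ+) (f g : Sym) :
    colorScalar k F G f (MvPolynomial.X r * g) =
      alphabetNorm n k r * colorScalar k F G (MvPolynomial.pderiv r f) g := by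
  rw [colorScalar_apply, colorScalar_apply, map_mul (colorHom k), colorHom_X, mul_assoc,
    map_mul (alphabetHom n) (MvPolynomial.X (k, r)), alphabetHom_X, unionScalar_mul_linearForm,
    adjointDerivation_alphabetHom, pderiv_colorHom_mul k r f hF, map_smul, LinearMap.smul_apply,
    smul_eq_mul]

/-- Eigenvectors of the Macdonald operator for different eigenvalues give orthogonal products. -/
theorem colorScalar_eq_zero (k : Fin n) {F G : MultiSym n}
    (hF : ∀ r, MvPolynomial.pderiv (k, r) F = 0) (hG : ∀ r, MvPolynomial.pderiv (k, r) G = 0)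
    {la mu : Par} (hne : la ≠ mu) :
    colorScalar k F G (macdonald (firstParam n k) (secondParam n k) la)
      (macdonald (firstParam n k) (secondParam n k) mu) = 0 := by
  have h := genericParameters_param k.2
  have h1 := Sym.operator_selfAdjoint (colorScalar_X_mul k (F := F) hG)
    (colorScalar_mul_X k (G := G) hF) (fun r => h.weight_relation (q ^ (n - 1 - (k : ℕ))) r)
    (macdonald (firstParam n k) (secondParam n k) la)
    (macdonald (firstParam n k) (secondParam n k) mu)
  rw [(macdonald_spec h la).2, (macdonald_spec h mu).2, map_smul, map_smul, LinearMap.smul_apply,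
    smul_eq_mul, smul_eq_mul, ← sub_eq_zero, ← sub_mul] at h1
  exact (mul_eq_zero.1 h1).resolve_left
    (sub_ne_zero.2 fun heq => hne (h.eigenvalue_injective heq))

theorem pderiv_prod_colorHom (k : Fin n) (r : ℕ+) (f : Fin n → Sym) :
    MvPolynomial.pderiv (k, r) (∏ i ∈ Finset.univ.erase k, colorHom i (f i)) = 0 := by
  classical
  refine Finset.prod_induction _ (fun F : MultiSym n => MvPolynomial.pderiv (k, r) F = 0) ?_ ?_ ?_
  · intro F G hF hG
    rw [Derivation.leibniz, hF, hG, smul_zero, smul_zero, add_zero]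
  · exact Derivation.map_one_eq_zero _
  · intro i hi
    refine MvPolynomial.pderiv_eq_zero_of_notMem_vars fun hmem => ?_
    obtain ⟨s, -, hs⟩ := Finset.mem_image.1 (MvPolynomial.vars_rename _ _ hmem)
    exact Finset.ne_of_mem_erase hi (Prod.mk.inj hs).1

/-- The product of plethysms of Macdonald polynomials. -/
noncomputable def macdonaldProduct (n : ℕ) (la : MultiPar n) : MultiSym n :=
  ∏ k : Fin n, plethysm (alphabetA n (n - 1 - k) (reverseIndex_lt k))
    (macdonald (firstParam n k) (secondParam n k) (la k))

theorem macdonaldProduct_eq (la : MultiPar n) : macdonaldProduct n la =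
    MultiSym.unionEquiv n (alphabetHom n
      (∏ k : Fin n, colorHom k (macdonald (firstParam n k) (secondParam n k) (la k)))) := by
  rw [map_prod, map_prod]
  exact Finset.prod_congr rfl fun k _ => plethysm_alphabetA k _

theorem scalar_macdonaldProduct {la mu : MultiPar n} (hne : la ≠ mu) :
    MultiSym.scalar n (macdonaldProduct n la) (macdonaldProduct n mu) = 0 := by
  obtain ⟨k, hk⟩ := Function.ne_iff.1 hne
  rw [macdonaldProduct_eq, macdonaldProduct_eq, ← unionScalar_apply,
    ← Finset.mul_prod_erase _ _ (Finset.mem_univ k),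
    ← Finset.mul_prod_erase Finset.univ (fun i : Fin n =>
      colorHom i (macdonald (firstParam n i) (secondParam n i) (mu i))) (Finset.mem_univ k),
    ← colorScalar_apply]
  exact colorScalar_eq_zero k (fun r => pderiv_prod_colorHom k r _)
    (fun r => pderiv_prod_colorHom k r _) hk

theorem macdonaldProduct_sub_m_mem (la : MultiPar n) :
    macdonaldProduct n la - MultiSym.m la ∈
      Submodule.span K (MultiSym.m '' {mu : MultiPar n | mu.Dominated la ∧ mu ≠ la}) :=
  prod_plethysm_sub_m_mem fun k => (macdonald_spec (genericParameters_param k.2) (la k)).1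

/-! ### The multi-Macdonald polynomials -/

theorem isMultiMacdonald_macdonaldProduct (n : ℕ) : IsMultiMacdonald n (macdonaldProduct n) where
  linearIndependent := linearIndependent_of_unitriangular MultiPar.rank_lt
    macdonaldProduct_sub_m_mem (MultiSym.linearIndependent_m n)
  span_eq_top := by
    have h1 := span_image_eq_of_unitriangular (S := Set.univ) MultiPar.rank_lt
      (macdonaldProduct_sub_m_mem (n := n)) (fun _ _ _ _ => Set.mem_univ _)
    rw [Set.image_univ, Set.image_univ] at h1
    rw [h1, MultiSym.span_m]
  triangular := fun la => by
    have h1 := Submodule.mem_map_of_mem (f := (MultiSym.toSeries n).toLinearMap)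
      (macdonaldProduct_sub_m_mem la)
    rw [Submodule.map_span, ← Set.image_comp] at h1
    have h2 : (MultiSym.toSeries n).toLinearMap ∘ MultiSym.m =
        (multiMonomialSeries : MultiPar n → _) := funext MultiSym.toSeries_m
    rw [h2, AlgHom.toLinearMap_apply, map_sub, MultiSym.toSeries_m] at h1
    exact h1
  orthogonal := fun _ _ => scalar_macdonaldProduct

theorem IsMultiMacdonald.unique {P Q : MultiPar n → MultiSym n} (hP : IsMultiMacdonald n P)
    (hQ : IsMultiMacdonald n Q) : P = Q :=
  eq_of_orthogonal_of_unitriangular (τ := (MultiSym.toSeries n).toLinearMap) MultiPar.rank_lt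
    MultiPar.strictDominated_trans (MultiSym.toSeries_injective n) scalar_nondegenerate
    hP.span_eq_top hP.triangular hQ.triangular hP.orthogonal hQ.orthogonal

theorem multiMacdonald_eq_macdonaldProduct (n : ℕ) : multiMacdonald n = macdonaldProduct n := by
  have hex : ∃ P, IsMultiMacdonald n P := ⟨_, isMultiMacdonald_macdonaldProduct n⟩
  rw [multiMacdonald, dif_pos hex]
  exact hex.choose_spec.unique (isMultiMacdonald_macdonaldProduct n)

end Orthogonality

end MultiMacdonald

theorem proposition2 (n : ℕ) (hn : 1 ≤ n) :
    (∃! P : MultiMacdonald.MultiPar n → MultiMacdonald.MultiSym n,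
        MultiMacdonald.IsMultiMacdonald n P) ∧
      (∀ k : Fin n, ∃! Q : MultiMacdonald.Par → MultiMacdonald.Sym,
        MultiMacdonald.IsMacdonald (MultiMacdonald.firstParam n k)
          (MultiMacdonald.secondParam n k) Q) ∧
      ∀ la : MultiMacdonald.MultiPar n,
        MultiMacdonald.multiMacdonald n la =
          ∏ k : Fin n,
            MultiMacdonald.plethysm (MultiMacdonald.alphabetA n (n - 1 - k) (by omega))
              (MultiMacdonald.macdonald (MultiMacdonald.firstParam n k)
                (MultiMacdonald.secondParam n k) (la k)) := by
  refine ⟨⟨_, MultiMacdonald.isMultiMacdonald_macdonaldProduct n, fun P hP =>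
    hP.unique (MultiMacdonald.isMultiMacdonald_macdonaldProduct n)⟩, fun k =>
      MultiMacdonald.existsUnique_isMacdonald (MultiMacdonald.genericParameters_param k.2),
    fun la => ?_⟩
  rw [MultiMacdonald.multiMacdonald_eq_macdonaldProduct, MultiMacdonald.macdonaldProduct]
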